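/- Let $p\ge 3$ be odd, $0\le L<p$ even, $t_0,\eta_0>0$. Let $S(t,\alpha)$ be $C^\infty$ on $[-t_0,t_0]\times\mathbb R$ with $S(t,0)=0$, such that every monomial $t^i\alpha^j$ in its Taylor expansion at the origin satisfies $i+(p-L+1)j>p+1$. Let $P(t,u,\alpha,\eta)$ be $C^\infty$ on $[-t_0,t_0]\times\mathbb R\times\mathbb R\times[0,\eta_0)$ and linear (affine) in $u$: $P(t,u,\alpha,\eta)=P_0(t,\alpha,\eta)+P_1(t,\alpha,\eta)\,u$. **The operator.** For a family $(\beta_\eta,v_\eta)$ indexed by small $\eta>0$, with $\beta_\eta\in\mathbb R$ and $v_\eta:[-t_0,t_0]\to\mathbb R$, let $\Xi_\eta(\beta_\eta,v_\eta)=(\alpha_\eta,u_\eta)$ be the solution, bounded as $\eta\to0^+$ (uniformly in $t\in[-t_0,t_0]$), of $$\eta^{p+2}\dot u_\eta=(p+1)\eta t^p u_\eta+\eta^{p-L+1}\alpha_\eta t^L+S(t,\eta^{p-L+1}\alpha_\eta)+\eta^{p+1}P(t,\eta v_\eta,\eta^{p-L+1}\beta_\eta,\eta),\qquad u_\eta(\pm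 t_0)=0.$$ The family $(\beta,v)$ is in the domain of $\Xi_\eta$ if such a bounded solution exists and any two of them coincide for all small $\eta>0$. A canard solution is a bounded family $(\alpha^*_\eta,u^*_\eta)$ with $\Xi_\eta(\alpha^*_\eta,u^*_\eta)=(\alpha^*_\eta,u^*_\eta)$ for all small $\eta>0$. **The formal spaces.** For $0\le k<p$, $k\ne L$, let $$\psi_k(T)=e^{T^{p+1}}\int_{+\infty}^T\Big(y^k-\frac{\int_{\mathbb R}z^ke^{-z^{p+1}}dz}{\int_{\mathbb R}z^Le^{-z^{p+1}}dz}\,y^L\Big)e^{-y^{p+1}}dy,$$ and let $\bar\psi_{i,k}(T)$ be $T^i\psi_k(T)$ minus the polynomial part of its expansion at $T\to\pm\infty$, so that $\bar\psi_{i,k}(T)\to0$ as $T\to\pm\infty$. Let $\mathcal C_n$ be the space of formal couples $$\Big(a\,\eta^n,\ \big(u(t)+\sum_{i=0}^n\ \sum_{0\le k<p,\,k\ne L}u_{i,k}\bar\psi_{i,k}\big)\eta^n\Big),\qquad a,u_{i,k}\in\mathbb R,\ u\in C^\infty([-t_0,t_0]),$$ where the $\bar\psi_{i,k}$ are treated as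 symbols. Let $\mathcal A_K=\bigoplus_{n\le K}\mathcal C_n$, let $\pi_K:\mathcal A_{K+1}\to\mathcal A_K$ be the projection, and let $\hat{\mathcal A}$ be the projective limit. For $c\in\mathcal A_K$, let $\tilde c$ be the family of couples obtained by substituting $\bar\psi_{i,k}(t/\eta)$ for the symbols. **Theorem 1.** There exists a sequence of maps $\Xi_K:\mathcal A_K\to\mathcal A_K$, $K\in\mathbb N$, such that: 1. (compatible) $\pi_K\circ\Xi_{K+1}=\Xi_K\circ\pi_K$ for all $K$; 2. (formally equivalent to $\Xi_\eta$) for all $(c_K)_K\in\hat{\mathcal A}$ and all $K$, the family $\tilde c_K$ is in the domain of $\Xi_\eta$, and $\Xi_\eta(\tilde c_K)-\widetilde{\Xi_K(c_K)}=o(\eta^K)$ as $\eta\to0^+$, uniformly in $t\in[-t_1,t_1]$ for every $0<t_1<t_0$; 3. there is a canard solution $(\alpha^*,u^*)$, any other one coincides with it for all small $\eta>0$, and there is $(c_K)_K\in\hat{\mathcal A}$ with $\Xi_K(c_K)=c_K$ for all $K$ that is a semi-asymptotic expansion of it: for all $K$ and every $0<t_1<t_0$, $(\alpha^*,u^*)-\tilde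 c_K=O(\eta^{K+1})$ as $\eta\to0^+$, uniformly in $t\in[-t_1,t_1]$. -/

import Mathlib

open Filter Topology Set
open scoped ContDiff

/-- The data of the singularly perturbed equation
`η^(p+1) u' = (p+1) t^p u + α t^L + S(t, α) + η^(p+1) P(t, u, α, η)`,
`t ∈ [-t₀, t₀]`, `η ∈ ]0, η₀[`, with control parameter `α`. -/
structure CanardData where
  p : ℕ
  L : ℕ
  t₀ : ℝ
  η₀ : ℝ
  S : ℝ → ℝ → ℝ
  P : ℝ → ℝ → ℝ → ℝ → ℝ

/-- A family of couples indexed by `η`: the component `.1` is `η ↦ α_η`, the component `.2` is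
`η ↦ (t ↦ u_η(t))`. Only small `η > 0` and `t ∈ [-t₀, t₀]` are relevant. -/
abbrev CoupleFamily : Type := (ℝ → ℝ) × (ℝ → ℝ → ℝ)

/-- The real vector space `C^∞([-r, r])`. -/
def smoothFunctions (r : ℝ) : Submodule ℝ (Icc (-r) r → ℝ) where
  carrier := {f | ContDiffOn ℝ ∞ (Function.extend Subtype.val f 0) (Icc (-r) r)}
  add_mem' := by
    intro f g hf hg
    refine (ContDiffOn.add hf hg).congr ?_
    intro x hx
    have h := fun f : Icc (-r) r → ℝ =>
      Subtype.val_injective.extend_apply f (0 : ℝ → ℝ) (⟨x, hx⟩ : Icc (-r) r)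
    simp only at h
    simp [h]
  zero_mem' := by
    refine (contDiffOn_const (c := (0 : ℝ))).congr ?_
    intro x hx
    exact Subtype.val_injective.extend_apply _ (0 : ℝ → ℝ) (⟨x, hx⟩ : Icc (-r) r)
  smul_mem' := by
    intro a f hf
    refine (ContDiffOn.const_smul a hf).congr ?_
    intro x hx
    have h := fun f : Icc (-r) r → ℝ =>
      Subtype.val_injective.extend_apply f (0 : ℝ → ℝ) (⟨x, hx⟩ : Icc (-r) r)
    simp only at h
    simp [h]

/-- The value at `t` of an element of `C^∞([-r, r])` (zero outside the interval). -/
noncomputable def smoothEval {r : ℝ} (f : smoothFunctions r) (t : ℝ) : ℝ :=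
  Function.extend Subtype.val (f : Icc (-r) r → ℝ) 0 t

/-- `(∫_ℝ y^k e^{-y^(p+1)} dy) / (∫_ℝ y^L e^{-y^(p+1)} dy)`. -/
noncomputable def momentRatio (p L k : ℕ) : ℝ :=
  (∫ y : ℝ, y ^ k * Real.exp (-y ^ (p + 1))) / (∫ y : ℝ, y ^ L * Real.exp (-y ^ (p + 1)))

/-- `ψ_k(T) = e^{T^(p+1)} ∫_{+∞}^T (y^k - c_k y^L) e^{-y^(p+1)} dy`, where `c_k` is the ratio of
moments that makes the integral over `ℝ` vanish. -/
noncomputable def psi (p L k : ℕ) (T : ℝ) : ℝ :=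
  Real.exp (T ^ (p + 1)) *
    (-∫ y in Ioi T, (y ^ k - momentRatio p L k * y ^ L) * Real.exp (-y ^ (p + 1)))

/-- `q` is the polynomial part of the expansion of `ρ` at `±∞`. There is at most one such `q`. -/
def IsPolynomialPart (ρ : ℝ → ℝ) (q : Polynomial ℝ) : Prop :=
  Tendsto (fun T => ρ T - q.eval T) (atBot ⊔ atTop) (𝓝 0)

open Classical in
/-- `[ρ]`: the function `ρ` without the polynomial part of its expansion at `±∞`. -/
noncomputable def polyBracket (ρ : ℝ → ℝ) (T : ℝ) : ℝ :=
  if h : ∃ q : Polynomial ℝ, IsPolynomialPart ρ q then ρ T - h.choose.eval T else ρ T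

/-- The intermediary functions `ψ̄_{i,k}(T) = [T^i ψ_k(T)]`. -/
noncomputable def psiBar (p L i k : ℕ) : ℝ → ℝ :=
  polyBracket (fun T => T ^ i * psi p L k T)

namespace CanardData

/-- The standing assumptions on the equation. -/
structure Admissible (D : CanardData) : Prop where
  odd_p : Odd D.p
  three_le_p : 3 ≤ D.p
  even_L : Even D.L
  L_lt_p : D.L < D.p
  t₀_pos : 0 < D.t₀
  η₀_pos : 0 < D.η₀
  smooth_S : ContDiffOn ℝ ∞ (fun x : ℝ × ℝ => D.S x.1 x.2) (Icc (-D.t₀) D.t₀ ×ˢ univ)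
  smooth_P : ContDiffOn ℝ ∞ (fun x : ℝ × ℝ × ℝ × ℝ => D.P x.1 x.2.1 x.2.2.1 x.2.2.2)
    (Icc (-D.t₀) D.t₀ ×ˢ univ ×ˢ univ ×ˢ Ico 0 D.η₀)
  S_zero : ∀ t ∈ Icc (-D.t₀) D.t₀, D.S t 0 = 0
  /-- Every monomial `t^i α^j` in the Taylor expansion of `S` at the origin has weighted degree
  `i + (p - L + 1) j > p + 1`. -/
  valuation_S : ∀ i j : ℕ, i + (D.p - D.L + 1) * j ≤ D.p + 1 →
    iteratedDeriv i (fun t => iteratedDeriv j (fun a => D.S t a) 0) 0 = 0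

/-- The linear case: `P` is an affine function of `u`. -/
def IsLinear (D : CanardData) : Prop :=
  ∃ P₀ P₁ : ℝ → ℝ → ℝ → ℝ, ∀ t ∈ Icc (-D.t₀) D.t₀, ∀ u a : ℝ, ∀ η ∈ Ico 0 D.η₀,
    D.P t u a η = P₀ t a η + P₁ t a η * u

/-! ### The operator `Ξ_η` and the canard solution -/

/-- For a fixed `η`, the couple `(α, u)` solves the boundary value problem
`η^(p+2) u' = (p+1) η t^p u + η^(p-L+1) α t^L + S(t, η^(p-L+1) α)
  + η^(p+1) P(t, η v, η^(p-L+1) β, η)`, `u(-t₀) = 0 = u(t₀)`. -/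
def SolvesSystem (D : CanardData) (η β : ℝ) (v : ℝ → ℝ) (α : ℝ) (u : ℝ → ℝ) : Prop :=
  u (-D.t₀) = 0 ∧ u D.t₀ = 0 ∧
    ∀ t ∈ Icc (-D.t₀) D.t₀, ∃ u' : ℝ, HasDerivWithinAt u u' (Icc (-D.t₀) D.t₀) t ∧
      η ^ (D.p + 2) * u' =
        ((D.p : ℝ) + 1) * η * t ^ D.p * u t + η ^ (D.p - D.L + 1) * α * t ^ D.L
          + D.S t (η ^ (D.p - D.L + 1) * α)
          + η ^ (D.p + 1) * D.P t (η * v t) (η ^ (D.p - D.L + 1) * β) η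

/-- `(α_η, u_η)` stays bounded, uniformly on `[-t₀, t₀]`, as `η → 0`. -/
def IsBoundedFamily (D : CanardData) (y : CoupleFamily) : Prop :=
  ∃ M : ℝ, ∀ᶠ η in 𝓝[>] (0 : ℝ), |y.1 η| ≤ M ∧ ∀ t ∈ Icc (-D.t₀) D.t₀, |y.2 η t| ≤ M

/-- Two families coincide for all small `η > 0`. -/
def Agree (D : CanardData) (y y' : CoupleFamily) : Prop :=
  ∀ᶠ η in 𝓝[>] (0 : ℝ), y.1 η = y'.1 η ∧ ∀ t ∈ Icc (-D.t₀) D.t₀, y.2 η t = y'.2 η t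

/-- `y` is a bounded family with `y_η = Ξ_η(x_η)` for all small `η > 0`. -/
def IsXiImage (D : CanardData) (x y : CoupleFamily) : Prop :=
  D.IsBoundedFamily y ∧
    ∀ᶠ η in 𝓝[>] (0 : ℝ), D.SolvesSystem η (x.1 η) (x.2 η) (y.1 η) (y.2 η)

/-- The set on which `Ξ_η` is well defined: the boundary value problem has one and only one
bounded solution for small `η > 0`. -/
def xiDomain (D : CanardData) : Set CoupleFamily :=
  {x | ∃ y, D.IsXiImage x y ∧ ∀ y', D.IsXiImage x y' → D.Agree y' y}

open Classical in
/-- The operator `Ξ_η : (β, v) ↦ (α, u)`. -/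
noncomputable def xi (D : CanardData) (x : CoupleFamily) : CoupleFamily :=
  if h : x ∈ D.xiDomain then Exists.choose h else 0

/-- A canard solution: a bounded fixed point of `Ξ_η`, that is, a solution `(α_η, u_η)` of
`η^(p+2) u' = (p+1) η t^p u + η^(p-L+1) α t^L + S(t, η^(p-L+1) α)
  + η^(p+1) P(t, η u, η^(p-L+1) α, η)` with `u(±t₀) = 0`, bounded as `η → 0`. -/
def IsCanardSolution (D : CanardData) (y : CoupleFamily) : Prop :=
  D.IsXiImage y y

/-! ### The formal spaces -/

/-- The space `𝒞_n` of the formal couples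
`(a η^n, (u(t) + ∑_{i ≤ n} ∑_{k < p, k ≠ L} u_{i,k} ψ̄_{i,k}) η^n)`,
given by their coefficients `(a, u, (u_{i,k}))`. -/
abbrev FormalTerm (D : CanardData) (n : ℕ) : Type :=
  ℝ × smoothFunctions D.t₀ × (Fin (n + 1) → {k : Fin D.p // (k : ℕ) ≠ D.L} → ℝ)

/-- The space `𝒜_K = 𝒞_0 ⊕ ⋯ ⊕ 𝒞_K`. -/
abbrev FormalSpace (D : CanardData) (K : ℕ) : Type :=
  (n : Fin (K + 1)) → D.FormalTerm n

/-- The projection `π_K : 𝒜_{K+1} → 𝒜_K`. -/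
def proj (D : CanardData) (K : ℕ) (c : D.FormalSpace (K + 1)) : D.FormalSpace K :=
  fun n => c n.castSucc

/-- The projective limit of the sequence `(𝒜_K, π_K)`. -/
def projLimit (D : CanardData) : Set ((K : ℕ) → D.FormalSpace K) :=
  {c | ∀ K, D.proj K (c (K + 1)) = c K}

/-- The family of couples `c̃` associated with the formal couple `c`, obtained by substituting
`ψ̄_{i,k}(t/η)` for the formal symbols. -/
noncomputable def realize (D : CanardData) {K : ℕ} (c : D.FormalSpace K) : CoupleFamily :=
  (fun η => ∑ n : Fin (K + 1), (c n).1 * η ^ (n : ℕ),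
   fun η t => ∑ n : Fin (K + 1),
    (smoothEval (c n).2.1 t
      + ∑ i : Fin ((n : ℕ) + 1), ∑ k : {k : Fin D.p // (k : ℕ) ≠ D.L},
          (c n).2.2 i k * psiBar D.p D.L i k.1 (t / η)) * η ^ (n : ℕ))

/-- `π_K ∘ Ξ_{K+1} = Ξ_K ∘ π_K` for all `K`. -/
def Compatible (D : CanardData) (Xi : (K : ℕ) → D.FormalSpace K → D.FormalSpace K) : Prop :=
  ∀ K, D.proj K ∘ Xi (K + 1) = Xi K ∘ D.proj K

/-- `y - y' = o(η^k)`, uniformly for `t ∈ [-t₁, t₁]`. -/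
def DiffLittleO (t₁ : ℝ) (k : ℕ) (y y' : CoupleFamily) : Prop :=
  ∀ ε > 0, ∀ᶠ η in 𝓝[>] (0 : ℝ), |y.1 η - y'.1 η| ≤ ε * η ^ k ∧
    ∀ t ∈ Icc (-t₁) t₁, |y.2 η t - y'.2 η t| ≤ ε * η ^ k

/-- `y - y' = O(η^k)`, uniformly for `t ∈ [-t₁, t₁]`. -/
def DiffBigO (t₁ : ℝ) (k : ℕ) (y y' : CoupleFamily) : Prop :=
  ∃ C : ℝ, ∀ᶠ η in 𝓝[>] (0 : ℝ), |y.1 η - y'.1 η| ≤ C * η ^ k ∧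
    ∀ t ∈ Icc (-t₁) t₁, |y.2 η t - y'.2 η t| ≤ C * η ^ k

/-- The sequence `(Ξ_K)` is formally equivalent to `Ξ_η`; the remainders are measured uniformly on
every interval `[-t₁, t₁] ⊂ ]-t₀, t₀[`. -/
def FormallyEquivalent (D : CanardData)
    (Xi : (K : ℕ) → D.FormalSpace K → D.FormalSpace K) : Prop :=
  ∀ c ∈ D.projLimit, ∀ K, D.realize (c K) ∈ D.xiDomain ∧
    ∀ t₁ ∈ Ioo 0 D.t₀, DiffLittleO t₁ K (D.xi (D.realize (c K))) (D.realize (Xi K (c K)))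

/-- `c` is a semi-asymptotic expansion of the family `y`, uniformly on every interval
`[-t₁, t₁] ⊂ ]-t₀, t₀[`. -/
def IsSemiAsymptoticExpansion (D : CanardData) (y : CoupleFamily)
    (c : (K : ℕ) → D.FormalSpace K) : Prop :=
  c ∈ D.projLimit ∧
    ∀ t₁ ∈ Ioo 0 D.t₀, ∀ K, DiffBigO t₁ (K + 1) y (D.realize (c K))

end CanardData

/-! ### A priori estimates for the linear equation -/

/-! Divide the equation by `η^(p+1)` and put `T = t/η`. It becomes `dW/dT = (p+1) T^p W + α T^L +
f`, where `f = S/η^(p+1) + P` is `rhs`. Two facts about this equation carry the theorem.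

The linear problem is well posed uniformly in `η`. As `p + 1` is even, the integrating factor
`e^{-T^(p+1)}` decays on both sides, so solutions are controlled from either end towards `0`. The
two halves match at `0` for a single `α`, because the moment of `T^L` is positive for even `L`.
Hence `apriori_estimate`: an error `ε (1 + |T|^p)` in the equation moves `α` and `W` by `O(ε)`, and
boundary values contribute only terms that are exponentially small away from the ends. By the weight
condition on `S`, a monomial `t^i (η^(p-L+1) α)^j` carries at least `η^(p+2)` once written in `T`;
so `f` depends on `α`, `β`, `v` with a Lipschitz constant `O(η (1 + |T|^p))` (`rhs_lipschitz`). For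
small `η` the problem defining `Ξ_η` and the canard problem are therefore contractions on balls
(`exists_bounded_solvesLinear`).

The formal spaces are stable under solving. A forcing `T^k` with `k < p` is absorbed by `α` if `k =
L`, and by `ψ_k` together with `α` otherwise. A forcing `T^p b(t)` is absorbed by `-b/(p+1)` up to a
term with one more `η`, and `T^k b(t)` with `k < p` reduces to `b(0) T^k` by Hadamard's lemma and `t
= ηT`. Solving with forcing `ψ̄_{i,k}` raises `i` by one, and so does multiplying it by `t`, which
also yields a factor `η`. Since `P` sees `v` only through `ηv`, the constraint `i ≤ n` at order
`η^n` is preserved. Affineness in `u` keeps products of the `ψ̄_{i,k}` from arising. This is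
`solvable_rhs`.

Because `rhs` gains a factor `η`, the coefficients below order `N` of the input and of its image
determine an admissible coefficient of order `N` of the image (`exists_next`); uniqueness of
composite expansions (`eq_zero_of_expansion`) makes successive orders fit together. The formal image
and the formal fixed point are thus built by recursion, and compatibility is automatic. An exact
solution and a formal one solve the same equation up to a small error, so `stability` and the gain
of `η` improve their distance by one order at a time (`expansion_of_isXiImage`). This applies to
`Ξ_η` of a truncated series and to the canard solution alike. -/

theorem abs_sub_le_of_deriv_bound {a b : ℝ} (hab : a ≤ b) {h h' B B' : ℝ → ℝ}
    (hh : ∀ x ∈ Icc a b, HasDerivWithinAt h (h' x) (Icc a b) x)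
    (hB : ∀ x ∈ Icc a b, HasDerivWithinAt B (B' x) (Icc a b) x)
    (bd : ∀ x ∈ Icc a b, |h' x| ≤ B' x) : |h b - h a| ≤ B b - B a := by
  have hmem : ∀ x ∈ Ico a b, Icc a b ∈ 𝓝[Ici x] x := fun x hx =>
    mem_of_superset (Icc_mem_nhdsGE hx.2) (Icc_subset_Icc_left hx.1)
  exact image_norm_le_of_norm_deriv_right_le_deriv_boundary' (f := fun x => h x - h a) (f' := h')
    (a := a) (b := b) (B := fun x => B x - B a) (B' := B')
    (fun x hx => ((hh x hx).continuousWithinAt).sub continuousWithinAt_const)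
    (fun x hx => ((hh x ⟨hx.1, hx.2.le⟩).mono_of_mem_nhdsWithin (hmem x hx)).sub_const _)
    (by simp)
    (fun x hx => ((hB x hx).continuousWithinAt).sub continuousWithinAt_const)
    (fun x hx => ((hB x ⟨hx.1, hx.2.le⟩).mono_of_mem_nhdsWithin (hmem x hx)).sub_const _)
    (fun x hx => bd x ⟨hx.1, hx.2.le⟩) ⟨hab, le_refl b⟩

theorem hasDerivAt_exp_neg_pow (p : ℕ) (T : ℝ) :
    HasDerivAt (fun T : ℝ => Real.exp (-T ^ (p + 1)))
      (-(((p : ℝ) + 1) * T ^ p * Real.exp (-T ^ (p + 1)))) T := by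
  have h := ((hasDerivAt_pow (p + 1) T).neg).exp
  refine h.congr_deriv ?_
  push_cast
  simp
  ring

/-- Variation of a function whose derivative is dominated by `ε e^{-s^(p+1)} (1 + s^p)`. -/
theorem abs_sub_le_exp_of_deriv_bound {p : ℕ} {R ε : ℝ} (hR : 1 ≤ R) (hε : 0 ≤ ε) {h h' : ℝ → ℝ}
    (hh : ∀ s ∈ Icc 0 R, HasDerivWithinAt h (h' s) (Icc 0 R) s)
    (bd : ∀ s ∈ Icc 0 R, |h' s| ≤ ε * (Real.exp (-s ^ (p + 1)) * (1 + s ^ p))) :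
    ∀ T ∈ Icc 0 R, |h R - h T| ≤ 8 * ε * Real.exp (-T ^ (p + 1)) := by
  -- For `s ≥ 1` the weight `1 + s^p` is at most `2(p+1) s^p`, so the bound is dominated by the
  -- derivative of `-2ε e^{-s^(p+1)}`.
  have far : ∀ T ∈ Icc 1 R, |h R - h T| ≤ 2 * ε * Real.exp (-T ^ (p + 1)) := by
    intro T hT
    have hsub : Icc T R ⊆ Icc 0 R := Icc_subset_Icc_left (by linarith [hT.1])
    have := abs_sub_le_of_deriv_bound hT.2 (h := h) (h' := h')
      (B := fun s => -(2 * ε) * Real.exp (-s ^ (p + 1)))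
      (B' := fun s => -(2 * ε) * (-(((p : ℝ) + 1) * s ^ p * Real.exp (-s ^ (p + 1)))))
      (fun x hx => (hh x (hsub hx)).mono hsub)
      (fun x _ => ((hasDerivAt_exp_neg_pow p x).const_mul _).hasDerivWithinAt)
      (by
        intro s hs
        refine (bd s (hsub hs)).trans ?_
        have h1 : 1 ≤ s ^ p := one_le_pow₀ (hT.1.trans hs.1)
        have h2 := Real.exp_pos (-s ^ (p + 1))
        have h3 : Real.exp (-s ^ (p + 1)) * (1 + s ^ p)
            ≤ Real.exp (-s ^ (p + 1)) * (2 * (((p : ℝ) + 1) * s ^ p)) := by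
          gcongr
          have : (0 : ℝ) ≤ (p : ℝ) * s ^ p := by positivity
          linarith
        calc ε * (Real.exp (-s ^ (p + 1)) * (1 + s ^ p))
            ≤ ε * (Real.exp (-s ^ (p + 1)) * (2 * (((p : ℝ) + 1) * s ^ p))) := by gcongr
          _ = _ := by ring)
    have hpos : 0 ≤ 2 * ε * Real.exp (-R ^ (p + 1)) := by positivity
    linarith
  intro T hT
  have hexp := Real.exp_pos (-T ^ (p + 1))
  rcases le_total 1 T with h1 | h1
  · have := far T ⟨h1, hT.2⟩
    have : 0 ≤ ε * Real.exp (-T ^ (p + 1)) := by positivity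
    linarith
  · have hsub : Icc T 1 ⊆ Icc 0 R := Icc_subset_Icc hT.1 hR
    have near := abs_sub_le_of_deriv_bound h1 (h := h) (h' := h')
      (B := fun s => (2 * ε) * s) (B' := fun s => 2 * ε * 1)
      (fun x hx => (hh x (hsub hx)).mono hsub)
      (fun x _ => ((hasDerivAt_id x).const_mul _).hasDerivWithinAt)
      (by
        intro s hs
        refine (bd s (hsub hs)).trans ?_
        have h0 : 0 ≤ s := hT.1.trans hs.1
        have e1 : Real.exp (-s ^ (p + 1)) ≤ 1 := by
          rw [Real.exp_le_one_iff]; have := pow_nonneg h0 (p + 1); linarith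
        have e2 : s ^ p ≤ 1 := pow_le_one₀ h0 hs.2
        have e3 := Real.exp_pos (-s ^ (p + 1))
        have e4 : 0 ≤ s ^ p := pow_nonneg h0 p
        have : Real.exp (-s ^ (p + 1)) * (1 + s ^ p) ≤ 1 * 2 := by gcongr; linarith
        calc _ ≤ ε * (1 * 2) := by gcongr
          _ = _ := by ring)
    have h1' := far 1 ⟨le_refl _, hR⟩
    have hT1 : T ^ (p + 1) ≤ 1 := pow_le_one₀ hT.1 h1
    have e1 : Real.exp (-1) ≤ Real.exp (-T ^ (p + 1)) := Real.exp_le_exp.2 (by linarith)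
    -- The variation on `[T, 1]` is at most `2ε`; `e < 3` turns it into `6ε e^{-1}`, and `2 + 6` is
    -- the constant `8`.
    have e2 : (1 : ℝ) ≤ 3 * Real.exp (-1) := by
      rw [Real.exp_neg]
      have := Real.exp_one_lt_d9
      have h0 := Real.exp_pos 1
      rw [← div_eq_mul_inv, le_div_iff₀ h0]; linarith
    have e3 : |h R - h T| ≤ |h R - h 1| + |h 1 - h T| := abs_sub_le _ _ _
    simp only [one_pow] at h1' near
    have : 2 * ε * Real.exp (-1) ≤ 2 * ε * Real.exp (-T ^ (p + 1)) := by gcongr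
    have : 2 * ε * 1 ≤ 2 * ε * (3 * Real.exp (-T ^ (p + 1))) := by gcongr; linarith
    have : 0 ≤ 2 * ε * T := mul_nonneg (by linarith) hT.1
    linarith

theorem pow_le_one_add_pow {s : ℝ} (hs : 0 ≤ s) {k p : ℕ} (h : k ≤ p) : s ^ k ≤ 1 + s ^ p := by
  have := pow_nonneg hs p
  rcases le_total s 1 with h1 | h1
  · linarith [pow_le_one₀ hs h1 (n := k)]
  · linarith [pow_le_pow_right₀ h1 h]

/-- A bounded solution of `W' = (p+1) T^p W + O(ε (1 + T^p))` on `[0, R]`. -/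
theorem abs_le_of_approx_half {p : ℕ} {R ε B : ℝ} (hR : 1 ≤ R) (hε : 0 ≤ ε) {W W' : ℝ → ℝ}
    (hW : ∀ s ∈ Icc 0 R, HasDerivWithinAt W (W' s) (Icc 0 R) s)
    (bd : ∀ s ∈ Icc 0 R, |W' s - ((p : ℝ) + 1) * s ^ p * W s| ≤ ε * (1 + s ^ p))
    (hB : |W R| ≤ B) :
    ∀ T ∈ Icc 0 R, |W T| ≤ 8 * ε + B * Real.exp (T ^ (p + 1) - R ^ (p + 1)) := by
  intro T hT
  have := abs_sub_le_exp_of_deriv_bound (p := p) hR hε (h := fun s => Real.exp (-s ^ (p + 1)) * W s)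
    (fun s hs => (hasDerivAt_exp_neg_pow p s).hasDerivWithinAt.mul (hW s hs))
    (by
      intro s hs
      have : -(((p : ℝ) + 1) * s ^ p * Real.exp (-s ^ (p + 1))) * W s + Real.exp (-s ^ (p + 1)) * W' s
        = Real.exp (-s ^ (p + 1)) * (W' s - ((p : ℝ) + 1) * s ^ p * W s) := by ring
      rw [this, abs_mul, abs_of_pos (Real.exp_pos _)]
      calc _ ≤ Real.exp (-s ^ (p + 1)) * (ε * (1 + s ^ p)) := by gcongr; exact bd s hs
        _ = _ := by ring) T hT
  have h1 : Real.exp (-T ^ (p + 1)) * |W T| ≤ 8 * ε * Real.exp (-T ^ (p + 1))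
      + Real.exp (-R ^ (p + 1)) * B := by
    have h2 : |Real.exp (-T ^ (p + 1)) * W T| ≤ |Real.exp (-R ^ (p + 1)) * W R|
        + |Real.exp (-R ^ (p + 1)) * W R - Real.exp (-T ^ (p + 1)) * W T| := by
      rw [abs_sub_comm]
      have := abs_add_le (Real.exp (-R ^ (p + 1)) * W R)
        (Real.exp (-T ^ (p + 1)) * W T - Real.exp (-R ^ (p + 1)) * W R)
      simpa using this
    rw [abs_mul, abs_mul, abs_of_pos (Real.exp_pos _), abs_of_pos (Real.exp_pos _)] at h2
    have h3 : Real.exp (-R ^ (p + 1)) * |W R| ≤ Real.exp (-R ^ (p + 1)) * B := by gcongr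
    linarith
  have h4 := mul_le_mul_of_nonneg_left h1 (Real.exp_pos (T ^ (p + 1))).le
  have h5 : Real.exp (T ^ (p + 1)) * Real.exp (-T ^ (p + 1)) = 1 := by
    rw [← Real.exp_add]; simp
  have h6 : Real.exp (T ^ (p + 1)) * Real.exp (-R ^ (p + 1))
      = Real.exp (T ^ (p + 1) - R ^ (p + 1)) := by
    rw [← Real.exp_add]; ring_nf
  calc |W T| = Real.exp (T ^ (p + 1)) * (Real.exp (-T ^ (p + 1)) * |W T|) := by
        rw [← mul_assoc, h5, one_mul]
    _ ≤ _ := h4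
    _ = 8 * ε * (Real.exp (T ^ (p + 1)) * Real.exp (-T ^ (p + 1)))
        + B * (Real.exp (T ^ (p + 1)) * Real.exp (-R ^ (p + 1))) := by ring
    _ = _ := by rw [h5, h6]; ring

/-- Primitive of `s^L e^{-s^(p+1)}`. -/
noncomputable def expMoment (p L : ℕ) (T : ℝ) : ℝ := ∫ s in (0 : ℝ)..T, s ^ L * Real.exp (-s ^ (p + 1))

theorem hasDerivAt_expMoment (p L : ℕ) (T : ℝ) :
    HasDerivAt (expMoment p L) (T ^ L * Real.exp (-T ^ (p + 1))) T := by
  have hc : Continuous fun s : ℝ => s ^ L * Real.exp (-s ^ (p + 1)) := by fun_prop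
  exact intervalIntegral.integral_hasDerivAt_right (hc.intervalIntegrable _ _)
    (hc.stronglyMeasurableAtFilter _ _) hc.continuousAt

theorem expMoment_monotone {p L : ℕ} (hL : Even L) : Monotone (expMoment p L) :=
  monotone_of_hasDerivAt_nonneg (hasDerivAt_expMoment p L)
    (fun x => mul_nonneg (hL.pow_nonneg x) (Real.exp_pos _).le)

theorem expMoment_one_sub_pos {p L : ℕ} (hL : Even L) : 0 < expMoment p L 1 - expMoment p L (-1) := by
  have h0 : expMoment p L (-1) ≤ expMoment p L 0 := expMoment_monotone hL (by norm_num)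
  have hz : expMoment p L 0 = 0 := by simp [expMoment]
  have h1 : 0 < expMoment p L 1 := by
    have hc : Continuous fun s : ℝ => s ^ L * Real.exp (-s ^ (p + 1)) := by fun_prop
    refine intervalIntegral.intervalIntegral_pos_of_pos_on (hc.intervalIntegrable _ _) ?_ one_pos
    intro x hx
    have := hx.1
    positivity
  linarith

theorem hasDerivWithinAt_comp_neg {R : ℝ} {W W' : ℝ → ℝ}
    (hW : ∀ s ∈ Icc (-R) R, HasDerivWithinAt W (W' s) (Icc (-R) R) s) :
    ∀ s ∈ Icc (-R) R, HasDerivWithinAt (fun s => W (-s)) (-W' (-s)) (Icc (-R) R) s := by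
  intro s hs
  have hmem : ∀ s ∈ Icc (-R) R, -s ∈ Icc (-R) R := fun s hs => ⟨by linarith [hs.2], by linarith [hs.1]⟩
  have := (hW (-s) (hmem s hs)).comp s (hasDerivAt_neg s).hasDerivWithinAt hmem
  simpa [Function.comp_def] using this

/-- After multiplication by `e^{-s^(p+1)}` the equation can be integrated, with an error of at most
`8ε` between `0` and either end. Comparing the two ends leaves `α` times the moment of `s^L`,
bounded below by its part on `[-1, 1]`, and this bounds `α`. Then `α s^L` is itself an error of size
`|α| (1 + |s|^p)`, and the bound on each half-line applies to `W`. -/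
theorem apriori_estimate {p L : ℕ} (hp : Odd p) (hL : Even L) (hLp : L ≤ p) :
    ∃ C : ℝ, 1 ≤ C ∧ ∀ (R α ε B : ℝ) (W W' : ℝ → ℝ), 1 ≤ R → 0 ≤ ε →
      (∀ s ∈ Icc (-R) R, HasDerivWithinAt W (W' s) (Icc (-R) R) s) →
      (∀ s ∈ Icc (-R) R, |W' s - (((p : ℝ) + 1) * s ^ p * W s + α * s ^ L)| ≤ ε * (1 + |s| ^ p)) →
      |W R| ≤ B → |W (-R)| ≤ B →
      |α| ≤ C * (ε + B * Real.exp (-R ^ (p + 1))) ∧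
      ∀ T ∈ Icc (-R) R, |W T| ≤ C * (ε + B * Real.exp (T ^ (p + 1) - R ^ (p + 1))) := by
  set I := expMoment p L 1 - expMoment p L (-1) with hI
  have hIpos : 0 < I := expMoment_one_sub_pos hL
  have hp1 : Even (p + 1) := hp.add_one
  -- `16 / I` is the constant for `α`; the rest comes from inserting `|α| + ε` into the half-line
  -- bound with its factor `8`.
  refine ⟨8 * (16 / I) + 9, by have : 0 ≤ 16 / I := by positivity
                               linarith, ?_⟩
  intro R α ε B W W' hR hε hW bd hB1 hB2
  have hB0 : 0 ≤ B := (abs_nonneg _).trans hB1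
  have hsub : Icc 0 R ⊆ Icc (-R) R := Icc_subset_Icc_left (by linarith)
  have hmem : ∀ s ∈ Icc (-R) R, -s ∈ Icc (-R) R := fun s hs => ⟨by linarith [hs.2], by linarith [hs.1]⟩
  set h : ℝ → ℝ := fun s => Real.exp (-s ^ (p + 1)) * W s - α * expMoment p L s with hh
  set h' : ℝ → ℝ := fun s => Real.exp (-s ^ (p + 1)) *
    (W' s - (((p : ℝ) + 1) * s ^ p * W s + α * s ^ L)) with hh'
  have hd : ∀ s ∈ Icc (-R) R, HasDerivWithinAt h (h' s) (Icc (-R) R) s := by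
    intro s hs
    refine (((hasDerivAt_exp_neg_pow p s).hasDerivWithinAt.mul (hW s hs)).sub
      ((hasDerivAt_expMoment p L s).hasDerivWithinAt.const_mul α)).congr_deriv ?_
    simp only [hh']; ring
  have hbd : ∀ s ∈ Icc (-R) R, |h' s| ≤ ε * (Real.exp (-s ^ (p + 1)) * (1 + |s| ^ p)) := by
    intro s hs
    simp only [hh']
    rw [abs_mul, abs_of_pos (Real.exp_pos _)]
    calc _ ≤ Real.exp (-s ^ (p + 1)) * (ε * (1 + |s| ^ p)) := by gcongr; exact bd s hs
        _ = _ := by ring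
  have z0 : (0 : ℝ) ∈ Icc 0 R := ⟨le_refl _, by linarith⟩
  have v1 : |h R - h 0| ≤ 8 * ε := by
    have := abs_sub_le_exp_of_deriv_bound (p := p) hR hε (h := h) (h' := h')
      (fun s hs => (hd s (hsub hs)).mono hsub)
      (fun s hs => by simpa [abs_of_nonneg hs.1] using hbd s (hsub hs)) 0 z0
    simpa using this
  have v2 : |h (-R) - h 0| ≤ 8 * ε := by
    have := abs_sub_le_exp_of_deriv_bound (p := p) hR hε (h := fun s => h (-s)) (h' := fun s => -h' (-s))
      (fun s hs => (hasDerivWithinAt_comp_neg hd s (hsub hs)).mono hsub)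
      (fun s hs => by simpa [abs_of_nonneg hs.1, hp1.neg_pow] using hbd (-s) (hmem s (hsub hs))) 0 z0
    simpa using this
  have hA : I ≤ expMoment p L R - expMoment p L (-R) := by
    have h1 := expMoment_monotone (p := p) hL hR
    have h2 := expMoment_monotone (p := p) hL (show -R ≤ -1 by linarith)
    linarith
  have hα : |α| ≤ (16 / I) * (ε + B * Real.exp (-R ^ (p + 1))) := by
    have e : α * (expMoment p L R - expMoment p L (-R)) =
        Real.exp (-R ^ (p + 1)) * W R - Real.exp (-R ^ (p + 1)) * W (-R)
          - ((h R - h 0) - (h (-R) - h 0)) := by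
      simp only [hh, hp1.neg_pow]; ring
    have e1 : |Real.exp (-R ^ (p + 1)) * W R| ≤ Real.exp (-R ^ (p + 1)) * B := by
      rw [abs_mul, abs_of_pos (Real.exp_pos _)]; gcongr
    have e2 : |Real.exp (-R ^ (p + 1)) * W (-R)| ≤ Real.exp (-R ^ (p + 1)) * B := by
      rw [abs_mul, abs_of_pos (Real.exp_pos _)]; gcongr
    have e3 : |α| * I ≤ 16 * (ε + B * Real.exp (-R ^ (p + 1))) := by
      calc |α| * I ≤ |α| * |expMoment p L R - expMoment p L (-R)| := by
            gcongr; exact hA.trans (le_abs_self _)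
        _ = |α * (expMoment p L R - expMoment p L (-R))| := (abs_mul _ _).symm
        _ ≤ 16 * (ε + B * Real.exp (-R ^ (p + 1))) := by
            rw [e, abs_le]
            rw [abs_le] at v1 v2 e1 e2
            have : 0 ≤ Real.exp (-R ^ (p + 1)) * B := by positivity
            constructor <;> linarith
    rw [div_mul_eq_mul_div, le_div_iff₀ hIpos]; exact e3
  have hI0 : 0 ≤ 16 / I := by positivity
  have hBe : 0 ≤ B * Real.exp (-R ^ (p + 1)) := by positivity
  refine ⟨hα.trans (by gcongr; linarith), ?_⟩
  have bd' : ∀ s ∈ Icc (-R) R, |W' s - ((p : ℝ) + 1) * s ^ p * W s| ≤ (|α| + ε) * (1 + |s| ^ p) := by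
    intro s hs
    have e : W' s - ((p : ℝ) + 1) * s ^ p * W s
        = (W' s - (((p : ℝ) + 1) * s ^ p * W s + α * s ^ L)) + α * s ^ L := by ring
    rw [e]
    refine (abs_add_le _ _).trans ?_
    have e1 := bd s hs
    have e2 : |α * s ^ L| ≤ |α| * (1 + |s| ^ p) := by
      rw [abs_mul, abs_pow]; gcongr; exact pow_le_one_add_pow (abs_nonneg s) hLp
    linarith
  have fin : ∀ T : ℝ, 8 * (|α| + ε) + B * Real.exp (T ^ (p + 1) - R ^ (p + 1))
      ≤ (8 * (16 / I) + 9) * (ε + B * Real.exp (T ^ (p + 1) - R ^ (p + 1))) := by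
    intro T
    have e1 : Real.exp (-R ^ (p + 1)) ≤ Real.exp (T ^ (p + 1) - R ^ (p + 1)) :=
      Real.exp_le_exp.2 (by have := hp1.pow_nonneg T; linarith)
    have e2 : B * Real.exp (-R ^ (p + 1)) ≤ B * Real.exp (T ^ (p + 1) - R ^ (p + 1)) := by gcongr
    have e3 : (16 / I) * (ε + B * Real.exp (-R ^ (p + 1)))
        ≤ (16 / I) * (ε + B * Real.exp (T ^ (p + 1) - R ^ (p + 1))) := by gcongr
    have e4 : 0 ≤ B * Real.exp (T ^ (p + 1) - R ^ (p + 1)) := by positivity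
    linarith
  have hαε : 0 ≤ |α| + ε := by positivity
  intro T hT
  rcases le_total 0 T with h0 | h0
  · refine (abs_le_of_approx_half (p := p) hR hαε (fun s hs => (hW s (hsub hs)).mono hsub)
      (fun s hs => by simpa [abs_of_nonneg hs.1] using bd' s (hsub hs)) hB1 T ⟨h0, hT.2⟩).trans (fin T)
  · have := (abs_le_of_approx_half (p := p) hR hαε (W := fun s => W (-s)) (W' := fun s => -W' (-s))
      (fun s hs => (hasDerivWithinAt_comp_neg hW s (hsub hs)).mono hsub)
      (fun s hs => by
        have := bd' (-s) (hmem s (hsub hs))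
        rw [abs_neg, abs_of_nonneg hs.1, hp.neg_pow] at this
        rw [← abs_neg]
        convert this using 2
        ring) hB2 (-T) ⟨by linarith, by linarith [hT.1]⟩)
    simp only [neg_neg, hp1.neg_pow] at this
    exact this.trans (fin T)

/-- Decay at `+∞` of the solution that does not blow up. -/
theorem decay_of_approx {p : ℕ} {w G : ℝ → ℝ} {C : ℝ}
    (hw : ∀ T, 1 ≤ T → HasDerivAt w (((p : ℝ) + 1) * T ^ p * w T + G T) T)
    (hG : ∀ T, 1 ≤ T → T * |G T| ≤ C * T ^ p)
    (h0 : Tendsto (fun T => Real.exp (-T ^ (p + 1)) * w T) atTop (𝓝 0)) :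
    ∀ T, 1 ≤ T → T * |w T| ≤ C := by
  have hC : 0 ≤ C := by
    have h1 : |G 1| ≤ C := by simpa using hG 1 le_rfl
    exact (abs_nonneg _).trans h1
  intro T hT
  have hT0 : 0 < T := by linarith
  set h : ℝ → ℝ := fun s => Real.exp (-s ^ (p + 1)) * w s with hh
  have key : ∀ R, T ≤ R → |h R - h T| ≤ C / T * Real.exp (-T ^ (p + 1)) := by
    intro R hR
    have := abs_sub_le_of_deriv_bound hR (h := h)
      (h' := fun s => Real.exp (-s ^ (p + 1)) * G s)
      (B := fun s => -(C / T) * Real.exp (-s ^ (p + 1)))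
      (B' := fun s => -(C / T) * (-(((p : ℝ) + 1) * s ^ p * Real.exp (-s ^ (p + 1)))))
      (fun s hs => by
        refine (((hasDerivAt_exp_neg_pow p s).mul (hw s (hT.trans hs.1))).congr_deriv ?_).hasDerivWithinAt
        ring)
      (fun s _ => ((hasDerivAt_exp_neg_pow p s).const_mul _).hasDerivWithinAt)
      (by
        intro s hs
        have hs1 : 1 ≤ s := hT.trans hs.1
        have hs0 : 0 ≤ s := by linarith
        -- Since `s ≥ T`, the factor `1/s` in the bound for `G` is at most `1/T`: this is where the
        -- decay comes from.
        have hg : |G s| ≤ C / T * s ^ p := by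
          rw [div_mul_eq_mul_div, le_div_iff₀ hT0, mul_comm]
          exact le_trans (by gcongr; exact hs.1) (hG s hs1)
        rw [abs_mul, abs_of_pos (Real.exp_pos _)]
        have hq : 0 ≤ C / T * s ^ p := by positivity
        have : C / T * s ^ p ≤ C / T * s ^ p * ((p : ℝ) + 1) := by
          have : (0 : ℝ) ≤ p := Nat.cast_nonneg p
          nlinarith
        calc _ ≤ Real.exp (-s ^ (p + 1)) * (C / T * s ^ p * ((p : ℝ) + 1)) := by
              gcongr; exact hg.trans this
          _ = _ := by ring)
    have : 0 ≤ C / T * Real.exp (-R ^ (p + 1)) := by positivity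
    linarith
  have lim : |0 - h T| ≤ C / T * Real.exp (-T ^ (p + 1)) :=
    le_of_tendsto ((h0.sub_const (h T)).abs) ((eventually_ge_atTop T).mono fun R hR => key R hR)
  rw [zero_sub, abs_neg, hh] at lim
  simp only [abs_mul, abs_of_pos (Real.exp_pos _)] at lim
  have hE := Real.exp_pos (-T ^ (p + 1))
  have : |w T| ≤ C / T := by
    rw [mul_comm] at lim
    exact le_of_mul_le_mul_right lim hE
  rw [le_div_iff₀ hT0] at this
  linarith

theorem apriori_estimate_scaled {p L : ℕ} (hp : Odd p) (hL : Even L) (hLp : L ≤ p) :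
    ∃ C : ℝ, 1 ≤ C ∧ ∀ (η r α ε B : ℝ) (w w' : ℝ → ℝ), 0 < η → η ≤ r → 0 ≤ ε →
      (∀ t ∈ Icc (-r) r, HasDerivWithinAt w (w' t) (Icc (-r) r) t) →
      (∀ t ∈ Icc (-r) r, |η * w' t - (((p : ℝ) + 1) * (t / η) ^ p * w t + α * (t / η) ^ L)|
        ≤ ε * (1 + |t / η| ^ p)) →
      |w r| ≤ B → |w (-r)| ≤ B →
      |α| ≤ C * (ε + B * Real.exp (-(r / η) ^ (p + 1))) ∧
      ∀ t ∈ Icc (-r) r, |w t| ≤ C * (ε + B * Real.exp ((t / η) ^ (p + 1) - (r / η) ^ (p + 1))) := by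
  obtain ⟨C, hC, h⟩ := apriori_estimate hp hL hLp
  refine ⟨C, hC, ?_⟩
  intro η r α ε B w w' hη hr hε hw bd hB1 hB2
  have hηr : η * (r / η) = r := by field_simp
  have maps : MapsTo (fun T => η * T) (Icc (-(r / η)) (r / η)) (Icc (-r) r) := by
    intro T hT
    constructor
    · have := mul_le_mul_of_nonneg_left hT.1 hη.le
      rw [mul_neg, hηr] at this; exact this
    · have := mul_le_mul_of_nonneg_left hT.2 hη.le
      rw [hηr] at this; exact this
  obtain ⟨h1, h2⟩ := h (r / η) α ε B (fun T => w (η * T)) (fun T => η * w' (η * T))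
    ((one_le_div hη).2 hr) hε
    (by
      intro T hT
      have := (hw (η * T) (maps hT)).comp T
        ((hasDerivAt_id T).const_mul η).hasDerivWithinAt maps
      refine this.congr_deriv ?_
      ring)
    (by
      intro T hT
      have := bd (η * T) (maps hT)
      rwa [mul_div_cancel_left₀ T hη.ne'] at this)
    (by simpa only [hηr] using hB1) (by simpa only [mul_neg, hηr] using hB2)
  refine ⟨h1, fun t ht => ?_⟩
  have hηt : η * (t / η) = t := by field_simp
  have := h2 (t / η) ⟨by rw [← neg_div]; gcongr; exact ht.1, by gcongr; exact ht.2⟩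
  simpa only [hηt] using this

/-- Variation of constants from `-r` gives `u(-r) = 0`. The value of `α` is the one for which the
weighted forcing has integral zero over `[-r, r]`, so that `u(r) = 0` as well; its denominator is
positive because `L` is even. -/
theorem exists_linear_solution (p : ℕ) {L : ℕ} (hL : Even L) {η r : ℝ} (hη : 0 < η) (hr : 0 < r)
    {f : ℝ → ℝ} (hf : Continuous f) :
    ∃ (α : ℝ) (u u' : ℝ → ℝ), u (-r) = 0 ∧ u r = 0 ∧ ∀ t, HasDerivAt u (u' t) t ∧
      η * u' t = ((p : ℝ) + 1) * (t / η) ^ p * u t + α * (t / η) ^ L + f t := by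
  set g : ℝ → ℝ := fun s => Real.exp (-(s / η) ^ (p + 1)) with hg
  have hgc : Continuous g := by fun_prop
  set I := ∫ s in (-r)..r, g s * (s / η) ^ L with hI
  have hcL : Continuous fun s => g s * (s / η) ^ L := by fun_prop
  have hIpos : 0 < I := by
    refine intervalIntegral.integral_pos (by linarith) hcL.continuousOn
      (fun x _ => mul_nonneg (Real.exp_pos _).le (hL.pow_nonneg _)) ⟨r, ⟨by linarith, le_rfl⟩, ?_⟩
    have := Real.exp_pos (-(r / η) ^ (p + 1))
    positivity
  set J := ∫ s in (-r)..r, g s * f s with hJ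
  have hcf : Continuous fun s => g s * f s := by fun_prop
  set α := -J / I with hα
  have hc : Continuous fun s => α * (g s * (s / η) ^ L) + g s * f s := by fun_prop
  set U : ℝ → ℝ := fun t => ∫ s in (-r)..t, (α * (g s * (s / η) ^ L) + g s * f s) with hU
  have hUd : ∀ t, HasDerivAt U (α * (g t * (t / η) ^ L) + g t * f t) t := fun t =>
    intervalIntegral.integral_hasDerivAt_right (hc.intervalIntegrable _ _)
      (hc.stronglyMeasurableAtFilter _ _) hc.continuousAt
  have hUr : U r = 0 := by
    simp only [hU]
    rw [intervalIntegral.integral_add ((hcL.const_mul α).intervalIntegrable _ _)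
      (hcf.intervalIntegrable _ _), intervalIntegral.integral_const_mul, ← hI, ← hJ, hα]
    field_simp
    ring
  have hE : ∀ t : ℝ, HasDerivAt (fun t => Real.exp ((t / η) ^ (p + 1)))
      (Real.exp ((t / η) ^ (p + 1)) * (((p : ℝ) + 1) * (t / η) ^ p * (1 / η))) t := by
    intro t
    refine ((((hasDerivAt_id t).div_const η).pow (p + 1)).exp).congr_deriv ?_
    simp
  refine ⟨α, fun t => Real.exp ((t / η) ^ (p + 1)) * (η⁻¹ * U t), _, by simp [hU], by simp [hUr],
    fun t => ⟨(hE t).mul ((hUd t).const_mul η⁻¹), ?_⟩⟩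
  have hgE : Real.exp ((t / η) ^ (p + 1)) * g t = 1 := by
    simp only [hg]; rw [← Real.exp_add]; simp
  have e1 : Real.exp ((t / η) ^ (p + 1)) * (α * (g t * (t / η) ^ L) + g t * f t)
      = α * (t / η) ^ L + f t := by
    calc _ = (Real.exp ((t / η) ^ (p + 1)) * g t) * (α * (t / η) ^ L + f t) := by ring
      _ = _ := by rw [hgE, one_mul]
  have hη' := hη.ne'
  calc _ = (η * η⁻¹) * (((p : ℝ) + 1) * (t / η) ^ p * (Real.exp ((t / η) ^ (p + 1)) * (η⁻¹ * U t)))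
        + (η * η⁻¹) * (Real.exp ((t / η) ^ (p + 1)) * (α * (g t * (t / η) ^ L) + g t * f t)) := by
        ring
    _ = _ := by rw [mul_inv_cancel₀ hη', e1]; ring

/-! ### The functions `ψ_k` and `ψ̄_{i,k}` -/

-- Both factors compare with `e^{|y|}`: the power through the exponential series, the Gaussian-like
-- factor through `|y| ≤ 1 + y^(p+1)`.
open MeasureTheory Polynomial in
theorem pow_mul_exp_neg_pow_le (p k : ℕ) (hp : Odd p) (y : ℝ) :
    |y| ^ k * Real.exp (-y ^ (p + 1)) ≤ Real.exp 1 * (k.factorial : ℝ) := by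
  have h1 : |y| ≤ 1 + y ^ (p + 1) := by
    have := pow_le_one_add_pow (abs_nonneg y) (show 1 ≤ p + 1 by omega)
    rwa [pow_one, hp.add_one.pow_abs] at this
  have h2 : |y| ^ k ≤ k.factorial * Real.exp |y| := by
    have := Real.pow_div_factorial_le_exp |y| (abs_nonneg y) k
    rwa [div_le_iff₀ (by positivity), mul_comm] at this
  have h3 : Real.exp (-y ^ (p + 1)) ≤ Real.exp 1 * Real.exp (-|y|) := by
    rw [← Real.exp_add]; exact Real.exp_le_exp.2 (by linarith)
  calc _ ≤ (k.factorial * Real.exp |y|) * (Real.exp 1 * Real.exp (-|y|)) := by gcongr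
    _ = Real.exp 1 * k.factorial * (Real.exp |y| * Real.exp (-|y|)) := by ring
    _ = _ := by rw [← Real.exp_add]; simp

open MeasureTheory in
theorem integrable_pow_mul_exp_neg_pow (p k : ℕ) (hp : Odd p) :
    Integrable (fun y : ℝ => y ^ k * Real.exp (-y ^ (p + 1))) := by
  refine (integrable_inv_one_add_sq.const_mul
    (Real.exp 1 * (k.factorial : ℝ) + Real.exp 1 * ((k + 2).factorial : ℝ))).mono'
    (by fun_prop) (Eventually.of_forall fun y => ?_)
  rw [Real.norm_eq_abs, abs_mul, abs_pow, abs_of_pos (Real.exp_pos _), ← div_eq_mul_inv,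
    le_div_iff₀ (by positivity)]
  -- The bounds for the exponents `k` and `k + 2` add up to domination by a multiple of `1/(1+y²)`.
  have h1 := pow_mul_exp_neg_pow_le p k hp y
  have h2 := pow_mul_exp_neg_pow_le p (k + 2) hp y
  rw [pow_add, sq_abs] at h2
  linarith

open MeasureTheory in
theorem integral_pow_mul_exp_neg_pow_pos (p : ℕ) {L : ℕ} (hp : Odd p) (hL : Even L) :
    0 < ∫ y : ℝ, y ^ L * Real.exp (-y ^ (p + 1)) := by
  have hi := integrable_pow_mul_exp_neg_pow p L hp
  have hn : ∀ y : ℝ, 0 ≤ y ^ L * Real.exp (-y ^ (p + 1)) := fun y =>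
    mul_nonneg (hL.pow_nonneg y) (Real.exp_pos _).le
  have h1 : ∫ y in Ioc (0 : ℝ) 1, y ^ L * Real.exp (-y ^ (p + 1)) ≤
      ∫ y : ℝ, y ^ L * Real.exp (-y ^ (p + 1)) :=
    setIntegral_le_integral hi (Eventually.of_forall hn)
  rw [← intervalIntegral.integral_of_le zero_le_one] at h1
  refine lt_of_lt_of_le ?_ h1
  refine intervalIntegral.integral_pos one_pos (by fun_prop) (fun x _ => hn x) ⟨1, by simp, ?_⟩
  have := Real.exp_pos (-1 ^ (p + 1))
  simpa using this

/-- `e^{-T^(p+1)} ψ_k(T)`. -/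
noncomputable def psiPrimitive (p L k : ℕ) (T : ℝ) : ℝ :=
  -∫ y in Ioi T, (y ^ k - momentRatio p L k * y ^ L) * Real.exp (-y ^ (p + 1))

open MeasureTheory in
theorem integrable_psi_integrand (p L k : ℕ) (hp : Odd p) :
    Integrable (fun y : ℝ => (y ^ k - momentRatio p L k * y ^ L) * Real.exp (-y ^ (p + 1))) := by
  refine ((integrable_pow_mul_exp_neg_pow p k hp).sub
    ((integrable_pow_mul_exp_neg_pow p L hp).const_mul (momentRatio p L k))).congr
    (Eventually.of_forall fun y => ?_)
  simp only [Pi.sub_apply]; ring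

open MeasureTheory in
theorem integral_psi_integrand {p L k : ℕ} (hp : Odd p) (hL : Even L) :
    ∫ y : ℝ, (y ^ k - momentRatio p L k * y ^ L) * Real.exp (-y ^ (p + 1)) = 0 := by
  have h := integral_sub (integrable_pow_mul_exp_neg_pow p k hp)
    ((integrable_pow_mul_exp_neg_pow p L hp).const_mul (momentRatio p L k))
  rw [integral_const_mul, momentRatio,
    div_mul_cancel₀ _ (integral_pow_mul_exp_neg_pow_pos p hp hL).ne', sub_self] at h
  rw [← h]
  congr 1; ext y; simp only [momentRatio]; ring

open MeasureTheory in
theorem psiPrimitive_eq {p L k : ℕ} (hp : Odd p) (T : ℝ) :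
    psiPrimitive p L k T = (∫ y in (0 : ℝ)..T, (y ^ k - momentRatio p L k * y ^ L)
      * Real.exp (-y ^ (p + 1))) + psiPrimitive p L k 0 := by
  have hi := integrable_psi_integrand p L k hp
  rw [psiPrimitive, psiPrimitive, ← intervalIntegral.integral_Ioi_sub_Ioi' hi.integrableOn
    hi.integrableOn]
  ring

theorem hasDerivAt_psiPrimitive {p L k : ℕ} (hp : Odd p) (T : ℝ) :
    HasDerivAt (psiPrimitive p L k)
      ((T ^ k - momentRatio p L k * T ^ L) * Real.exp (-T ^ (p + 1))) T := by
  have hc : Continuous fun y : ℝ => (y ^ k - momentRatio p L k * y ^ L) * Real.exp (-y ^ (p + 1)) := by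
    fun_prop
  have h := (intervalIntegral.integral_hasDerivAt_right (hc.intervalIntegrable 0 T)
    (hc.stronglyMeasurableAtFilter _ _) hc.continuousAt).add_const (psiPrimitive p L k 0)
  exact h.congr_of_eventuallyEq (Eventually.of_forall fun x => psiPrimitive_eq hp x)

-- The primitive is normalised at `+∞`; it vanishes at `-∞` too because the moment ratio makes the
-- integral over the line zero. This is what excludes exponential growth of `ψ_k` on the left.
open MeasureTheory in
theorem tendsto_psiPrimitive {p L k : ℕ} (hp : Odd p) (hL : Even L) :
    Tendsto (psiPrimitive p L k) (atBot ⊔ atTop) (𝓝 0) := by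
  have hi := integrable_psi_integrand p L k hp
  have h0 := integral_psi_integrand (k := k) hp hL
  rw [tendsto_sup]
  constructor
  · have h := (intervalIntegral_tendsto_integral_Iic (0 : ℝ) hi.integrableOn tendsto_id).neg.add_const
      (psiPrimitive p L k 0)
    have e : -(∫ y in Iic (0 : ℝ), (y ^ k - momentRatio p L k * y ^ L) * Real.exp (-y ^ (p + 1)))
        + psiPrimitive p L k 0 = 0 := by
      rw [← intervalIntegral.integral_Iic_add_Ioi (b := (0 : ℝ)) hi.integrableOn hi.integrableOn] at h0
      rw [psiPrimitive]; linarith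
    rw [e] at h
    refine h.congr fun T => ?_
    rw [psiPrimitive_eq hp T, intervalIntegral.integral_symm]
    simp
  · have h := (intervalIntegral_tendsto_integral_Ioi (0 : ℝ) hi.integrableOn tendsto_id).add_const
      (psiPrimitive p L k 0)
    have e : (∫ y in Ioi (0 : ℝ), (y ^ k - momentRatio p L k * y ^ L) * Real.exp (-y ^ (p + 1)))
        + psiPrimitive p L k 0 = 0 := by
      rw [psiPrimitive]; ring
    rw [e] at h
    refine h.congr fun T => ?_
    rw [psiPrimitive_eq hp T]
    simp

theorem exp_mul_psi (p L k : ℕ) (T : ℝ) :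
    Real.exp (-T ^ (p + 1)) * psi p L k T = psiPrimitive p L k T := by
  rw [psi, ← mul_assoc, ← Real.exp_add]
  simp [psiPrimitive]

/-- Thus `ψ_k` solves `W' = (p+1) T^p W + α T^L + T^k` with `α = -momentRatio p L k`, which is its
role in the formal solution. -/
theorem hasDerivAt_psi {p L k : ℕ} (hp : Odd p) (T : ℝ) :
    HasDerivAt (psi p L k) (((p : ℝ) + 1) * T ^ p * psi p L k T
      + (T ^ k - momentRatio p L k * T ^ L)) T := by
  have h := ((hasDerivAt_pow (p + 1) T).exp).mul (hasDerivAt_psiPrimitive (L := L) (k := k) hp T)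
  have e : (fun T : ℝ => Real.exp (T ^ (p + 1))) * psiPrimitive p L k = psi p L k := rfl
  rw [e] at h
  refine h.congr_deriv ?_
  have e1 : psi p L k T = Real.exp (T ^ (p + 1)) * psiPrimitive p L k T := rfl
  have e2 : Real.exp (T ^ (p + 1)) * Real.exp (-T ^ (p + 1)) = 1 := by rw [← Real.exp_add]; simp
  rw [e1]
  push_cast
  calc _ = ((p : ℝ) + 1) * T ^ p * (Real.exp (T ^ (p + 1)) * psiPrimitive p L k T)
        + (T ^ k - momentRatio p L k * T ^ L)
          * (Real.exp (T ^ (p + 1)) * Real.exp (-T ^ (p + 1))) := by ring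
    _ = _ := by rw [e2, mul_one]

theorem decay_two_sided {p : ℕ} (hp : Odd p) {w G : ℝ → ℝ} {C : ℝ}
    (hw : ∀ T, HasDerivAt w (((p : ℝ) + 1) * T ^ p * w T + G T) T)
    (hG : ∀ T, 1 ≤ |T| → |T| * |G T| ≤ C * |T| ^ p)
    (h0 : Tendsto (fun T => Real.exp (-T ^ (p + 1)) * w T) (atBot ⊔ atTop) (𝓝 0)) :
    ∀ T, 1 ≤ |T| → |T| * |w T| ≤ C := by
  rw [tendsto_sup] at h0
  intro T hT
  rcases le_total 0 T with h | h
  · rw [abs_of_nonneg h] at hT ⊢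
    exact decay_of_approx (fun T _ => hw T)
      (fun T hT => by
        have h0 : 0 ≤ T := by linarith
        simpa [abs_of_nonneg h0] using hG T (by rwa [abs_of_nonneg h0])) h0.2 T hT
  · rw [abs_of_nonpos h] at hT ⊢
    have := decay_of_approx (p := p) (w := fun T => w (-T)) (G := fun T => -G (-T)) (C := C)
      (fun T _ => by
        have := (hw (-T)).comp T (hasDerivAt_neg T)
        refine (this.congr_deriv ?_)
        rw [hp.neg_pow]; ring)
      (fun T hT => by
        have h0 : 0 ≤ T := by linarith
        simpa [abs_of_nonneg h0] using hG (-T) (by rwa [abs_neg, abs_of_nonneg h0]))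
      (by
        have := h0.1.comp tendsto_neg_atTop_atBot
        refine this.congr fun T => ?_
        simp [hp.add_one.neg_pow]) (-T) hT
    simpa using this

theorem tendsto_abs_atBot_sup_atTop : Tendsto (fun T : ℝ => |T|) (atBot ⊔ atTop) atTop :=
  tendsto_sup.2 ⟨tendsto_abs_atBot_atTop, tendsto_abs_atTop_atTop⟩

theorem tendsto_exp_neg_mul_of_bound {p : ℕ} (hp : Odd p) {g : ℝ → ℝ} {C : ℝ} {n : ℕ}
    (hg : ∀ T, 1 ≤ |T| → |g T| ≤ C * |T| ^ n) :
    Tendsto (fun T => Real.exp (-T ^ (p + 1)) * g T) (atBot ⊔ atTop) (𝓝 0) := by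
  have hC : 0 ≤ C := by
    have := hg 1 (by simp)
    simp only [abs_one, one_pow, mul_one] at this
    exact (abs_nonneg _).trans this
  have h1 := (tendsto_inv_atTop_zero.comp tendsto_abs_atBot_sup_atTop).const_mul
    (C * (Real.exp 1 * ((n + 1).factorial : ℝ)))
  rw [mul_zero] at h1
  refine squeeze_zero_norm' ?_ h1
  filter_upwards [tendsto_abs_atBot_sup_atTop.eventually (eventually_ge_atTop 1)] with T hT
  have hT0 : 0 < |T| := by linarith
  rw [Real.norm_eq_abs, abs_mul, abs_of_pos (Real.exp_pos _), Function.comp, ← div_eq_mul_inv,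
    le_div_iff₀ hT0]
  calc _ ≤ Real.exp (-T ^ (p + 1)) * (C * |T| ^ n) * |T| := by gcongr; exact hg T hT
    _ = C * (|T| ^ (n + 1) * Real.exp (-T ^ (p + 1))) := by ring
    _ ≤ _ := mul_le_mul_of_nonneg_left (pow_mul_exp_neg_pow_le p (n + 1) hp T) hC

theorem polynomial_eval_bound (q : Polynomial ℝ) {n : ℕ} (hn : q.natDegree ≤ n) :
    ∃ C : ℝ, 0 ≤ C ∧ ∀ T : ℝ, 1 ≤ |T| → |q.eval T| ≤ C * |T| ^ n := by
  refine ⟨∑ i ∈ Finset.range (n + 1), |q.coeff i|, by positivity, fun T hT => ?_⟩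
  rw [Polynomial.eval_eq_sum_range' (Nat.lt_succ_of_le hn), Finset.sum_mul]
  refine (Finset.abs_sum_le_sum_abs _ _).trans (Finset.sum_le_sum fun i hi => ?_)
  rw [abs_mul, abs_pow]
  gcongr
  exact Nat.lt_succ_iff.1 (Finset.mem_range.1 hi)

open Polynomial in
/-- Reduction of a polynomial right-hand side to degree `< p`. -/
theorem exists_poly_reduction (p : ℕ) (Q : ℝ[X]) :
    ∃ q r : ℝ[X], r.degree < p ∧ Q + C ((p : ℝ) + 1) * X ^ p * q - derivative q = r := by
  induction Q using Polynomial.induction_on' with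
  | add Q₁ Q₂ h1 h2 =>
    obtain ⟨q1, r1, hr1, e1⟩ := h1
    obtain ⟨q2, r2, hr2, e2⟩ := h2
    refine ⟨q1 + q2, r1 + r2, (degree_add_le _ _).trans_lt (max_lt hr1 hr2), ?_⟩
    rw [← e1, ← e2, derivative_add]; ring
  | monomial n a =>
    induction n using Nat.strong_induction_on generalizing a with
    | _ n ih =>
      rcases lt_or_ge n p with h | h
      · exact ⟨0, monomial n a, (degree_monomial_le n a).trans_lt (by exact_mod_cast h), by simp⟩
      · obtain ⟨m, rfl⟩ := Nat.exists_eq_add_of_le h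
        have hp0 : ((p : ℝ) + 1) ≠ 0 := by positivity
        -- The multiple of `X^m` that cancels the monomial of degree `p + m`; its derivative has
        -- degree at most `m - 1`, so the induction goes on.
        have e1 : C ((p : ℝ) + 1) * X ^ p * monomial m (-a / ((p : ℝ) + 1)) = monomial (p + m) (-a) := by
          rw [X_pow_eq_monomial, C_mul_monomial, monomial_mul_monomial]
          congr 1; field_simp
        rcases Nat.eq_zero_or_pos m with rfl | hm
        · refine ⟨monomial 0 (-a / ((p : ℝ) + 1)), 0, by simp, ?_⟩
          rw [e1, derivative_monomial]
          simp
        · obtain ⟨q, r, hr, e⟩ := ih (m - 1) (by omega) (-(-a / ((p : ℝ) + 1) * m))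
          refine ⟨monomial m (-a / ((p : ℝ) + 1)) + q, r, hr, ?_⟩
          rw [← e, mul_add, e1, derivative_add, derivative_monomial, monomial_neg, monomial_neg]
          ring

-- A polynomial that tends to `0` at `+∞` is zero, so the polynomial part picked by choice is the
-- given one.
open Polynomial in
theorem polyBracket_eq {ρ : ℝ → ℝ} {q : ℝ[X]} (hq : IsPolynomialPart ρ q) (T : ℝ) :
    polyBracket ρ T = ρ T - q.eval T := by
  have h : ∃ q : ℝ[X], IsPolynomialPart ρ q := ⟨q, hq⟩
  have hc := h.choose_spec
  have key : h.choose = q := by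
    have h1 : Tendsto (fun T => (h.choose - q).eval T) atTop (𝓝 0) := by
      have := (hq.mono_left le_sup_right).sub (hc.mono_left le_sup_right)
      rw [sub_zero] at this
      refine this.congr fun T => ?_
      rw [eval_sub]; ring
    have := ((h.choose - q).tendsto_nhds_iff.1 h1).1
    rw [leadingCoeff_eq_zero] at this
    exact sub_eq_zero.1 this
  rw [polyBracket, dif_pos h, key]

open Polynomial in
/-- The functions `T^i ψ_k` minus their polynomial parts. -/
theorem exists_psi_reduction {p L k : ℕ} (hp : Odd p) (hL : Even L) (hLp : L < p) (hk : k < p) :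
    ∃ q r : ℕ → ℝ[X], q 0 = 0 ∧ (∀ i, (r i).degree < p) ∧
      (∀ i T, HasDerivAt (fun T => T ^ (i + 1) * psi p L k T - (q (i + 1)).eval T)
        (((p : ℝ) + 1) * T ^ p * (T ^ (i + 1) * psi p L k T - (q (i + 1)).eval T)
          + (((i : ℝ) + 1) * (T ^ i * psi p L k T - (q i).eval T) + (r i).eval T)) T) ∧
      ∀ i, ∃ C, ∀ T, 1 ≤ |T| → |T| * |T ^ i * psi p L k T - (q i).eval T| ≤ C := by
  choose qf rf hdeg heq using exists_poly_reduction p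
  -- The polynomial terms produced by differentiating `T^(i+1) ψ_k`, including the contribution of
  -- `q i`. The next `q` is chosen so that only a remainder of degree `< p` survives.
  let Q : ℕ → ℝ[X] → ℝ[X] := fun i q =>
    C ((i : ℝ) + 1) * q + X ^ (i + 1) * (X ^ k - C (momentRatio p L k) * X ^ L)
  let q : ℕ → ℝ[X] := fun i => Nat.rec 0 (fun i q => qf (Q i q)) i
  have hq : ∀ i, q (i + 1) = qf (Q i (q i)) := fun i => rfl
  have hder : ∀ i T, HasDerivAt (fun T => T ^ (i + 1) * psi p L k T - (q (i + 1)).eval T)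
        (((p : ℝ) + 1) * T ^ p * (T ^ (i + 1) * psi p L k T - (q (i + 1)).eval T)
          + (((i : ℝ) + 1) * (T ^ i * psi p L k T - (q i).eval T) + (rf (Q i (q i))).eval T)) T := by
    intro i T
    refine (((hasDerivAt_pow (i + 1) T).mul (hasDerivAt_psi hp T)).sub
      ((q (i + 1)).hasDerivAt T)).congr_deriv ?_
    have := congrArg (Polynomial.eval T) (heq (Q i (q i)))
    rw [← hq] at this
    simp only [Q, eval_add, eval_sub, eval_mul, eval_C, eval_pow, eval_X] at this
    rw [← this]
    push_cast
    ring
  refine ⟨q, fun i => rf (Q i (q i)), rfl, fun i => hdeg _, hder, ?_⟩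
  have h0 : ∃ C, ∀ T, 1 ≤ |T| → |T| * |psi p L k T| ≤ C := by
    refine ⟨1 + |momentRatio p L k|, decay_two_sided hp (hasDerivAt_psi hp) (fun T hT => ?_)
      ((tendsto_psiPrimitive hp hL).congr fun T => (exp_mul_psi p L k T).symm)⟩
    have e1 : |T ^ k - momentRatio p L k * T ^ L| ≤ |T| ^ k + |momentRatio p L k| * |T| ^ L := by
      refine (abs_sub _ _).trans ?_
      rw [abs_pow, abs_mul, abs_pow]
    have e2 : |T| ^ (k + 1) ≤ |T| ^ p := pow_le_pow_right₀ hT hk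
    have e3 : |T| ^ (L + 1) ≤ |T| ^ p := pow_le_pow_right₀ hT hLp
    calc _ ≤ |T| * (|T| ^ k + |momentRatio p L k| * |T| ^ L) := by gcongr
      _ = |T| ^ (k + 1) + |momentRatio p L k| * |T| ^ (L + 1) := by ring
      _ ≤ |T| ^ p + |momentRatio p L k| * |T| ^ p := by gcongr
      _ = _ := by ring
  have h0' : ∃ C, ∀ T, 1 ≤ |T| → |psi p L k T| ≤ C := by
    obtain ⟨C, hC⟩ := h0
    refine ⟨C, fun T hT => le_trans ?_ (hC T hT)⟩
    exact le_mul_of_one_le_left (abs_nonneg _) hT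
  intro i
  induction i with
  | zero => simpa [q] using h0
  | succ i ih =>
    obtain ⟨C, hC⟩ := ih
    obtain ⟨C₁, hC₁0, hC₁⟩ := polynomial_eval_bound (rf (Q i (q i))) (n := p - 1)
      (by
        have hp0 : 0 < p := hp.pos
        by_cases hz : rf (Q i (q i)) = 0
        · rw [hz]; simp
        · have := (Polynomial.natDegree_lt_iff_degree_lt hz).2 (hdeg (Q i (q i)))
          omega)
    obtain ⟨C₀, hC₀⟩ := h0'
    obtain ⟨C₂, hC₂0, hC₂⟩ := polynomial_eval_bound (q (i + 1))
      (n := (q (i + 1)).natDegree + (i + 1)) (by omega)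
    -- The new forcing is a decaying function plus a polynomial of degree `< p`, hence
    -- `O(|T|^(p-1))`, which is what the decay lemma requires.
    refine ⟨((i : ℝ) + 1) * C + C₁, decay_two_sided hp (hder i) (fun T hT => ?_) ?_⟩
    · have e0 : |T| * |T| ^ (p - 1) = |T| ^ p := by
        rw [← pow_succ']; congr 1; have := hp.pos; omega
      have hCn : 0 ≤ C := le_trans (by positivity) (hC T hT)
      have e1 : (1 : ℝ) ≤ |T| ^ p := one_le_pow₀ hT
      have e2 := abs_add_le (((i : ℝ) + 1) * (T ^ i * psi p L k T - (q i).eval T))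
        ((rf (Q i (q i))).eval T)
      rw [abs_mul, abs_of_pos (show (0 : ℝ) < (i : ℝ) + 1 by positivity)] at e2
      calc _ ≤ |T| * (((i : ℝ) + 1) * |T ^ i * psi p L k T - (q i).eval T| + C₁ * |T| ^ (p - 1)) := by
            gcongr; exact e2.trans (by gcongr; exact hC₁ T hT)
        _ = ((i : ℝ) + 1) * (|T| * |T ^ i * psi p L k T - (q i).eval T|)
            + C₁ * (|T| * |T| ^ (p - 1)) := by ring
        _ ≤ ((i : ℝ) + 1) * (C * |T| ^ p) + C₁ * |T| ^ p := by
            rw [e0]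
            exact add_le_add (mul_le_mul_of_nonneg_left
              ((hC T hT).trans (le_mul_of_one_le_right hCn e1)) (by positivity)) le_rfl
        _ = _ := by ring
    · refine tendsto_exp_neg_mul_of_bound hp (C := C₀ + C₂)
        (n := (q (i + 1)).natDegree + (i + 1)) (fun T hT => ?_)
      have hC₀n : 0 ≤ C₀ := le_trans (abs_nonneg _) (hC₀ T hT)
      refine (abs_sub _ _).trans ?_
      rw [abs_mul, abs_pow, add_mul]
      refine add_le_add ?_ (hC₂ T hT)
      rw [mul_comm C₀]
      exact mul_le_mul (pow_le_pow_right₀ hT (by omega)) (hC₀ T hT) (abs_nonneg _) (by positivity)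

/-- The properties of the functions `ψ̄_{i,k}` that are used in the sequel. -/
theorem exists_psiBar_poly {p L k : ℕ} (hp : Odd p) (hL : Even L) (hLp : L < p) (hk : k < p) :
    ∃ q r : ℕ → Polynomial ℝ, q 0 = 0 ∧ (∀ i, (r i).degree < p) ∧
      (∀ i T, psiBar p L i k T = T ^ i * psi p L k T - (q i).eval T) ∧
      (∀ i T, HasDerivAt (psiBar p L (i + 1) k) (((p : ℝ) + 1) * T ^ p * psiBar p L (i + 1) k T
          + (((i : ℝ) + 1) * psiBar p L i k T + (r i).eval T)) T) ∧
      ∀ i, ∃ C, ∀ T, 1 ≤ |T| → |T| * |psiBar p L i k T| ≤ C := by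
  obtain ⟨q, r, hq0, hr, hd, hb⟩ := exists_psi_reduction hp hL hLp hk
  have key : ∀ i T, psiBar p L i k T = T ^ i * psi p L k T - (q i).eval T := by
    intro i T
    refine polyBracket_eq ?_ T
    obtain ⟨C, hC⟩ := hb i
    have h1 := (tendsto_inv_atTop_zero.comp tendsto_abs_atBot_sup_atTop).const_mul C
    rw [mul_zero] at h1
    refine squeeze_zero_norm' ?_ h1
    filter_upwards [tendsto_abs_atBot_sup_atTop.eventually (eventually_ge_atTop 1)] with T hT
    rw [Real.norm_eq_abs, Function.comp, ← div_eq_mul_inv, le_div_iff₀ (by linarith), mul_comm]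
    exact hC T hT
  refine ⟨q, r, hq0, hr, key, fun i T => ?_, fun i => ?_⟩
  · have := hd i T
    simp only [← key] at this
    exact this
  · simpa only [key] using hb i

theorem hasDerivAt_psiBar_zero {p L k : ℕ} (hp : Odd p) (hL : Even L) (hLp : L < p) (hk : k < p)
    (T : ℝ) : HasDerivAt (psiBar p L 0 k) (((p : ℝ) + 1) * T ^ p * psiBar p L 0 k T
      + (T ^ k - momentRatio p L k * T ^ L)) T := by
  obtain ⟨q, r, hq0, hr, key, -, -⟩ := exists_psiBar_poly hp hL hLp hk
  have e : psiBar p L 0 k = psi p L k := by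
    ext T; rw [key, hq0]; simp
  rw [e]
  exact hasDerivAt_psi hp T

theorem hasDerivAt_psiBar_succ {p L k : ℕ} (hp : Odd p) (hL : Even L) (hLp : L < p) (hk : k < p)
    (i : ℕ) : ∃ r : Polynomial ℝ, r.degree < p ∧ ∀ T, HasDerivAt (psiBar p L (i + 1) k)
      (((p : ℝ) + 1) * T ^ p * psiBar p L (i + 1) k T
          + (((i : ℝ) + 1) * psiBar p L i k T + r.eval T)) T := by
  obtain ⟨q, r, hq0, hr, key, hd, -⟩ := exists_psiBar_poly hp hL hLp hk
  exact ⟨r i, hr i, hd i⟩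

theorem differentiable_psiBar {p L k : ℕ} (hp : Odd p) (hL : Even L) (hLp : L < p) (hk : k < p)
    (i : ℕ) : Differentiable ℝ (psiBar p L i k) := by
  intro T
  cases i with
  | zero => exact (hasDerivAt_psiBar_zero hp hL hLp hk T).differentiableAt
  | succ i =>
    obtain ⟨r, -, h⟩ := hasDerivAt_psiBar_succ hp hL hLp hk i
    exact (h T).differentiableAt

theorem exists_bound_psiBar {p L k : ℕ} (hp : Odd p) (hL : Even L) (hLp : L < p) (hk : k < p)
    (i : ℕ) : ∃ C, ∀ T, |psiBar p L i k T| ≤ C := by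
  obtain ⟨q, r, hq0, hr, key, hd, hb⟩ := exists_psiBar_poly hp hL hLp hk
  obtain ⟨C, hC⟩ := hb i
  obtain ⟨C', hC'⟩ := isCompact_Icc.exists_bound_of_continuousOn (s := Icc (-1 : ℝ) 1)
    (differentiable_psiBar hp hL hLp hk i).continuous.continuousOn
  refine ⟨max C C', fun T => ?_⟩
  rcases le_total 1 |T| with h | h
  · exact (le_trans (le_mul_of_one_le_left (abs_nonneg _) h) (hC T h)).trans (le_max_left _ _)
  · exact (hC' T (abs_le.1 h)).trans (le_max_right _ _)

theorem tendsto_psiBar {p L k : ℕ} (hp : Odd p) (hL : Even L) (hLp : L < p) (hk : k < p)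
    (i : ℕ) : Tendsto (psiBar p L i k) (atBot ⊔ atTop) (𝓝 0) := by
  obtain ⟨q, r, hq0, hr, key, hd, hb⟩ := exists_psiBar_poly hp hL hLp hk
  obtain ⟨C, hC⟩ := hb i
  have h1 := (tendsto_inv_atTop_zero.comp tendsto_abs_atBot_sup_atTop).const_mul C
  rw [mul_zero] at h1
  refine squeeze_zero_norm' ?_ h1
  filter_upwards [tendsto_abs_atBot_sup_atTop.eventually (eventually_ge_atTop 1)] with T hT
  rw [Real.norm_eq_abs, Function.comp, ← div_eq_mul_inv, le_div_iff₀ (by linarith), mul_comm]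
  exact hC T hT

/-- The difference of `T ψ̄_{i,k}` and `ψ̄_{i+1,k}` is a polynomial; it is bounded at `+∞`, as both
functions are, hence constant. -/
theorem mul_psiBar {p L k : ℕ} (hp : Odd p) (hL : Even L) (hLp : L < p) (hk : k < p)
    (i : ℕ) : ∃ γ : ℝ, ∀ T, T * psiBar p L i k T = psiBar p L (i + 1) k T + γ := by
  obtain ⟨q, r, hq0, hr, key, hd, hb⟩ := exists_psiBar_poly hp hL hLp hk
  obtain ⟨C, hC⟩ := hb i
  obtain ⟨C', hC'⟩ := exists_bound_psiBar hp hL hLp hk (i + 1)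
  have e : ∀ T, T * psiBar p L i k T - psiBar p L (i + 1) k T
      = (q (i + 1) - Polynomial.X * q i).eval T := by
    intro T; rw [key, key]; simp; ring
  have hdeg : (q (i + 1) - Polynomial.X * q i).degree ≤ 0 := by
    rw [← Polynomial.isBoundedUnder_abs_atTop_iff]
    refine ⟨C + C', ?_⟩
    rw [eventually_map]
    filter_upwards [eventually_ge_atTop 1] with T hT
    rw [← e]
    refine (abs_sub _ _).trans (add_le_add ?_ (hC' T))
    rw [abs_mul]
    exact hC T (hT.trans (le_abs_self T))
  rw [Polynomial.eq_C_of_degree_le_zero hdeg] at e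
  refine ⟨(q (i + 1) - Polynomial.X * q i).coeff 0, fun T => ?_⟩
  have := e T
  rw [Polynomial.eval_C] at this
  linarith

/-! ### Hadamard's lemma and Taylor expansions with a parameter -/

theorem hasDerivAt_integral_pow_mul_comp {g : ℝ → ℝ} (hg : ContDiff ℝ ∞ g) (i : ℕ) (t : ℝ) :
    HasDerivAt (fun t => ∫ s in (0 : ℝ)..1, s ^ i * g (s * t))
      (∫ s in (0 : ℝ)..1, s ^ (i + 1) * deriv g (s * t)) t := by
  have hg' : Continuous (deriv g) := hg.continuous_deriv (by norm_num)
  have hgc : Continuous g := hg.continuous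
  have hc1 : ∀ t, Continuous fun s : ℝ => s ^ i * g (s * t) := fun t => by fun_prop
  have hc2 : ∀ t, Continuous fun s : ℝ => s ^ (i + 1) * deriv g (s * t) := fun t => by fun_prop
  have hc3 : Continuous fun x : ℝ × ℝ => x.1 ^ (i + 1) * deriv g (x.1 * x.2) := by fun_prop
  obtain ⟨C, hC⟩ := (isCompact_Icc.prod (isCompact_closedBall t 1)).exists_bound_of_continuousOn
    (s := Icc (0 : ℝ) 1 ×ˢ Metric.closedBall t 1) hc3.continuousOn
  refine (intervalIntegral.hasDerivAt_integral_of_dominated_loc_of_deriv_le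
    (F := fun t s => s ^ i * g (s * t)) (F' := fun t s => s ^ (i + 1) * deriv g (s * t))
    (bound := fun _ => C) (Metric.ball_mem_nhds t one_pos)
    (Eventually.of_forall fun t => (hc1 t).aestronglyMeasurable)
    ((hc1 t).intervalIntegrable _ _) (hc2 t).aestronglyMeasurable ?_ (by simp) ?_).2
  · refine Eventually.of_forall fun s hs x hx => hC (s, x) ⟨?_, Metric.ball_subset_closedBall hx⟩
    rw [uIoc_of_le zero_le_one] at hs
    exact ⟨hs.1.le, hs.2⟩
  · refine Eventually.of_forall fun s _ x _ => ?_
    have h1 : HasDerivAt g (deriv g (s * x)) (s * x) :=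
      (hg.differentiable (by norm_num) _).hasDerivAt
    have h2 := (h1.comp x ((hasDerivAt_id x).const_mul s)).const_mul (s ^ i)
    refine h2.congr_deriv ?_
    ring

/-- Differentiation under the integral sign gives an integral of the same shape with `i + 1` and
`deriv g`, so one can induct on the order of smoothness. -/
theorem contDiff_integral_pow_mul_comp {g : ℝ → ℝ} (hg : ContDiff ℝ ∞ g) (i : ℕ) :
    ContDiff ℝ ∞ (fun t => ∫ s in (0 : ℝ)..1, s ^ i * g (s * t)) := by
  rw [contDiff_infty]
  intro n
  induction n generalizing g i with
  | zero =>
    exact contDiff_zero.2 (continuous_iff_continuousAt.2 fun t =>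
      (hasDerivAt_integral_pow_mul_comp hg i t).continuousAt)
  | succ n ih =>
    rw [Nat.cast_succ, contDiff_succ_iff_deriv]
    refine ⟨fun t => (hasDerivAt_integral_pow_mul_comp hg i t).differentiableAt, by simp, ?_⟩
    rw [funext fun t => (hasDerivAt_integral_pow_mul_comp hg i t).deriv]
    exact ih (contDiff_infty_iff_deriv.1 hg).2 (i + 1)

theorem exists_hadamard_of_contDiff {f : ℝ → ℝ} (hf : ContDiff ℝ ∞ f) :
    ∃ g : ℝ → ℝ, ContDiff ℝ ∞ g ∧ ∀ t, f t = f 0 + t * g t := by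
  have hd : ContDiff ℝ ∞ (deriv f) := (contDiff_infty_iff_deriv.1 hf).2
  refine ⟨_, contDiff_integral_pow_mul_comp hd 0, fun t => ?_⟩
  have h1 : ∀ s ∈ uIcc (0 : ℝ) 1, HasDerivAt (fun s => f (s * t)) (t * deriv f (s * t)) s := by
    intro s _
    have h1 : HasDerivAt f (deriv f (s * t)) (s * t) :=
      (hf.differentiable (by norm_num) _).hasDerivAt
    refine (h1.comp s ((hasDerivAt_id s).mul_const t)).congr_deriv ?_
    ring
  have hc : Continuous (fun s : ℝ => t * deriv f (s * t)) := by
    have := hd.continuous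
    fun_prop
  have h2 := intervalIntegral.integral_eq_sub_of_hasDerivAt h1 (hc.intervalIntegrable _ _)
  rw [intervalIntegral.integral_const_mul] at h2
  simp only [pow_zero, one_mul, zero_mul] at h2 ⊢
  linarith

/-- Near `0` the quotient is that of a cut-off of `b`, smooth on the whole line; away from `0` it is
`(b t - b 0) / t`. In this way `b` need not be extended beyond the interval. -/
theorem exists_hadamard {r : ℝ} (hr : 0 < r) {b : ℝ → ℝ} (hb : ContDiffOn ℝ ∞ b (Icc (-r) r)) :
    ∃ g : ℝ → ℝ, ContDiffOn ℝ ∞ g (Icc (-r) r) ∧ ∀ t ∈ Icc (-r) r, b t = b 0 + t * g t := by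
  let χ : ContDiffBump (0 : ℝ) := ⟨r / 4, r / 2, by linarith, by linarith⟩
  have hint : ∀ x, |x| < r → ContDiffAt ℝ ∞ b x := fun x hx =>
    hb.contDiffAt (Icc_mem_nhds (abs_lt.1 hx).1 (abs_lt.1 hx).2)
  have hf : ContDiff ℝ ∞ (fun x => χ x * b x) := by
    rw [contDiff_iff_contDiffAt]
    intro x
    rcases lt_or_ge |x| r with h | h
    · exact χ.contDiff.contDiffAt.mul (hint x h)
    · have h0 : (fun x => χ x * b x) =ᶠ[𝓝 x] fun _ => 0 := by
        have hlt : r / 2 < |x| := by linarith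
        filter_upwards [(continuous_abs.tendsto x).eventually (eventually_gt_nhds hlt)] with y hy
        rw [χ.zero_of_le_dist (by simpa [Real.dist_eq] using hy.le), zero_mul]
      exact contDiffAt_const.congr_of_eventuallyEq h0
  obtain ⟨g₀, hg₀, h0⟩ := exists_hadamard_of_contDiff hf
  have hχ : ∀ x, |x| ≤ r / 4 → χ x = 1 := fun x hx =>
    χ.one_of_mem_closedBall (by simpa [Real.dist_eq] using hx)
  have hnear : ∀ x, |x| ≤ r / 4 → b x = b 0 + x * g₀ x := by
    intro x hx
    have := h0 x
    simpa [hχ x hx, hχ 0 (by simp; linarith)] using this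
  refine ⟨fun t => if t = 0 then g₀ 0 else (b t - b 0) / t, ?_, ?_⟩
  · intro x hx
    rcases eq_or_ne x 0 with rfl | hx0
    · refine ContDiffAt.contDiffWithinAt (hg₀.contDiffAt.congr_of_eventuallyEq ?_)
      have h4 : (0 : ℝ) < r / 4 := by linarith
      have : ∀ᶠ y : ℝ in 𝓝 0, |y| < r / 4 := by
        have := (continuous_abs.tendsto (0 : ℝ)).eventually (eventually_lt_nhds (b := r / 4) (by simpa))
        exact this
      filter_upwards [this] with y hy
      by_cases hy0 : y = 0
      · simp [hy0]
      · rw [if_neg hy0, hnear y hy.le]; field_simp; ring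
    · refine (((hb x hx).sub contDiffWithinAt_const).div contDiffWithinAt_id hx0).congr_of_eventuallyEq
        (f := fun t => (b t - b 0) / t) ?_ (by simp [hx0])
      filter_upwards [mem_nhdsWithin_of_mem_nhds (isOpen_ne.mem_nhds hx0)] with y hy
      rw [if_neg hy]
  · intro t _
    by_cases ht0 : t = 0
    · simp [ht0]
    · simp only [if_neg ht0]; field_simp; ring

theorem exists_partial_deriv {r : ℝ} (hr : 0 < r) {I : Set ℝ} (hI : UniqueDiffOn ℝ I)
    {φ : ℝ → ℝ → ℝ} (hφ : ContDiffOn ℝ ∞ (fun x : ℝ × ℝ => φ x.1 x.2) (Icc (-r) r ×ˢ I)) :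
    ∃ φ' : ℝ → ℝ → ℝ, ContDiffOn ℝ ∞ (fun x : ℝ × ℝ => φ' x.1 x.2) (Icc (-r) r ×ˢ I) ∧
      ∀ t ∈ Icc (-r) r, ∀ η ∈ I, HasDerivWithinAt (φ t) (φ' t η) I η := by
  have hu : UniqueDiffOn ℝ (Icc (-r) r ×ˢ I) := (uniqueDiffOn_Icc (by linarith)).prod hI
  refine ⟨fun t η => fderivWithin ℝ (fun x : ℝ × ℝ => φ x.1 x.2) (Icc (-r) r ×ˢ I) (t, η) (0, 1),
    (hφ.fderivWithin hu (by simp)).clm_apply contDiffOn_const, fun t ht η hη => ?_⟩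
  have h1 := ((hφ.differentiableOn (by simp)) (t, η) ⟨ht, hη⟩).hasFDerivWithinAt
  have h2 : HasDerivWithinAt (fun s : ℝ => (t, s)) ((0 : ℝ), (1 : ℝ)) I η :=
    (hasDerivWithinAt_const η I t).prodMk (hasDerivWithinAt_id η I)
  exact h1.comp_hasDerivWithinAt η h2 (fun s hs => ⟨ht, hs⟩)

section ParamTaylor

variable {r : ℝ} {I J : Set ℝ}

/-- One integration step in the proof of Taylor's formula. -/
theorem lipschitz_remainder_of_deriv (hJI : J ⊆ I) (hJ : Convex ℝ J)
    {φ φ' : ℝ → ℝ → ℝ} (hd : ∀ t ∈ Icc (-r) r, ∀ η ∈ I, HasDerivWithinAt (φ t) (φ' t η) I η)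
    {N : ℕ} {c : ℕ → ℝ → ℝ} {C : ℝ} (hC0 : 0 ≤ C) (hC : ∀ t ∈ Icc (-r) r, ∀ η ∈ J,
      |φ' t η - ∑ l ∈ Finset.range N, c l t * η ^ l| ≤ C * |η| ^ N)
    {d : ℕ → ℝ → ℝ} (hdc : ∀ l t, d (l + 1) t = c l t / (l + 1)) :
    ∀ t ∈ Icc (-r) r, ∀ η ∈ J, ∀ η' ∈ J,
      |(φ t η - ∑ l ∈ Finset.range (N + 1), d l t * η ^ l)
        - (φ t η' - ∑ l ∈ Finset.range (N + 1), d l t * η' ^ l)|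
        ≤ C * (max |η| |η'|) ^ N * |η - η'| := by
  intro t ht η hη η' hη'
  set m := max |η| |η'| with hm
  have hconv : Convex ℝ (J ∩ Icc (-m) m) := hJ.inter (convex_Icc _ _)
  have hder : ∀ x ∈ J ∩ Icc (-m) m, HasDerivWithinAt
      (fun η => φ t η - ∑ l ∈ Finset.range (N + 1), d l t * η ^ l)
      (φ' t x - ∑ l ∈ Finset.range N, c l t * x ^ l) (J ∩ Icc (-m) m) x := by
    intro x hx
    refine ((hd t ht x (hJI hx.1)).mono (inter_subset_left.trans hJI)).sub ?_
    have h1 : HasDerivAt (fun η => ∑ l ∈ Finset.range (N + 1), d l t * η ^ l)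
        (∑ l ∈ Finset.range (N + 1), d l t * (l * x ^ (l - 1))) x :=
      HasDerivAt.fun_sum fun l _ => (hasDerivAt_pow l x).const_mul _
    refine (h1.congr_deriv ?_).hasDerivWithinAt
    rw [Finset.sum_range_succ']
    simp only [Nat.cast_zero, zero_mul, mul_zero, add_zero]
    refine Finset.sum_congr rfl fun l _ => ?_
    rw [hdc]
    push_cast
    have : (l : ℝ) + 1 ≠ 0 := by positivity
    field_simp
  have := hconv.norm_image_sub_le_of_norm_hasDerivWithin_le (C := C * m ^ N) hder
    (fun x hx => (hC t ht x hx.1).trans (by gcongr; exact abs_le.2 hx.2))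
    (x := η') (y := η) ⟨hη', abs_le.1 (le_max_right _ _)⟩ ⟨hη, abs_le.1 (le_max_left _ _)⟩
  simpa [Real.norm_eq_abs] using this

theorem contDiffOn_slice {φ : ℝ → ℝ → ℝ}
    (hφ : ContDiffOn ℝ ∞ (fun x : ℝ × ℝ => φ x.1 x.2) (Icc (-r) r ×ˢ I)) {η : ℝ} (hη : η ∈ I) :
    ContDiffOn ℝ ∞ (fun t => φ t η) (Icc (-r) r) :=
  hφ.comp (contDiffOn_id.prodMk contDiffOn_const) (fun _ ht => ⟨ht, hη⟩)

theorem iteratedDeriv_succ_of_hasDeriv {φ φ' : ℝ → ℝ} (h : ∀ x, HasDerivAt φ (φ' x) x) (l : ℕ) :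
    iteratedDeriv (l + 1) φ 0 = iteratedDeriv l φ' 0 := by
  rw [iteratedDeriv_succ', funext fun x => (h x).deriv]

/-- Induction on `N`: expand the partial derivative to one order less and integrate. `I` carries the
smoothness, while `J` is a compact convex part containing `0` on which the remainder is uniform. `I`
is the whole line for `S`, where the coefficients must be recognised as derivatives, and a half-open
interval at `0` for `P`. -/
theorem exists_param_taylor (hr : 0 < r) (hI : UniqueDiffOn ℝ I) (hJI : J ⊆ I) (hJ : Convex ℝ J)
    (hJc : IsCompact J) (h0 : (0 : ℝ) ∈ J) (N : ℕ) {φ : ℝ → ℝ → ℝ}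
    (hφ : ContDiffOn ℝ ∞ (fun x : ℝ × ℝ => φ x.1 x.2) (Icc (-r) r ×ˢ I)) :
    ∃ c : ℕ → ℝ → ℝ, (∀ l, ContDiffOn ℝ ∞ (c l) (Icc (-r) r)) ∧
      (I = univ → ∀ l < N, ∀ t ∈ Icc (-r) r,
        c l t * (l.factorial : ℝ) = iteratedDeriv l (φ t) 0) ∧
      ∃ C, 0 ≤ C ∧ ∀ t ∈ Icc (-r) r, ∀ η ∈ J,
        |φ t η - ∑ l ∈ Finset.range N, c l t * η ^ l| ≤ C * |η| ^ N := by
  induction N generalizing φ with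
  | zero =>
    obtain ⟨C, hC⟩ := ((isCompact_Icc (a := -r) (b := r)).prod hJc).exists_bound_of_continuousOn
      (hφ.continuousOn.mono (prod_mono_right hJI))
    refine ⟨fun _ _ => 0, fun _ => contDiffOn_const, by simp, max C 0, le_max_right _ _,
      fun t ht η hη => ?_⟩
    simpa using Or.inl (hC (t, η) ⟨ht, hη⟩)
  | succ N ih =>
    obtain ⟨φ', hφ', hd⟩ := exists_partial_deriv hr hI hφ
    obtain ⟨c, hc, hci, C, hC0, hC⟩ := ih hφ'
    let d : ℕ → ℝ → ℝ := fun l t => match l with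
      | 0 => φ t 0
      | l + 1 => c l t / (l + 1)
    have hs := lipschitz_remainder_of_deriv hJI hJ hd hC0 hC (d := d) (fun _ _ => rfl)
    refine ⟨d, ?_, ?_, C, hC0, ?_⟩
    · rintro (_ | l)
      · exact contDiffOn_slice hφ (hJI h0)
      · exact (hc l).div_const _
    · rintro hIu (_ | l) hl t ht
      · simp [d]
      · have hd' : ∀ x, HasDerivAt (φ t) (φ' t x) x := by
          intro x
          have := hd t ht x (by rw [hIu]; trivial)
          rwa [hIu, hasDerivWithinAt_univ] at this
        rw [iteratedDeriv_succ_of_hasDeriv hd', ← hci hIu l (by omega) t ht]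
        simp only [d, Nat.factorial_succ]
        push_cast
        field_simp
    · intro t ht η hη
      have h1 := hs t ht η hη 0 h0
      have h2 : φ t 0 - ∑ l ∈ Finset.range (N + 1), d l t * (0 : ℝ) ^ l = 0 := by
        rw [Finset.sum_range_succ']; simp [d]
      rw [h2, sub_zero, abs_zero, max_eq_left (abs_nonneg η), sub_zero] at h1
      rw [pow_succ, ← mul_assoc]
      exact h1

end ParamTaylor

/-! ### The right-hand side of the equation -/

theorem iteratedDeriv_succ_id_mul_zero {g : ℝ → ℝ} {n : ℕ} (hg : ContDiffAt ℝ ∞ g 0) :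
    iteratedDeriv (n + 1) (fun t => t * g t) 0 = (n + 1) * iteratedDeriv n g 0 := by
  rw [iteratedDeriv_fun_mul (f := fun t : ℝ => t) contDiffAt_id (hg.of_le (by exact_mod_cast le_top)),
    Finset.sum_eq_single_of_mem 1 (by simp)]
  · rw [iteratedDeriv_fun_id_zero]
    simp
  · intro i _ hi
    rw [iteratedDeriv_fun_id_zero, if_neg hi]
    simp

/-- Hadamard's lemma applied `q` times: each division by `t` lowers the order of the vanishing
derivatives at `0` by one. -/
theorem exists_flat_factor {r : ℝ} (hr : 0 < r) (q : ℕ) {s : ℝ → ℝ}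
    (hs : ContDiffOn ℝ ∞ s (Icc (-r) r)) (h0 : ∀ i < q, iteratedDeriv i s 0 = 0) :
    ∃ b : ℝ → ℝ, ContDiffOn ℝ ∞ b (Icc (-r) r) ∧ ∀ t ∈ Icc (-r) r, s t = t ^ q * b t := by
  induction q generalizing s with
  | zero => exact ⟨s, hs, by simp⟩
  | succ q ih =>
    obtain ⟨g, hg, hsg⟩ := exists_hadamard hr hs
    have hs0 : s 0 = 0 := by simpa using h0 0 (Nat.succ_pos q)
    have hnhds : Icc (-r) r ∈ 𝓝 (0 : ℝ) := Icc_mem_nhds (by linarith) hr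
    have he : s =ᶠ[𝓝 0] fun t => t * g t := by
      filter_upwards [hnhds] with t ht
      rw [hsg t ht, hs0, zero_add]
    obtain ⟨b, hb, hgb⟩ := ih hg (by
      intro i hi
      have h1 := h0 (i + 1) (by omega)
      rw [he.iteratedDeriv_eq, iteratedDeriv_succ_id_mul_zero (hg.contDiffAt hnhds)] at h1
      exact (mul_eq_zero.1 h1).resolve_left (by positivity))
    exact ⟨b, hb, fun t ht => by rw [hsg t ht, hs0, hgb t ht]; ring⟩

namespace CanardData

variable {D : CanardData}

/-- The Taylor expansion of `S` in `α`. -/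
theorem Admissible.exists_S_taylor (hD : D.Admissible) (J : ℕ) :
    ∃ b : ℕ → ℝ → ℝ, (∀ l, ContDiffOn ℝ ∞ (b l) (Icc (-D.t₀) D.t₀)) ∧
      ∃ C, 0 ≤ C ∧ ∀ t ∈ Icc (-D.t₀) D.t₀, ∀ a a' : ℝ, |a| ≤ 1 → |a'| ≤ 1 →
        |(D.S t a - ∑ l ∈ Finset.range J,
            t ^ (D.p + 2 - (D.p - D.L + 1) * (l + 1)) * b l t * a ^ (l + 1))
          - (D.S t a' - ∑ l ∈ Finset.range J,
            t ^ (D.p + 2 - (D.p - D.L + 1) * (l + 1)) * b l t * a' ^ (l + 1))|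
          ≤ C * (max |a| |a'|) ^ J * |a - a'| := by
  obtain ⟨S', hS', hd⟩ := exists_partial_deriv hD.t₀_pos uniqueDiffOn_univ hD.smooth_S
  obtain ⟨c, hc, hci, C, hC0, hC⟩ := exists_param_taylor (J := Icc (-1) 1) hD.t₀_pos
    uniqueDiffOn_univ (subset_univ _) (convex_Icc _ _) isCompact_Icc (by simp) J hS'
  have hnhds : Icc (-D.t₀) D.t₀ ∈ 𝓝 (0 : ℝ) := Icc_mem_nhds (by linarith [hD.t₀_pos]) hD.t₀_pos
  -- The weight condition annihilates the derivatives in `t` of order `< p + 2 - (p-L+1)(l+1)` of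
  -- the coefficient of `a^(l+1)`. The subtraction is truncated: no power of `t` is extracted once
  -- `a^(l+1)` alone has weight at least `p + 2`.
  have hb : ∀ l, ∃ b : ℝ → ℝ, ContDiffOn ℝ ∞ b (Icc (-D.t₀) D.t₀) ∧ (l < J →
      ∀ t ∈ Icc (-D.t₀) D.t₀, c l t / (l + 1) = t ^ (D.p + 2 - (D.p - D.L + 1) * (l + 1)) * b t) := by
    intro l
    by_cases hl : l < J
    · obtain ⟨b, hb, h⟩ := exists_flat_factor hD.t₀_pos (D.p + 2 - (D.p - D.L + 1) * (l + 1))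
        ((hc l).div_const ((l : ℝ) + 1)) (by
          intro i hi
          have e : (fun t => c l t / ((l : ℝ) + 1)) =ᶠ[𝓝 0]
              fun t => (((l : ℝ) + 1) * l.factorial)⁻¹ * iteratedDeriv (l + 1) (fun a => D.S t a) 0 := by
            filter_upwards [hnhds] with t ht
            have hd' : ∀ x, HasDerivAt (D.S t) (S' t x) x := fun x => by
              have := hd t ht x trivial
              rwa [hasDerivWithinAt_univ] at this
            have h1 : iteratedDeriv (l + 1) (fun a => D.S t a) 0 = iteratedDeriv l (S' t) 0 :=
              iteratedDeriv_succ_of_hasDeriv hd' l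
            rw [h1, ← hci rfl l hl t ht]
            have := Nat.factorial_pos l
            field_simp
          rw [e.iteratedDeriv_eq, iteratedDeriv_const_mul_field, hD.valuation_S i (l + 1) (by omega),
            mul_zero])
      exact ⟨b, hb, fun _ => h⟩
    · exact ⟨0, contDiffOn_const, fun h => absurd h hl⟩
  choose b hbs hbe using hb
  refine ⟨b, hbs, C, hC0, fun t ht a a' ha ha' => ?_⟩
  -- The constant term can be set to `0`, since it cancels in the difference of two remainders.
  have := lipschitz_remainder_of_deriv (subset_univ _) (convex_Icc (-1 : ℝ) 1) hd hC0 hC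
    (d := fun l t => match l with
      | 0 => 0
      | l + 1 => c l t / (l + 1)) (fun _ _ => rfl) t ht a (abs_le.1 ha) a' (abs_le.1 ha')
  have hsum : ∀ a : ℝ, ∑ l ∈ Finset.range J,
      t ^ (D.p + 2 - (D.p - D.L + 1) * (l + 1)) * b l t * a ^ (l + 1)
      = ∑ l ∈ Finset.range J, c l t / (l + 1) * a ^ (l + 1) := fun a =>
    Finset.sum_congr rfl fun l hl => by rw [hbe l (Finset.mem_range.1 hl) t ht]
  rw [hsum, hsum]
  simpa [Finset.sum_range_succ'] using this

/-- With `t = ηT` the monomial has order at least `p + 2` in `η` and degree at most `p` in `T`; the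
latter uses `2 ≤ m`. -/
theorem weight_le {p m l : ℕ} (hm : 2 ≤ m) {η t : ℝ} (hη : 0 < η) (hη1 : η ≤ 1) :
    |t| ^ (p + 2 - m * (l + 1)) * η ^ (m * (l + 1)) ≤ η ^ (p + 2) * (1 + |t / η| ^ p) := by
  set e := p + 2 - m * (l + 1) with he
  have hle : e ≤ p := by
    have : 2 ≤ m * (l + 1) := by nlinarith
    omega
  have ht : |t| = η * |t / η| := by rw [abs_div, abs_of_pos hη]; field_simp
  have h1 : η ^ (e + m * (l + 1)) ≤ η ^ (p + 2) := pow_le_pow_of_le_one hη.le hη1 (by omega)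
  have h2 := pow_le_one_add_pow (abs_nonneg (t / η)) hle
  calc |t| ^ e * η ^ (m * (l + 1)) = η ^ (e + m * (l + 1)) * |t / η| ^ e := by
        rw [ht, mul_pow, pow_add]; ring
    _ ≤ _ := by gcongr

theorem eventually_pos_le {c : ℝ} (hc : 0 < c) : ∀ᶠ η : ℝ in 𝓝[>] 0, 0 < η ∧ η ≤ c := by
  filter_upwards [Ioc_mem_nhdsGT hc] with η hη using hη

theorem Admissible.two_le (hD : D.Admissible) : 2 ≤ D.p - D.L + 1 := by
  have := hD.L_lt_p; omega

theorem pow_mul_abs_le_one {m : ℕ} (hm : 2 ≤ m) {η M a : ℝ} (hη : 0 < η) (hM : 0 ≤ M)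
    (h1 : η ≤ 1 / (M + 1)) (ha : |a| ≤ M) : |η ^ m * a| ≤ 1 := by
  have h2 : η ≤ 1 := h1.trans (by rw [div_le_one (by linarith)]; linarith)
  rw [abs_mul, abs_of_pos (by positivity)]
  calc η ^ m * |a| ≤ η ^ 1 * M :=
        mul_le_mul (pow_le_pow_of_le_one hη.le h2 (by omega)) ha (abs_nonneg _) (by positivity)
    _ ≤ 1 / (M + 1) * (M + 1) := by rw [pow_one]; gcongr; linarith
    _ = 1 := by field_simp

/-- Every Taylor term in `α` has weight at least `p + 2`, and the remainder has a higher one. The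
power `η^(p+2)` exceeds by one the `η^(p+1)` by which the equation is divided: this is the source of
the contraction. -/
theorem Admissible.S_lipschitz (hD : D.Admissible) {M : ℝ} (hM : 0 ≤ M) :
    ∃ C, 0 ≤ C ∧ ∀ᶠ η in 𝓝[>] (0 : ℝ), ∀ t ∈ Icc (-D.t₀) D.t₀, ∀ a a' : ℝ, |a| ≤ M → |a'| ≤ M →
      |D.S t (η ^ (D.p - D.L + 1) * a) - D.S t (η ^ (D.p - D.L + 1) * a')|
        ≤ C * η ^ (D.p + 2) * (1 + |t / η| ^ D.p) * |a - a'| := by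
  set m := D.p - D.L + 1 with hm
  have hm2 : 2 ≤ m := hD.two_le
  obtain ⟨b, hb, C, hC0, hC⟩ := hD.exists_S_taylor (D.p + 2)
  choose B hB using fun l => isCompact_Icc.exists_bound_of_continuousOn (hb l).continuousOn
  have hB0 : ∀ l, 0 ≤ B l := fun l =>
    (norm_nonneg _).trans (hB l 0 ⟨by linarith [hD.t₀_pos], hD.t₀_pos.le⟩)
  refine ⟨(∑ l ∈ Finset.range (D.p + 2), B l * ((l + 1) * M ^ l)) + C * M ^ (D.p + 2),
    add_nonneg (Finset.sum_nonneg fun l _ => mul_nonneg (hB0 l) (by positivity)) (by positivity), ?_⟩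
  filter_upwards [eventually_pos_le (show 0 < 1 / (M + 1) by positivity)] with η hη t ht a a' ha ha'
  obtain ⟨hη0, hη1⟩ := hη
  have hle1 : η ≤ 1 := hη1.trans (by rw [div_le_one (by linarith)]; linarith)
  have h1 := hC t ht _ _ (pow_mul_abs_le_one hm2 hη0 hM hη1 ha) (pow_mul_abs_le_one hm2 hη0 hM hη1 ha')
  set w := η ^ (D.p + 2) * (1 + |t / η| ^ D.p) with hw
  have hw0 : 0 ≤ w := by positivity
  have hsum : ∀ x y : ℝ, ∑ l ∈ Finset.range (D.p + 2), t ^ (D.p + 2 - m * (l + 1)) * b l t * x ^ (l + 1)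
      - ∑ l ∈ Finset.range (D.p + 2), t ^ (D.p + 2 - m * (l + 1)) * b l t * y ^ (l + 1)
      = ∑ l ∈ Finset.range (D.p + 2), t ^ (D.p + 2 - m * (l + 1)) * b l t * (x ^ (l + 1) - y ^ (l + 1)) := by
    intro x y
    rw [← Finset.sum_sub_distrib]
    exact Finset.sum_congr rfl fun l _ => by ring
  have h2 : |∑ l ∈ Finset.range (D.p + 2), t ^ (D.p + 2 - m * (l + 1)) * b l t
        * ((η ^ m * a) ^ (l + 1) - (η ^ m * a') ^ (l + 1))|
      ≤ ∑ l ∈ Finset.range (D.p + 2), B l * ((l + 1) * M ^ l) * (w * |a - a'|) := by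
    refine (Finset.abs_sum_le_sum_abs _ _).trans (Finset.sum_le_sum fun l _ => ?_)
    have e1 : |a ^ (l + 1) - a' ^ (l + 1)| ≤ |a - a'| * ((l + 1) * M ^ l) := by
      have := abs_pow_sub_pow_le a a' (l + 1)
      simp only [Nat.add_sub_cancel] at this
      push_cast at this
      refine this.trans ?_
      rw [mul_assoc]
      gcongr
      exact max_le ha ha'
    have e2 : t ^ (D.p + 2 - m * (l + 1)) * b l t * ((η ^ m * a) ^ (l + 1) - (η ^ m * a') ^ (l + 1))
        = (t ^ (D.p + 2 - m * (l + 1)) * η ^ (m * (l + 1))) * b l t * (a ^ (l + 1) - a' ^ (l + 1)) := by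
      rw [mul_pow, mul_pow, ← pow_mul]; ring
    rw [e2, abs_mul, abs_mul, abs_mul, abs_pow, abs_of_pos (show 0 < η ^ (m * (l + 1)) by positivity)]
    calc _ ≤ w * B l * (|a - a'| * ((l + 1) * M ^ l)) := by
          have := hB l t ht
          rw [Real.norm_eq_abs] at this
          exact mul_le_mul (mul_le_mul (weight_le hm2 hη0 hle1) this (abs_nonneg _) hw0) e1
            (abs_nonneg _) (mul_nonneg hw0 (hB0 l))
      _ = _ := by ring
  have h3 : max |η ^ m * a| |η ^ m * a'| ≤ η ^ m * M := by
    rw [abs_mul, abs_mul, abs_of_pos (show 0 < η ^ m by positivity)]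
    exact max_le (by gcongr) (by gcongr)
  have h4 : C * max |η ^ m * a| |η ^ m * a'| ^ (D.p + 2) * |η ^ m * a - η ^ m * a'|
      ≤ C * M ^ (D.p + 2) * (w * |a - a'|) := by
    have e0 : |η ^ m * a - η ^ m * a'| = η ^ m * |a - a'| := by
      rw [← mul_sub, abs_mul, abs_of_pos (show 0 < η ^ m by positivity)]
    rw [e0]
    have e1 : η ^ (m * (D.p + 2) + m) ≤ w := by
      have h1 : η ^ (m * (D.p + 2) + m) ≤ η ^ (D.p + 2) :=
        pow_le_pow_of_le_one hη0.le hle1 (by nlinarith)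
      have h2 : (0 : ℝ) ≤ |t / η| ^ D.p := by positivity
      have h3 : (0 : ℝ) ≤ η ^ (D.p + 2) := by positivity
      rw [hw]; nlinarith
    calc _ ≤ C * (η ^ m * M) ^ (D.p + 2) * (η ^ m * |a - a'|) := by gcongr
      _ = C * M ^ (D.p + 2) * (η ^ (m * (D.p + 2) + m) * |a - a'|) := by
          rw [mul_pow, ← pow_mul, pow_add]; ring
      _ ≤ _ := by gcongr
  have h5 := abs_add_le
    ((D.S t (η ^ m * a) - ∑ l ∈ Finset.range (D.p + 2),
            t ^ (D.p + 2 - m * (l + 1)) * b l t * (η ^ m * a) ^ (l + 1))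
          - (D.S t (η ^ m * a') - ∑ l ∈ Finset.range (D.p + 2),
            t ^ (D.p + 2 - m * (l + 1)) * b l t * (η ^ m * a') ^ (l + 1)))
    (∑ l ∈ Finset.range (D.p + 2), t ^ (D.p + 2 - m * (l + 1)) * b l t
        * ((η ^ m * a) ^ (l + 1) - (η ^ m * a') ^ (l + 1)))
  rw [← Finset.sum_mul] at h2
  have e : ∀ A B X Y : ℝ, A - X - (B - Y) + (X - Y) = A - B := by intros; ring
  rw [← hsum, e, hsum] at h5
  calc _ ≤ _ := h5
    _ ≤ C * M ^ (D.p + 2) * (w * |a - a'|)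
      + (∑ l ∈ Finset.range (D.p + 2), B l * ((l + 1) * M ^ l)) * (w * |a - a'|) :=
        add_le_add (h1.trans h4) h2
    _ = _ := by rw [hw]; ring

/-- A smooth function is Lipschitz on a compact convex set, and `v`, `β` enter multiplied by `η` and
`η^(p-L+1)`, hence the factor `η`. -/
theorem Admissible.P_bounds (hD : D.Admissible) {M : ℝ} (hM : 0 ≤ M) :
    ∃ C, 0 ≤ C ∧ ∀ᶠ η in 𝓝[>] (0 : ℝ), ∀ t ∈ Icc (-D.t₀) D.t₀, ∀ b b' v v' : ℝ,
      |b| ≤ M → |b'| ≤ M → |v| ≤ M → |v'| ≤ M →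
      |D.P t (η * v) (η ^ (D.p - D.L + 1) * b) η| ≤ C ∧
      |D.P t (η * v) (η ^ (D.p - D.L + 1) * b) η - D.P t (η * v') (η ^ (D.p - D.L + 1) * b') η|
        ≤ C * η * (|b - b'| + |v - v'|) := by
  set m := D.p - D.L + 1 with hm
  have hm2 : 2 ≤ m := hD.two_le
  have hη₀ := hD.η₀_pos
  set K : Set (ℝ × ℝ × ℝ × ℝ) := Icc (-D.t₀) D.t₀ ×ˢ Icc (-1) 1 ×ˢ Icc (-1) 1 ×ˢ Icc 0 (D.η₀ / 2)
    with hK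
  have hKc : IsCompact K := isCompact_Icc.prod (isCompact_Icc.prod (isCompact_Icc.prod isCompact_Icc))
  have hKx : Convex ℝ K := (convex_Icc _ _).prod ((convex_Icc _ _).prod
    ((convex_Icc _ _).prod (convex_Icc _ _)))
  have hsm := hD.smooth_P.mono (t := K) (prod_mono_right (prod_mono (subset_univ _)
    (prod_mono (subset_univ _) (Icc_subset_Ico_right (by linarith)))))
  obtain ⟨κ, hκ⟩ := hsm.exists_lipschitzOnWith (by simp) hKx hKc
  obtain ⟨B, hB⟩ := hKc.exists_bound_of_continuousOn hsm.continuousOn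
  refine ⟨max B κ, le_max_of_le_right κ.2, ?_⟩
  filter_upwards [eventually_pos_le (show 0 < 1 / (M + 1) by positivity),
    eventually_pos_le (show 0 < D.η₀ / 2 by positivity)] with η hη hη' t ht b b' v v' hb hb' hv hv'
  obtain ⟨hη0, hη1⟩ := hη
  have hle1 : η ≤ 1 := hη1.trans (by rw [div_le_one (by linarith)]; linarith)
  have hv1 : ∀ v, |v| ≤ M → |η * v| ≤ 1 := fun v hv => by
    rw [abs_mul, abs_of_pos hη0]
    calc η * |v| ≤ 1 / (M + 1) * (M + 1) := by gcongr; linarith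
      _ = 1 := by field_simp
  have hmem : ∀ b v, |b| ≤ M → |v| ≤ M → (t, η * v, η ^ m * b, η) ∈ K := fun b v hb hv =>
    ⟨ht, abs_le.1 (hv1 v hv), abs_le.1 (pow_mul_abs_le_one hm2 hη0 hM hη1 hb), hη'.1.le, hη'.2⟩
  refine ⟨(hB _ (hmem b v hb hv)).trans (le_max_left _ _), ?_⟩
  have := hκ.dist_le_mul _ (hmem b v hb hv) _ (hmem b' v' hb' hv')
  rw [Real.dist_eq] at this
  refine this.trans ?_
  rw [mul_assoc]
  gcongr
  · exact le_max_right _ _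
  · simp only [Prod.dist_eq, dist_self, Real.dist_eq, ← mul_sub, abs_mul, abs_of_pos hη0,
      abs_of_pos (show 0 < η ^ m by positivity)]
    have e1 : η ^ m * |b - b'| ≤ η * |b - b'| := by
      gcongr
      calc η ^ m ≤ η ^ 1 := pow_le_pow_of_le_one hη0.le hle1 (by omega)
        _ = η := pow_one η
    have e2 : 0 ≤ η * |b - b'| := by positivity
    have e3 : 0 ≤ η * |v - v'| := by positivity
    rw [mul_add]
    refine max_le (by linarith) (max_le (by linarith) (max_le (by linarith) (by linarith)))

/-- The inhomogeneous term of the equation divided by `η^(p+1)`. -/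
noncomputable def rhs (D : CanardData) (η a b v t : ℝ) : ℝ :=
  D.S t (η ^ (D.p - D.L + 1) * a) / η ^ (D.p + 1) + D.P t (η * v) (η ^ (D.p - D.L + 1) * b) η

theorem Admissible.rhs_lipschitz (hD : D.Admissible) {M : ℝ} (hM : 0 ≤ M) :
    ∃ C, 0 ≤ C ∧ ∀ᶠ η in 𝓝[>] (0 : ℝ), ∀ t ∈ Icc (-D.t₀) D.t₀, ∀ a a' b b' v v' : ℝ,
      |a| ≤ M → |a'| ≤ M → |b| ≤ M → |b'| ≤ M → |v| ≤ M → |v'| ≤ M →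
      |D.rhs η a b v t - D.rhs η a' b' v' t|
        ≤ C * η * (|a - a'| + |b - b'| + |v - v'|) * (1 + |t / η| ^ D.p) := by
  obtain ⟨C₁, hC₁, h1⟩ := hD.S_lipschitz hM
  obtain ⟨C₂, hC₂, h2⟩ := hD.P_bounds hM
  refine ⟨C₁ + C₂, by positivity, ?_⟩
  filter_upwards [h1, h2, eventually_pos_le one_pos] with η h1 h2 hη t ht a a' b b' v v' ha ha' hb hb' hv hv'
  obtain ⟨hη0, -⟩ := hη
  have e1 := h1 t ht a a' ha ha'
  have e2 := (h2 t ht b b' v v' hb hb' hv hv').2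
  have e3 : D.rhs η a b v t - D.rhs η a' b' v' t =
      (D.S t (η ^ (D.p - D.L + 1) * a) - D.S t (η ^ (D.p - D.L + 1) * a')) / η ^ (D.p + 1)
      + (D.P t (η * v) (η ^ (D.p - D.L + 1) * b) η - D.P t (η * v') (η ^ (D.p - D.L + 1) * b') η) := by
    rw [rhs, rhs]; ring
  have hpos : 0 < η ^ (D.p + 1) := by positivity
  have e4 : |(D.S t (η ^ (D.p - D.L + 1) * a) - D.S t (η ^ (D.p - D.L + 1) * a')) / η ^ (D.p + 1)|
      ≤ C₁ * η * |a - a'| * (1 + |t / η| ^ D.p) := by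
    rw [abs_div, abs_of_pos hpos, div_le_iff₀ hpos]
    calc _ ≤ _ := e1
      _ = _ := by ring
  have hT : (0 : ℝ) ≤ |t / η| ^ D.p := by positivity
  rw [e3]
  calc _ ≤ C₁ * η * |a - a'| * (1 + |t / η| ^ D.p) + C₂ * η * (|b - b'| + |v - v'|) * (1 + |t / η| ^ D.p) := by
        refine (abs_add_le _ _).trans (add_le_add e4 (e2.trans ?_))
        exact le_mul_of_one_le_right (by positivity) (by linarith)
    _ ≤ (C₁ + C₂) * η * (|a - a'| + |b - b'| + |v - v'|) * (1 + |t / η| ^ D.p) := by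
        rw [← add_mul]
        gcongr
        have : 0 ≤ C₁ * η * (|b - b'| + |v - v'|) := by positivity
        have : 0 ≤ C₂ * η * |a - a'| := by positivity
        linarith

theorem Admissible.rhs_bound (hD : D.Admissible) {M : ℝ} (hM : 0 ≤ M) :
    ∃ C, 0 ≤ C ∧ ∀ᶠ η in 𝓝[>] (0 : ℝ), ∀ t ∈ Icc (-D.t₀) D.t₀, ∀ b v : ℝ,
      |b| ≤ M → |v| ≤ M → |D.rhs η 0 b v t| ≤ C := by
  obtain ⟨C, hC, h⟩ := hD.P_bounds hM
  refine ⟨C, hC, ?_⟩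
  filter_upwards [h] with η h t ht b v hb hv
  simpa [rhs, hD.S_zero t ht] using (h t ht b b v v hb hb hv hv).1

end CanardData

/-! ### Formal series and approximate solutions -/

theorem smoothEval_eq {r : ℝ} (f : smoothFunctions r) {t : ℝ} (ht : t ∈ Icc (-r) r) :
    smoothEval f t = (f : Icc (-r) r → ℝ) ⟨t, ht⟩ :=
  Subtype.val_injective.extend_apply (f : Icc (-r) r → ℝ) (0 : ℝ → ℝ) (⟨t, ht⟩ : Icc (-r) r)

theorem smoothEval_of_notMem {r : ℝ} (f : smoothFunctions r) {t : ℝ} (ht : t ∉ Icc (-r) r) :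
    smoothEval f t = 0 :=
  Function.extend_apply' _ _ _ (by rintro ⟨x, rfl⟩; exact ht x.2)

theorem smoothEval_add {r : ℝ} (f g : smoothFunctions r) (t : ℝ) :
    smoothEval (f + g) t = smoothEval f t + smoothEval g t := by
  by_cases ht : t ∈ Icc (-r) r
  · simp [smoothEval_eq _ ht]
  · simp [smoothEval_of_notMem _ ht]

theorem smoothEval_smul {r : ℝ} (a : ℝ) (f : smoothFunctions r) (t : ℝ) :
    smoothEval (a • f) t = a * smoothEval f t := by
  by_cases ht : t ∈ Icc (-r) r
  · simp [smoothEval_eq _ ht]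
  · simp [smoothEval_of_notMem _ ht]

theorem smoothEval_zero {r : ℝ} (t : ℝ) : smoothEval (0 : smoothFunctions r) t = 0 := by
  have := smoothEval_smul 0 (0 : smoothFunctions r) t
  simpa using this

theorem contDiffOn_smoothEval {r : ℝ} (f : smoothFunctions r) :
    ContDiffOn ℝ ∞ (smoothEval f) (Icc (-r) r) := f.2

theorem exists_smoothEval_eq {r : ℝ} {g : ℝ → ℝ} (hg : ContDiffOn ℝ ∞ g (Icc (-r) r)) :
    ∃ f : smoothFunctions r, ∀ t ∈ Icc (-r) r, smoothEval f t = g t := by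
  have h : ∀ t ∈ Icc (-r) r,
      Function.extend Subtype.val (fun x : Icc (-r) r => g x) (0 : ℝ → ℝ) t = g t := fun t ht =>
    Subtype.val_injective.extend_apply (fun x : Icc (-r) r => g x) (0 : ℝ → ℝ) (⟨t, ht⟩ : Icc (-r) r)
  exact ⟨⟨fun x => g x, hg.congr h⟩, h⟩

namespace CanardData

variable {D : CanardData}

/-- Formal series of couples. -/
abbrev FormalSeries (D : CanardData) : Type := (n : ℕ) → D.FormalTerm n

/-- The function `u(t) + ∑ u_{i,k} ψ̄_{i,k}(t/η)` of a formal term. -/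
noncomputable def termEval (D : CanardData) {n : ℕ} (e : D.FormalTerm n) (η t : ℝ) : ℝ :=
  smoothEval e.2.1 t + ∑ i : Fin (n + 1), ∑ k : {k : Fin D.p // (k : ℕ) ≠ D.L},
    e.2.2 i k * psiBar D.p D.L i k.1 (t / η)

theorem termEval_add {n : ℕ} (e e' : D.FormalTerm n) (η t : ℝ) :
    D.termEval (e + e') η t = D.termEval e η t + D.termEval e' η t := by
  simp only [termEval, Prod.snd_add, Prod.fst_add, smoothEval_add, Pi.add_apply, add_mul,
    Finset.sum_add_distrib]
  ring

theorem termEval_smul {n : ℕ} (a : ℝ) (e : D.FormalTerm n) (η t : ℝ) :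
    D.termEval (a • e) η t = a * D.termEval e η t := by
  simp only [termEval, Prod.smul_snd, Prod.smul_fst, smoothEval_smul, Pi.smul_apply, smul_eq_mul,
    mul_add, Finset.mul_sum, mul_assoc]

theorem termEval_zero {n : ℕ} (η t : ℝ) : D.termEval (0 : D.FormalTerm n) η t = 0 := by
  have := termEval_smul 0 (0 : D.FormalTerm n) η t
  simpa using this

/-- The sum of the first `N` terms of a formal series. -/
noncomputable def partialSum (D : CanardData) (c : D.FormalSeries) (N : ℕ) : CoupleFamily :=
  (fun η => ∑ n ∈ Finset.range N, (c n).1 * η ^ n,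
   fun η t => ∑ n ∈ Finset.range N, D.termEval (c n) η t * η ^ n)

theorem partialSum_add (c c' : D.FormalSeries) (N : ℕ) :
    D.partialSum (c + c') N = D.partialSum c N + D.partialSum c' N := by
  refine Prod.ext (funext fun η => ?_) (funext fun η => funext fun t => ?_)
  · simp [partialSum, add_mul, Finset.sum_add_distrib]
  · simp [partialSum, termEval_add, add_mul, Finset.sum_add_distrib]

theorem partialSum_smul (a : ℝ) (c : D.FormalSeries) (N : ℕ) :
    D.partialSum (a • c) N = a • D.partialSum c N := by
  refine Prod.ext (funext fun η => ?_) (funext fun η => funext fun t => ?_)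
  · simp [partialSum, Finset.mul_sum, mul_assoc]
  · simp [partialSum, termEval_smul, Finset.mul_sum, mul_assoc]

theorem partialSum_congr {c c' : D.FormalSeries} {N : ℕ} (h : ∀ n < N, c n = c' n) :
    D.partialSum c N = D.partialSum c' N := by
  refine Prod.ext (funext fun η => ?_) (funext fun η => funext fun t => ?_)
  · exact Finset.sum_congr rfl fun n hn =>
      congrArg (fun e : D.FormalTerm n => e.1 * η ^ n) (h n (Finset.mem_range.1 hn))
  · exact Finset.sum_congr rfl fun n hn =>
      congrArg (fun e : D.FormalTerm n => D.termEval e η t * η ^ n) (h n (Finset.mem_range.1 hn))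

/-- `y` solves the equation `η u' = (p+1) (t/η)^p u + α (t/η)^L + f` up to an error
`O(η^N (1 + |t/η|^p))` on `[-r, r]`. -/
def ApproxSol (D : CanardData) (r : ℝ) (N : ℕ) (y : CoupleFamily) (f : ℝ → ℝ → ℝ) : Prop :=
  ∃ C : ℝ, ∀ᶠ η in 𝓝[>] (0 : ℝ), ∀ t ∈ Icc (-r) r, ∃ u' : ℝ,
    HasDerivWithinAt (y.2 η) u' (Icc (-r) r) t ∧
      |η * u' - (((D.p : ℝ) + 1) * (t / η) ^ D.p * y.2 η t + y.1 η * (t / η) ^ D.L + f η t)|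
        ≤ C * η ^ N * (1 + |t / η| ^ D.p)

/-- `f = O(η^N (1 + |t/η|^p))` on `[-r, r]`. -/
def Negligible (D : CanardData) (r : ℝ) (N : ℕ) (f : ℝ → ℝ → ℝ) : Prop :=
  ∃ C : ℝ, ∀ᶠ η in 𝓝[>] (0 : ℝ), ∀ t ∈ Icc (-r) r, |f η t| ≤ C * η ^ N * (1 + |t / η| ^ D.p)

theorem ApproxSol.add {r : ℝ} {N : ℕ} {y y' : CoupleFamily} {f f' : ℝ → ℝ → ℝ}
    (h : D.ApproxSol r N y f) (h' : D.ApproxSol r N y' f') :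
    D.ApproxSol r N (y + y') (fun η t => f η t + f' η t) := by
  obtain ⟨C, hC⟩ := h
  obtain ⟨C', hC'⟩ := h'
  refine ⟨C + C', ?_⟩
  filter_upwards [hC, hC'] with η h h' t ht
  obtain ⟨u, hu, hb⟩ := h t ht
  obtain ⟨u', hu', hb'⟩ := h' t ht
  refine ⟨u + u', hu.add hu', ?_⟩
  have e : ∀ A B x1 x2 y1 y2 z1 z2 : ℝ, η * (u + u') - (A * (x1 + x2) + (y1 + y2) * B + (z1 + z2))
      = (η * u - (A * x1 + y1 * B + z1)) + (η * u' - (A * x2 + y2 * B + z2)) := by intros; ring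
  calc _ = _ := by simp only [Prod.snd_add, Prod.fst_add, Pi.add_apply]; rw [e]
    _ ≤ _ := abs_add_le _ _
    _ ≤ _ := add_le_add hb hb'
    _ = _ := by ring

theorem ApproxSol.smul {r : ℝ} {N : ℕ} {y : CoupleFamily} {f : ℝ → ℝ → ℝ} (a : ℝ)
    (h : D.ApproxSol r N y f) : D.ApproxSol r N (a • y) (fun η t => a * f η t) := by
  obtain ⟨C, hC⟩ := h
  refine ⟨|a| * C, ?_⟩
  filter_upwards [hC] with η h t ht
  obtain ⟨u, hu, hb⟩ := h t ht
  refine ⟨a * u, hu.const_mul a, ?_⟩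
  have e : ∀ A B x y z : ℝ, η * (a * u) - (A * (a * x) + (a * y) * B + a * z)
      = a * (η * u - (A * x + y * B + z)) := by intros; ring
  simp only [Prod.smul_snd, Prod.smul_fst, Pi.smul_apply, smul_eq_mul]
  rw [e, abs_mul]
  calc _ ≤ |a| * (C * η ^ N * (1 + |t / η| ^ D.p)) := by gcongr
    _ = _ := by ring

theorem ApproxSol.of_negligible {r : ℝ} {N : ℕ} {y : CoupleFamily} {f g : ℝ → ℝ → ℝ}
    (h : D.ApproxSol r N y f) (hg : D.Negligible r N (fun η t => g η t - f η t)) :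
    D.ApproxSol r N y g := by
  obtain ⟨C, hC⟩ := h
  obtain ⟨C', hC'⟩ := hg
  refine ⟨C + C', ?_⟩
  filter_upwards [hC, hC'] with η h h' t ht
  obtain ⟨u, hu, hb⟩ := h t ht
  refine ⟨u, hu, ?_⟩
  have e : ∀ A B : ℝ, η * u - (A + B + g η t) = (η * u - (A + B + f η t)) - (g η t - f η t) := by
    intros; ring
  rw [e]
  calc _ ≤ _ := abs_sub _ _
    _ ≤ _ := add_le_add hb (h' t ht)
    _ = _ := by ring

/-- The equation with right-hand side `f` has a formal solution up to `O(η^N)`. -/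
def Solvable (D : CanardData) (N : ℕ) (f : ℝ → ℝ → ℝ) : Prop :=
  ∃ c : D.FormalSeries, D.ApproxSol D.t₀ N (D.partialSum c N) f

theorem Solvable.add {N : ℕ} {f g : ℝ → ℝ → ℝ} (hf : D.Solvable N f) (hg : D.Solvable N g) :
    D.Solvable N (fun η t => f η t + g η t) := by
  obtain ⟨c, hc⟩ := hf
  obtain ⟨d, hd⟩ := hg
  exact ⟨c + d, by rw [partialSum_add]; exact hc.add hd⟩

theorem Solvable.smul {N : ℕ} {f : ℝ → ℝ → ℝ} (a : ℝ) (hf : D.Solvable N f) :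
    D.Solvable N (fun η t => a * f η t) := by
  obtain ⟨c, hc⟩ := hf
  exact ⟨a • c, by rw [partialSum_smul]; exact hc.smul a⟩

theorem Solvable.of_negligible {N : ℕ} {f g : ℝ → ℝ → ℝ} (hf : D.Solvable N f)
    (h : D.Negligible D.t₀ N (fun η t => g η t - f η t)) : D.Solvable N g := by
  obtain ⟨c, hc⟩ := hf
  exact ⟨c, hc.of_negligible h⟩

theorem Solvable.congr {N : ℕ} {f g : ℝ → ℝ → ℝ} (hf : D.Solvable N f)
    (h : ∀ᶠ η in 𝓝[>] (0 : ℝ), ∀ t ∈ Icc (-D.t₀) D.t₀, f η t = g η t) : D.Solvable N g := by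
  refine hf.of_negligible ⟨0, ?_⟩
  filter_upwards [h] with η h t ht
  simp [h t ht]

theorem solvable_zero {N : ℕ} : D.Solvable N (fun _ _ => 0) := by
  refine ⟨0, 0, ?_⟩
  refine Eventually.of_forall fun η t _ => ⟨0, ?_, ?_⟩
  · have : (D.partialSum 0 N).2 η = fun _ => 0 := by
      funext t; simp [partialSum, termEval_zero]
    rw [this]
    exact hasDerivWithinAt_const _ _ _
  · simp [partialSum, termEval_zero]

theorem solvable_of_negligible {N : ℕ} {f : ℝ → ℝ → ℝ} (h : D.Negligible D.t₀ N f) :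
    D.Solvable N f :=
  solvable_zero.of_negligible (by simpa using h)

theorem solvable_sum {N : ℕ} {ι : Type*} (s : Finset ι) {f : ι → ℝ → ℝ → ℝ}
    (h : ∀ i ∈ s, D.Solvable N (f i)) : D.Solvable N (fun η t => ∑ i ∈ s, f i η t) := by
  classical
  induction s using Finset.induction_on with
  | empty => simpa using solvable_zero
  | insert a s ha ih =>
    simp only [Finset.sum_insert ha]
    exact (h a (Finset.mem_insert_self _ _)).add
      (ih fun i hi => h i (Finset.mem_insert_of_mem hi))

/-- Formal solutions consisting of a single term. -/
theorem solvable_of_term {N j : ℕ} (hj : j < N) (e : D.FormalTerm j) {f : ℝ → ℝ → ℝ}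
    (h : ∀ᶠ η in 𝓝[>] (0 : ℝ), ∀ t ∈ Icc (-D.t₀) D.t₀, ∃ u' : ℝ,
      HasDerivWithinAt (D.termEval e η) u' (Icc (-D.t₀) D.t₀) t ∧
      f η t = (η * u' - (((D.p : ℝ) + 1) * (t / η) ^ D.p * D.termEval e η t
        + e.1 * (t / η) ^ D.L)) * η ^ j) : D.Solvable N f := by
  classical
  refine ⟨Pi.single j e, 0, ?_⟩
  have h1 : ∀ η, (D.partialSum (Pi.single j e) N).1 η = e.1 * η ^ j := by
    intro η
    simp only [partialSum]
    rw [Finset.sum_eq_single_of_mem j (Finset.mem_range.2 hj) (fun n _ hn => by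
      rw [Pi.single_eq_of_ne hn]; simp)]
    rw [Pi.single_eq_same]
  have h2 : ∀ η, (D.partialSum (Pi.single j e) N).2 η = fun t => D.termEval e η t * η ^ j := by
    intro η
    funext t
    simp only [partialSum]
    rw [Finset.sum_eq_single_of_mem j (Finset.mem_range.2 hj) (fun n _ hn => by
      rw [Pi.single_eq_of_ne hn, termEval_zero, zero_mul])]
    rw [Pi.single_eq_same]
  filter_upwards [h] with η h t ht
  obtain ⟨u', hu', hf⟩ := h t ht
  rw [h1, h2]
  refine ⟨u' * η ^ j, hu'.mul_const _, ?_⟩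
  rw [hf]
  simp only [zero_mul]
  refine le_of_eq ?_
  rw [abs_eq_zero]
  ring

/-! ### Formal solutions for elementary right-hand sides -/

theorem negligible_of_bound {N j k : ℕ} (hj : N ≤ j) (hk : k ≤ D.p) {g : ℝ → ℝ → ℝ} {C : ℝ}
    (hg : ∀ᶠ η in 𝓝[>] (0 : ℝ), ∀ t ∈ Icc (-D.t₀) D.t₀, |g η t| ≤ C) :
    D.Negligible D.t₀ N (fun η t => η ^ j * (t / η) ^ k * g η t) := by
  refine ⟨C, ?_⟩
  filter_upwards [hg, eventually_pos_le one_pos] with η hg hη t ht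
  obtain ⟨h0, h1⟩ := hη
  have e1 := pow_le_one_add_pow (abs_nonneg (t / η)) hk
  have e2 : η ^ j ≤ η ^ N := pow_le_pow_of_le_one h0.le h1 hj
  rw [abs_mul, abs_mul, abs_pow (t / η), abs_of_pos (show 0 < η ^ j by positivity)]
  calc _ ≤ η ^ N * (1 + |t / η| ^ D.p) * C := by
        exact mul_le_mul (mul_le_mul e2 e1 (by positivity) (by positivity)) (hg t ht)
          (abs_nonneg _) (by positivity)
    _ = _ := by ring

/-- The forcing `T^L` is cancelled by `α = -1` alone, and any other `T^k` by `ψ_k` with `α =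
-momentRatio p L k`. Orders `j ≥ N` are negligible. -/
theorem Admissible.solvable_monomial (hD : D.Admissible) {N : ℕ} (j : ℕ) {k : ℕ} (hk : k < D.p) :
    D.Solvable N (fun η t => η ^ j * (t / η) ^ k) := by
  rcases le_or_gt N j with hj | hj
  · refine solvable_of_negligible ?_
    simpa using negligible_of_bound (D := D) (g := fun _ _ => 1) (C := 1) hj hk.le (by simp)
  · by_cases hkL : k = D.L
    · refine solvable_of_term hj (-1, 0, 0) (Eventually.of_forall fun η t _ => ⟨0, ?_, ?_⟩)
      · have : D.termEval ((-1, 0, 0) : D.FormalTerm j) η = fun _ => 0 := by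
          funext t; simp [termEval, smoothEval_zero]
        rw [this]
        exact hasDerivWithinAt_const _ _ _
      · simp [termEval, smoothEval_zero, hkL]; ring
    · classical
      have hev : ∀ η t, D.termEval ((-momentRatio D.p D.L k, 0,
          Pi.single 0 (Pi.single ⟨⟨k, hk⟩, hkL⟩ 1)) : D.FormalTerm j) η t
          = psiBar D.p D.L 0 k (t / η) := by
        intro η t
        rw [termEval, smoothEval_zero, zero_add, Finset.sum_eq_single_of_mem 0 (Finset.mem_univ _)
          (fun i _ hi => by simp [Pi.single_eq_of_ne hi]),
          Finset.sum_eq_single_of_mem ⟨⟨k, hk⟩, hkL⟩ (Finset.mem_univ _)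
          (fun i _ hi => by simp [Pi.single_eq_of_ne hi])]
        simp
      refine solvable_of_term hj (-momentRatio D.p D.L k, 0,
          Pi.single 0 (Pi.single ⟨⟨k, hk⟩, hkL⟩ 1)) ?_
      filter_upwards [eventually_pos_le one_pos] with η hη t _
      rw [funext (hev η)]
      have h := ((hasDerivAt_psiBar_zero hD.odd_p hD.even_L hD.L_lt_p hk (t / η)).comp t
        ((hasDerivAt_id t).div_const η)).hasDerivWithinAt (s := Icc (-D.t₀) D.t₀)
      refine ⟨_, h, ?_⟩
      have := hη.1.ne'
      field_simp
      ring

theorem Admissible.solvable_polynomial (hD : D.Admissible) {N : ℕ} (j : ℕ) {q : Polynomial ℝ}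
    (hq : q.degree < D.p) : D.Solvable N (fun η t => η ^ j * q.eval (t / η)) := by
  have h : ∀ k ∈ Finset.range D.p, D.Solvable N (fun η t => q.coeff k * (η ^ j * (t / η) ^ k)) :=
    fun k hk => (hD.solvable_monomial j (Finset.mem_range.1 hk)).smul _
  refine (solvable_sum _ h).congr (Eventually.of_forall fun η t _ => ?_)
  by_cases hz : q = 0
  · simp [hz]
  · rw [Polynomial.eval_eq_sum_range' ((Polynomial.natDegree_lt_iff_degree_lt hz).2 hq), Finset.mul_sum]
    exact Finset.sum_congr rfl fun k _ => by ring

theorem Admissible.bound_of_contDiffOn (hD : D.Admissible) {b : ℝ → ℝ}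
    (hb : ContDiffOn ℝ ∞ b (Icc (-D.t₀) D.t₀)) :
    ∃ C, 0 ≤ C ∧ ∀ t ∈ Icc (-D.t₀) D.t₀, |b t| ≤ C := by
  obtain ⟨C, hC⟩ := isCompact_Icc.exists_bound_of_continuousOn hb.continuousOn
  exact ⟨C, (norm_nonneg _).trans (hC 0 ⟨by linarith [hD.t₀_pos], hD.t₀_pos.le⟩), hC⟩

/-- Induction on the number of orders still missing. If `k < p`, write `b = b(0) + t g` and `t = η
(t/η)`: the rest has one more `η` and exponent `k + 1`. If `k = p`, the function `-b/(p+1)` removes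
the forcing and leaves a multiple of `η^(j+1) b'`. -/
theorem Admissible.solvable_smooth (hD : D.Admissible) {N : ℕ} (j : ℕ) {k : ℕ} (hk : k ≤ D.p)
    {b : ℝ → ℝ} (hb : ContDiffOn ℝ ∞ b (Icc (-D.t₀) D.t₀)) :
    D.Solvable N (fun η t => η ^ j * (t / η) ^ k * b t) := by
  suffices H : ∀ d j k : ℕ, N ≤ j + d → k ≤ D.p → ∀ b : ℝ → ℝ, ContDiffOn ℝ ∞ b (Icc (-D.t₀) D.t₀) →
      D.Solvable N (fun η t => η ^ j * (t / η) ^ k * b t) from H N j k (by omega) hk b hb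
  clear hb hk b k j
  intro d
  induction d with
  | zero =>
    intro j k hj hk b hb
    obtain ⟨C, -, hC⟩ := hD.bound_of_contDiffOn hb
    exact solvable_of_negligible (negligible_of_bound hj hk (g := fun _ t => b t)
      (Eventually.of_forall fun _ => hC))
  | succ d ih =>
    intro j k hj hk b hb
    have ht₀ := hD.t₀_pos
    rcases le_or_gt N j with hjN | hjN
    · exact ih j k (by omega) hk b hb
    · rcases hk.eq_or_lt with rfl | hk
      · have hu : UniqueDiffOn ℝ (Icc (-D.t₀) D.t₀) := uniqueDiffOn_Icc (by linarith)
        have hb' : ContDiffOn ℝ ∞ (derivWithin b (Icc (-D.t₀) D.t₀)) (Icc (-D.t₀) D.t₀) :=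
          hb.derivWithin hu (by simp)
        have hp0 : ((D.p : ℝ) + 1) ≠ 0 := by positivity
        obtain ⟨f, hf⟩ := exists_smoothEval_eq (hb.div_const (-((D.p : ℝ) + 1)))
        have hev : ∀ η, ∀ t ∈ Icc (-D.t₀) D.t₀, D.termEval ((0, f, 0) : D.FormalTerm j) η t
            = b t / (-((D.p : ℝ) + 1)) := by
          intro η t ht; simp [termEval, hf t ht]
        have h1 : D.Solvable N (fun η t => η ^ j * (t / η) ^ D.p * b t
            - η ^ (j + 1) * (derivWithin b (Icc (-D.t₀) D.t₀) t / ((D.p : ℝ) + 1))) := by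
          refine solvable_of_term hjN (0, f, 0) (Eventually.of_forall fun η t ht =>
            ⟨derivWithin b (Icc (-D.t₀) D.t₀) t / (-((D.p : ℝ) + 1)), ?_, ?_⟩)
          · have hd : DifferentiableWithinAt ℝ b (Icc (-D.t₀) D.t₀) t :=
              hb.differentiableOn (by simp) t ht
            exact (hd.hasDerivWithinAt.div_const _).congr (hev η) (hev η t ht)
          · rw [hev η t ht]
            field_simp
            ring
        have h2 := ih (j + 1) 0 (by omega) (Nat.zero_le _) _ (hb'.div_const ((D.p : ℝ) + 1))
        refine (h1.add h2).congr (Eventually.of_forall fun η t _ => ?_)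
        ring
      · obtain ⟨g, hg, hbg⟩ := exists_hadamard ht₀ hb
        have h1 := (hD.solvable_monomial (N := N) j hk).smul (b 0)
        have h2 := ih (j + 1) (k + 1) (by omega) hk g hg
        refine (h1.add h2).congr ?_
        filter_upwards [eventually_pos_le one_pos] with η hη t ht
        have e : η * (t / η) = t := mul_div_cancel₀ t hη.1.ne'
        rw [hbg t ht]
        calc _ = b 0 * (η ^ j * (t / η) ^ k) + η ^ j * (t / η) ^ k * (η * (t / η)) * g t := by ring
          _ = _ := by rw [e]; ring

/-- `ψ̄_{i+1,k}/(i+1)` solves the equation with forcing `ψ̄_{i,k}` up to a polynomial of degree `<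
p`, which is solvable by itself. The symbol of index `i + 1` has to be available at order `j`, hence
`i < j`. -/
theorem Admissible.solvable_psiBar (hD : D.Admissible) {N : ℕ} {i j k : ℕ} (hij : i < j)
    (hk : k < D.p) (hkL : k ≠ D.L) :
    D.Solvable N (fun η t => η ^ j * psiBar D.p D.L i k (t / η)) := by
  rcases le_or_gt N j with hj | hj
  · obtain ⟨C, hC⟩ := exists_bound_psiBar hD.odd_p hD.even_L hD.L_lt_p hk i
    refine solvable_of_negligible ?_
    have := negligible_of_bound (D := D) (g := fun η t => psiBar D.p D.L i k (t / η)) (C := C) hj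
      (Nat.zero_le _) (Eventually.of_forall fun η t _ => hC _)
    simpa using this
  · classical
    obtain ⟨q, hq, hd⟩ := hasDerivAt_psiBar_succ hD.odd_p hD.even_L hD.L_lt_p hk i
    have hi0 : ((i : ℝ) + 1) ≠ 0 := by positivity
    set e : D.FormalTerm j := (0, 0, Pi.single ⟨i + 1, by omega⟩
      (Pi.single ⟨⟨k, hk⟩, hkL⟩ (1 / ((i : ℝ) + 1)))) with he
    have hev : ∀ η t, D.termEval e η t = 1 / ((i : ℝ) + 1) * psiBar D.p D.L (i + 1) k (t / η) := by
      intro η t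
      rw [termEval, he, smoothEval_zero, zero_add,
        Finset.sum_eq_single_of_mem ⟨i + 1, by omega⟩ (Finset.mem_univ _)
        (fun i _ hi => by simp [Pi.single_eq_of_ne hi]),
        Finset.sum_eq_single_of_mem ⟨⟨k, hk⟩, hkL⟩ (Finset.mem_univ _)
        (fun i _ hi => by simp [Pi.single_eq_of_ne hi])]
      simp
    have h1 : D.Solvable N (fun η t => η ^ j * psiBar D.p D.L i k (t / η)
        + 1 / ((i : ℝ) + 1) * (η ^ j * q.eval (t / η))) := by
      refine solvable_of_term hj e ?_
      filter_upwards [eventually_pos_le one_pos] with η hη t _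
      rw [funext (hev η)]
      have h := (((hd (t / η)).comp t ((hasDerivAt_id t).div_const η)).const_mul
        (1 / ((i : ℝ) + 1))).hasDerivWithinAt (s := Icc (-D.t₀) D.t₀)
      refine ⟨_, h, ?_⟩
      have := hη.1.ne'
      have he1 : e.1 = 0 := rfl
      rw [he1]
      field_simp
      ring
    refine (h1.add ((hD.solvable_polynomial j hq).smul (-(1 / ((i : ℝ) + 1))))).congr
      (Eventually.of_forall fun η t _ => ?_)
    ring

/-- Write `b = b(0) + t g` and `t ψ̄_{i,k}(t/η) = η (ψ̄_{i+1,k}(t/η) + γ)`. The index `i` and the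
order `j` rise together, so `i < j` persists until the order reaches `N`. -/
theorem Admissible.solvable_smooth_mul_psiBar (hD : D.Admissible) {N : ℕ} {i j k : ℕ} (hij : i < j)
    (hk : k < D.p) (hkL : k ≠ D.L) {b : ℝ → ℝ} (hb : ContDiffOn ℝ ∞ b (Icc (-D.t₀) D.t₀)) :
    D.Solvable N (fun η t => η ^ j * b t * psiBar D.p D.L i k (t / η)) := by
  suffices H : ∀ d i j : ℕ, N ≤ j + d → i < j → ∀ b : ℝ → ℝ,
      ContDiffOn ℝ ∞ b (Icc (-D.t₀) D.t₀) →
      D.Solvable N (fun η t => η ^ j * b t * psiBar D.p D.L i k (t / η)) from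
    H N i j (by omega) hij b hb
  clear hb hij b j i
  intro d
  induction d with
  | zero =>
    intro i j hj _ b hb
    obtain ⟨C, hC0, hC⟩ := hD.bound_of_contDiffOn hb
    obtain ⟨C', hC'⟩ := exists_bound_psiBar hD.odd_p hD.even_L hD.L_lt_p hk i
    refine solvable_of_negligible ?_
    have := negligible_of_bound (D := D) (g := fun η t => b t * psiBar D.p D.L i k (t / η))
      (C := C * C') hj (Nat.zero_le _) (Eventually.of_forall fun η t ht => by
        rw [abs_mul]; exact mul_le_mul (hC t ht) (hC' _) (abs_nonneg _) hC0)
    simpa [mul_assoc] using this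
  | succ d ih =>
    intro i j hj hij b hb
    obtain ⟨g, hg, hbg⟩ := exists_hadamard hD.t₀_pos hb
    obtain ⟨γ, hγ⟩ := mul_psiBar hD.odd_p hD.even_L hD.L_lt_p hk i
    have h1 := (hD.solvable_psiBar (N := N) hij hk hkL).smul (b 0)
    have h2 := ih (i + 1) (j + 1) (by omega) (by omega) g hg
    have h3 := (hD.solvable_smooth (N := N) (j + 1) (Nat.zero_le _) hg).smul γ
    refine ((h1.add h2).add h3).congr ?_
    filter_upwards [eventually_pos_le one_pos] with η hη t ht
    have hη0 := hη.1.ne'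
    have e := hγ (t / η)
    have e2 : t * psiBar D.p D.L i k (t / η) = η * (psiBar D.p D.L (i + 1) k (t / η) + γ) := by
      rw [← e]; field_simp
    rw [hbg t ht]
    calc _ = b 0 * (η ^ j * psiBar D.p D.L i k (t / η))
          + η ^ j * g t * (η * (psiBar D.p D.L (i + 1) k (t / η) + γ)) := by ring
      _ = _ := by rw [← e2]; ring

end CanardData

namespace CanardData

variable {D : CanardData}

/-! ### Formal solvability for the full right-hand side -/

theorem solvable_eval_mul {N : ℕ} {f : ℝ → ℝ → ℝ} (q : Polynomial ℝ)
    (h : ∀ s : ℕ, D.Solvable N (fun η t => η ^ s * f η t)) :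
    D.Solvable N (fun η t => q.eval η * f η t) := by
  refine (solvable_sum (Finset.range (q.natDegree + 1))
    (fun s _ => (h s).smul (q.coeff s))).congr (Eventually.of_forall fun η t _ => ?_)
  rw [Polynomial.eval_eq_sum_range, Finset.sum_mul]
  exact Finset.sum_congr rfl fun s _ => by ring

theorem Admissible.termEval_bounded (hD : D.Admissible) {n : ℕ} (e : D.FormalTerm n) :
    ∃ C, 0 ≤ C ∧ ∀ η, ∀ t ∈ Icc (-D.t₀) D.t₀, |D.termEval e η t| ≤ C := by
  obtain ⟨C, hC0, hC⟩ := hD.bound_of_contDiffOn (contDiffOn_smoothEval e.2.1)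
  choose B hB using fun (i : ℕ) (k : {k : Fin D.p // (k : ℕ) ≠ D.L}) =>
    exists_bound_psiBar hD.odd_p hD.even_L hD.L_lt_p k.1.2 i
  have hB0 : ∀ i k, 0 ≤ B i k := fun i k => (abs_nonneg _).trans (hB i k 0)
  refine ⟨C + ∑ i : Fin (n + 1), ∑ k, |e.2.2 i k| * B i k,
    add_nonneg hC0 (Finset.sum_nonneg fun i _ => Finset.sum_nonneg fun k _ =>
      mul_nonneg (abs_nonneg _) (hB0 i k)), fun η t ht => ?_⟩
  refine (abs_add_le _ _).trans (add_le_add (hC t ht) ?_)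
  refine (Finset.abs_sum_le_sum_abs _ _).trans (Finset.sum_le_sum fun i _ => ?_)
  refine (Finset.abs_sum_le_sum_abs _ _).trans (Finset.sum_le_sum fun k _ => ?_)
  rw [abs_mul]
  gcongr
  exact hB i k _

theorem Admissible.partialSum_bounded (hD : D.Admissible) (c : D.FormalSeries) (N : ℕ) :
    ∃ C, 0 ≤ C ∧ ∀ η ∈ Ioc (0 : ℝ) 1, |(D.partialSum c N).1 η| ≤ C ∧
      ∀ t ∈ Icc (-D.t₀) D.t₀, |(D.partialSum c N).2 η t| ≤ C := by
  choose B hB0 hB using fun n => hD.termEval_bounded (c n)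
  refine ⟨∑ n ∈ Finset.range N, (|(c n).1| + B n),
    Finset.sum_nonneg fun n _ => add_nonneg (abs_nonneg _) (hB0 n), fun η hη => ⟨?_, fun t ht => ?_⟩⟩
  · change |∑ n ∈ Finset.range N, (c n).1 * η ^ n| ≤ _
    refine (Finset.abs_sum_le_sum_abs _ _).trans (Finset.sum_le_sum fun n _ => ?_)
    rw [abs_mul, abs_of_nonneg (pow_nonneg hη.1.le n)]
    have := mul_le_of_le_one_right (abs_nonneg (c n).1) (pow_le_one₀ (n := n) hη.1.le hη.2)
    linarith [hB0 n]
  · change |∑ n ∈ Finset.range N, D.termEval (c n) η t * η ^ n| ≤ _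
    refine (Finset.abs_sum_le_sum_abs _ _).trans (Finset.sum_le_sum fun n _ => ?_)
    rw [abs_mul, abs_of_nonneg (pow_nonneg hη.1.le n)]
    have := mul_le_of_le_one_right (abs_nonneg (D.termEval (c n) η t))
      (pow_le_one₀ (n := n) hη.1.le hη.2)
    linarith [hB n η t ht, abs_nonneg (c n).1]

/-- The power `η^(j+1)` reflects that `P` sees `v` only through `ηv`: a symbol of index `i ≤ n` at
order `n` ends up at order `j + 1 + n > i`, as solvability demands. -/
theorem Admissible.solvable_mul_partialSum (hD : D.Admissible) {M : ℕ} (c : D.FormalSeries) (N j : ℕ)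
    {b : ℝ → ℝ} (hb : ContDiffOn ℝ ∞ b (Icc (-D.t₀) D.t₀)) :
    D.Solvable M (fun η t => η ^ (j + 1) * b t * (D.partialSum c N).2 η t) := by
  have h : ∀ n ∈ Finset.range N, D.Solvable M (fun η t =>
      η ^ (j + 1 + n) * (t / η) ^ 0 * (b t * smoothEval (c n).2.1 t)
      + ∑ i : Fin (n + 1), ∑ k : {k : Fin D.p // (k : ℕ) ≠ D.L},
        (c n).2.2 i k * (η ^ (j + 1 + n) * b t * psiBar D.p D.L i k.1 (t / η))) := by
    intro n _
    refine (hD.solvable_smooth _ (Nat.zero_le _) (hb.mul (contDiffOn_smoothEval _))).add ?_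
    refine solvable_sum _ fun i _ => solvable_sum _ fun k _ => ?_
    exact (hD.solvable_smooth_mul_psiBar (by omega) k.1.2 k.2 hb).smul _
  refine (solvable_sum _ h).congr (Eventually.of_forall fun η t _ => ?_)
  simp only [partialSum]
  rw [Finset.mul_sum]
  refine Finset.sum_congr rfl fun n _ => ?_
  simp only [termEval, add_mul, mul_add, Finset.sum_mul, Finset.mul_sum]
  congr 1
  · ring
  · exact Finset.sum_congr rfl fun i _ => Finset.sum_congr rfl fun k _ => by ring

theorem polynomial_bound_Icc (A : Polynomial ℝ) : ∃ C, 0 ≤ C ∧ ∀ η ∈ Ioc (0 : ℝ) 1, |A.eval η| ≤ C := by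
  obtain ⟨C, hC⟩ := isCompact_Icc.exists_bound_of_continuousOn (s := Icc (0 : ℝ) 1)
    A.continuous.continuousOn
  exact ⟨C, (norm_nonneg _).trans (hC 0 (by simp)), fun η hη => hC η ⟨hη.1.le, hη.2⟩⟩

theorem Admissible.solvable_S (hD : D.Admissible) {M : ℕ} (A : Polynomial ℝ) :
    D.Solvable M (fun η t => D.S t (η ^ (D.p - D.L + 1) * A.eval η) / η ^ (D.p + 1)) := by
  set m := D.p - D.L + 1 with hm
  have hm2 : 2 ≤ m := hD.two_le
  -- This length makes the remainder `O(η^(M+p+1))`, so that `η^M` is left after division by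
  -- `η^(p+1)`.
  obtain ⟨b, hb, C, hC0, hC⟩ := hD.exists_S_taylor (M + D.p + 1)
  obtain ⟨B, hB0, hB⟩ := polynomial_bound_Icc A
  have hterm : ∀ l ∈ Finset.range (M + D.p + 1), D.Solvable M (fun η t => (A ^ (l + 1)).eval η *
      (η ^ (D.p + 2 - m * (l + 1) + m * (l + 1) - (D.p + 1))
        * (t / η) ^ (D.p + 2 - m * (l + 1)) * b l t)) := by
    intro l _
    refine solvable_eval_mul _ fun s => ?_
    have hle : D.p + 2 - m * (l + 1) ≤ D.p := by
      have : 2 ≤ m * (l + 1) := by nlinarith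
      omega
    refine (hD.solvable_smooth (s + (D.p + 2 - m * (l + 1) + m * (l + 1) - (D.p + 1))) hle
      (hb l)).congr (Eventually.of_forall fun η t _ => ?_)
    rw [pow_add]; ring
  refine (solvable_sum _ hterm).of_negligible ⟨C * B ^ (M + D.p + 1 + 1), ?_⟩
  filter_upwards [eventually_pos_le (show 0 < 1 / (B + 1) by positivity)] with η hη t ht
  obtain ⟨hη0, hη1⟩ := hη
  have hle1 : η ≤ 1 := hη1.trans (by rw [div_le_one (by linarith)]; linarith)
  have hA := hB η ⟨hη0, hle1⟩
  have hx := pow_mul_abs_le_one hm2 hη0 hB0 hη1 hA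
  have h1 := hC t ht (η ^ m * A.eval η) 0 hx (by simp)
  rw [hD.S_zero t ht] at h1
  simp only [ne_eq, Nat.succ_ne_zero, not_false_eq_true, zero_pow, mul_zero, Finset.sum_const_zero,
    sub_zero, abs_zero] at h1
  rw [max_eq_left (abs_nonneg (η ^ m * A.eval η))] at h1
  have hsum : ∑ l ∈ Finset.range (M + D.p + 1), (A ^ (l + 1)).eval η *
      (η ^ (D.p + 2 - m * (l + 1) + m * (l + 1) - (D.p + 1))
        * (t / η) ^ (D.p + 2 - m * (l + 1)) * b l t)
      = (∑ l ∈ Finset.range (M + D.p + 1), t ^ (D.p + 2 - m * (l + 1)) * b l t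
          * (η ^ m * A.eval η) ^ (l + 1)) / η ^ (D.p + 1) := by
    rw [eq_div_iff (by positivity), Finset.sum_mul]
    refine Finset.sum_congr rfl fun l _ => ?_
    -- The subtraction of `p + 1` is not truncated, because the total weight is at least `p + 2`.
    have e1 : η ^ (D.p + 2 - m * (l + 1) + m * (l + 1) - (D.p + 1)) * η ^ (D.p + 1)
        = η ^ (D.p + 2 - m * (l + 1)) * η ^ (m * (l + 1)) := by
      rw [← pow_add, ← pow_add]; congr 1; omega
    have e2 : t ^ (D.p + 2 - m * (l + 1))
        = η ^ (D.p + 2 - m * (l + 1)) * (t / η) ^ (D.p + 2 - m * (l + 1)) := by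
      rw [← mul_pow, mul_div_cancel₀ t hη0.ne']
    rw [Polynomial.eval_pow, mul_pow, ← pow_mul, e2]
    calc _ = (A.eval η) ^ (l + 1) * (t / η) ^ (D.p + 2 - m * (l + 1)) * b l t *
          (η ^ (D.p + 2 - m * (l + 1) + m * (l + 1) - (D.p + 1)) * η ^ (D.p + 1)) := by ring
      _ = _ := by rw [e1]; ring
  rw [hsum, ← sub_div, abs_div, abs_of_pos (show 0 < η ^ (D.p + 1) by positivity),
    div_le_iff₀ (by positivity)]
  have hx2 : |η ^ m * A.eval η| ≤ η ^ m * B := by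
    rw [abs_mul, abs_of_pos (show 0 < η ^ m by positivity)]; gcongr
  have hpow : η ^ (m * (M + D.p + 1 + 1)) ≤ η ^ (M + (D.p + 1)) :=
    pow_le_pow_of_le_one hη0.le hle1 (by nlinarith)
  have hT : (0 : ℝ) ≤ |t / η| ^ D.p := by positivity
  calc _ ≤ C * |η ^ m * A.eval η| ^ (M + D.p + 1) * |η ^ m * A.eval η| := h1
    _ = C * |η ^ m * A.eval η| ^ (M + D.p + 1 + 1) := by ring
    _ ≤ C * (η ^ m * B) ^ (M + D.p + 1 + 1) := by gcongr
    _ = C * B ^ (M + D.p + 1 + 1) * η ^ (m * (M + D.p + 1 + 1)) := by rw [mul_pow, ← pow_mul]; ring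
    _ ≤ C * B ^ (M + D.p + 1 + 1) * η ^ (M + (D.p + 1)) := by gcongr
    _ ≤ C * B ^ (M + D.p + 1 + 1) * η ^ (M + (D.p + 1)) * (1 + |t / η| ^ D.p) :=
        le_mul_of_one_le_right (by positivity) (by linarith)
    _ = _ := by rw [pow_add η M]; ring

/-- With `β` a polynomial in `η` and `u` frozen, `P` is a smooth function of `(t, η)`, which is
expanded in `η` at the endpoint `0`. -/
theorem Admissible.exists_P_taylor (hD : D.Admissible) (M : ℕ) (u : ℝ) (B : Polynomial ℝ) :
    ∃ c : ℕ → ℝ → ℝ, (∀ l, ContDiffOn ℝ ∞ (c l) (Icc (-D.t₀) D.t₀)) ∧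
      ∃ C, 0 ≤ C ∧ ∀ᶠ η in 𝓝[>] (0 : ℝ), ∀ t ∈ Icc (-D.t₀) D.t₀,
        |D.P t u (η ^ (D.p - D.L + 1) * B.eval η) η - ∑ l ∈ Finset.range M, c l t * η ^ l|
          ≤ C * η ^ M := by
  have hη₀ := hD.η₀_pos
  have hsm : ContDiffOn ℝ ∞ (fun x : ℝ × ℝ => D.P x.1 u (x.2 ^ (D.p - D.L + 1) * B.eval x.2) x.2)
      (Icc (-D.t₀) D.t₀ ×ˢ Ico 0 D.η₀) := by
    have hB : ContDiff ℝ ∞ (fun x : ℝ × ℝ => B.eval x.2) := by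
      have h1 : ContDiff ℝ ∞ (fun x : ℝ => B.eval x) := by
        simpa using B.contDiff_aeval (𝕜 := ℝ) ∞
      exact h1.comp contDiff_snd
    have hin : ContDiff ℝ ∞ (fun x : ℝ × ℝ =>
        (x.1, u, x.2 ^ (D.p - D.L + 1) * B.eval x.2, x.2)) := by fun_prop
    exact hD.smooth_P.comp hin.contDiffOn (fun x hx => ⟨hx.1, trivial, trivial, hx.2⟩)
  obtain ⟨c, hc, -, C, hC0, hC⟩ := exists_param_taylor (J := Icc 0 (D.η₀ / 2)) hD.t₀_pos
    (uniqueDiffOn_Ico 0 D.η₀) (Icc_subset_Ico_right (by linarith)) (convex_Icc _ _) isCompact_Icc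
    ⟨le_rfl, by linarith⟩ M
    (φ := fun t η => D.P t u (η ^ (D.p - D.L + 1) * B.eval η) η) hsm
  refine ⟨c, hc, C, hC0, ?_⟩
  filter_upwards [eventually_pos_le (show 0 < D.η₀ / 2 by positivity)] with η hη t ht
  simpa [abs_of_pos hη.1] using hC t ht η ⟨hη.1.le, hη.2⟩

theorem exists_partialSum_polynomial (c : D.FormalSeries) (N : ℕ) :
    ∃ A : Polynomial ℝ, ∀ η, (D.partialSum c N).1 η = A.eval η := by
  refine ⟨∑ n ∈ Finset.range N, Polynomial.C (c n).1 * Polynomial.X ^ n, fun η => ?_⟩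
  simp [partialSum, Polynomial.eval_finsetSum]

/-- For polynomial inputs the equation has formal solutions of every order. -/
theorem Admissible.solvable_rhs (hD : D.Admissible) (hlin : D.IsLinear) (a c : D.FormalSeries)
    (N M : ℕ) : D.Solvable M (fun η t =>
      D.rhs η ((D.partialSum a N).1 η) ((D.partialSum c N).1 η) ((D.partialSum c N).2 η t) t) := by
  obtain ⟨A, hA⟩ := exists_partialSum_polynomial a N
  obtain ⟨B, hB⟩ := exists_partialSum_polynomial c N
  obtain ⟨c₀, hc₀, C₀, hC₀0, hC₀⟩ := hD.exists_P_taylor M 0 B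
  obtain ⟨c₁, hc₁, C₁, hC₁0, hC₁⟩ := hD.exists_P_taylor M 1 B
  obtain ⟨CV, hCV0, hCV⟩ := hD.partialSum_bounded c N
  obtain ⟨P₀, P₁, hP⟩ := hlin
  have h1 := hD.solvable_S (M := M) A
  have h2 : D.Solvable M (fun η t => ∑ l ∈ Finset.range M, η ^ l * (t / η) ^ 0 * c₀ l t) :=
    solvable_sum _ fun l _ => hD.solvable_smooth l (Nat.zero_le _) (hc₀ l)
  have h3 : D.Solvable M (fun η t => ∑ l ∈ Finset.range M,
      η ^ (l + 1) * (c₁ l t - c₀ l t) * (D.partialSum c N).2 η t) :=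
    solvable_sum _ fun l _ => hD.solvable_mul_partialSum c N l ((hc₁ l).sub (hc₀ l))
  refine (h1.add (h2.add h3)).of_negligible ⟨C₀ + (C₁ + C₀) * CV, ?_⟩
  filter_upwards [hC₀, hC₁, eventually_pos_le one_pos,
    eventually_pos_le (show 0 < D.η₀ / 2 by linarith [hD.η₀_pos])] with η h0 h1 hη hη' t ht
  obtain ⟨hη0, hη1⟩ := hη
  set V := (D.partialSum c N).2 η t with hV
  have hVb : |V| ≤ CV := (hCV η ⟨hη0, hη1⟩).2 t ht
  set x := η ^ (D.p - D.L + 1) * B.eval η with hx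
  have hmem : η ∈ Ico 0 D.η₀ := ⟨hη0.le, by linarith [hη'.2, hD.η₀_pos]⟩
  -- An affine function is determined by its values at `0` and `1`; these inherit smoothness from
  -- `P`, whatever `P₀` and `P₁` are.
  have eP : D.P t (η * V) x η = D.P t 0 x η + (D.P t 1 x η - D.P t 0 x η) * (η * V) := by
    rw [hP t ht _ x η hmem, hP t ht 0 x η hmem, hP t ht 1 x η hmem]; ring
  set s₀ := ∑ l ∈ Finset.range M, c₀ l t * η ^ l with hs₀
  set s₁ := ∑ l ∈ Finset.range M, c₁ l t * η ^ l with hs₁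
  have e2 : ∑ l ∈ Finset.range M, η ^ l * (t / η) ^ 0 * c₀ l t = s₀ :=
    Finset.sum_congr rfl fun l _ => by ring
  have e3 : ∑ l ∈ Finset.range M, η ^ (l + 1) * (c₁ l t - c₀ l t) * V = (s₁ - s₀) * (η * V) := by
    rw [hs₀, hs₁, ← Finset.sum_sub_distrib, Finset.sum_mul]
    exact Finset.sum_congr rfl fun l _ => by ring
  rw [e2, e3, rhs, hA, hB, ← hx, eP]
  have b0 := h0 t ht
  have b1 := h1 t ht
  have hηV : |η * V| ≤ CV := by
    rw [abs_mul, abs_of_pos hη0]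
    calc η * |V| ≤ 1 * CV := by gcongr
      _ = CV := one_mul _
  have e : ∀ Z : ℝ, Z + (D.P t 0 x η + (D.P t 1 x η - D.P t 0 x η) * (η * V))
      - (Z + (s₀ + (s₁ - s₀) * (η * V)))
      = (D.P t 0 x η - s₀) + ((D.P t 1 x η - s₁) - (D.P t 0 x η - s₀)) * (η * V) := by
    intro Z; ring
  rw [e]
  have hT : (0 : ℝ) ≤ |t / η| ^ D.p := by positivity
  calc _ ≤ |D.P t 0 x η - s₀| + |(D.P t 1 x η - s₁) - (D.P t 0 x η - s₀)| * |η * V| := by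
        rw [← abs_mul]; exact abs_add_le _ _
    _ ≤ C₀ * η ^ M + (C₁ * η ^ M + C₀ * η ^ M) * CV := by
        gcongr
        exact (abs_sub _ _).trans (add_le_add b1 b0)
    _ = (C₀ + (C₁ + C₀) * CV) * η ^ M := by ring
    _ ≤ _ := le_mul_of_one_le_right (by positivity) (by linarith)

end CanardData

/-! ### Uniqueness of composite expansions -/

theorem exp_neg_div_pow_le {c : ℝ} (hc : 0 < c) {q : ℕ} (hq : 1 ≤ q) (N : ℕ) :
    ∃ C, 0 ≤ C ∧ ∀ η ∈ Ioc (0 : ℝ) 1, Real.exp (-(c / η ^ q)) ≤ C * η ^ N := by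
  refine ⟨N.factorial / c ^ N, by positivity, fun η hη => ?_⟩
  obtain ⟨h0, h1⟩ := hη
  have e1 : c / η ≤ c / η ^ q := by
    gcongr
    calc η ^ q ≤ η ^ 1 := pow_le_pow_of_le_one h0.le h1 hq
      _ = η := pow_one η
  have e2 := Real.pow_div_factorial_le_exp (c / η) (by positivity) N
  calc Real.exp (-(c / η ^ q)) ≤ Real.exp (-(c / η)) := Real.exp_le_exp.2 (by linarith)
    _ = (Real.exp (c / η))⁻¹ := Real.exp_neg _
    _ ≤ ((c / η) ^ N / N.factorial)⁻¹ := by gcongr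
    _ = _ := by rw [div_pow]; field_simp

theorem tendsto_div_nhdsGT {g : ℝ → ℝ} (hg : Tendsto g (atBot ⊔ atTop) (𝓝 0)) {t : ℝ} (ht : t ≠ 0) :
    Tendsto (fun η => g (t / η)) (𝓝[>] 0) (𝓝 0) := by
  rcases lt_or_gt_of_ne ht with h | h
  · exact (hg.mono_left le_sup_left).comp (tendsto_inv_nhdsGT_zero.const_mul_atTop_of_neg h)
  · exact (hg.mono_left le_sup_right).comp (tendsto_inv_nhdsGT_zero.const_mul_atTop h)

/-- For fixed `t ≠ 0` the term `g 0 (t/η)` disappears in the limit, so `b 0` vanishes off `0`, and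
everywhere by continuity. The choice `t = ηT` then isolates `g 0 T`. Dividing by `η` reduces to a
shorter sum. -/
theorem eq_zero_of_expansion {t₀ : ℝ} (ht₀ : 0 < t₀) (N : ℕ) {b g : ℕ → ℝ → ℝ}
    (hb : ∀ n, ContinuousOn (b n) (Icc (-t₀) t₀)) (hgb : ∀ n, ∃ C, ∀ T, |g n T| ≤ C)
    (hg : ∀ n, Tendsto (g n) (atBot ⊔ atTop) (𝓝 0))
    (h : ∀ r ∈ Ioo 0 t₀, ∃ C, ∀ᶠ η in 𝓝[>] (0 : ℝ), ∀ t ∈ Icc (-r) r,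
      |∑ n ∈ Finset.range N, (b n t + g n (t / η)) * η ^ n| ≤ C * η ^ N) :
    ∀ n < N, (∀ t ∈ Icc (-t₀) t₀, b n t = 0) ∧ ∀ T, g n T = 0 := by
  induction N generalizing b g with
  | zero => intro n hn; omega
  | succ N ih =>
    have split : ∀ η t, ∑ n ∈ Finset.range (N + 1), (b n t + g n (t / η)) * η ^ n
        = (∑ n ∈ Finset.range N, (b (n + 1) t + g (n + 1) (t / η)) * η ^ n) * η
          + (b 0 t + g 0 (t / η)) := by
      intro η t
      rw [Finset.sum_range_succ', Finset.sum_mul, pow_zero, mul_one]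
      congr 1
      exact Finset.sum_congr rfl fun n _ => by ring
    have bound : ∃ B, ∀ η ∈ Ioc (0 : ℝ) 1, ∀ t ∈ Icc (-t₀) t₀,
        |∑ n ∈ Finset.range N, (b (n + 1) t + g (n + 1) (t / η)) * η ^ n| ≤ B := by
      choose B hB using fun n => isCompact_Icc.exists_bound_of_continuousOn (hb n)
      choose G hG using hgb
      refine ⟨∑ n ∈ Finset.range N, (B (n + 1) + G (n + 1)), fun η hη t ht => ?_⟩
      refine (Finset.abs_sum_le_sum_abs _ _).trans (Finset.sum_le_sum fun n _ => ?_)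
      rw [abs_mul, abs_of_nonneg (pow_nonneg hη.1.le n)]
      exact (mul_le_of_le_one_right (abs_nonneg _) (pow_le_one₀ hη.1.le hη.2)).trans
        ((abs_add_le _ _).trans (add_le_add (hB _ t ht) (hG _ _)))
    obtain ⟨B, hB⟩ := bound
    have lead : ∀ r ∈ Ioo 0 t₀, ∃ C, ∀ᶠ η in 𝓝[>] (0 : ℝ), ∀ t ∈ Icc (-r) r,
        |b 0 t + g 0 (t / η)| ≤ C * η := by
      intro r hr
      obtain ⟨C, hC⟩ := h r hr
      refine ⟨|C| + B, ?_⟩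
      filter_upwards [hC, CanardData.eventually_pos_le one_pos] with η hC hη t ht
      have h1 := hC t ht
      have h2 := hB η hη t (Icc_subset_Icc (by linarith [hr.2]) hr.2.le ht)
      rw [split] at h1
      have e1 : C * η ^ (N + 1) ≤ |C| * η := by
        calc C * η ^ (N + 1) ≤ |C| * η ^ (N + 1) := by
              have h0 := hη.1.le
              gcongr
              exact le_abs_self C
          _ ≤ |C| * η ^ 1 := by
              gcongr ?_ * ?_
              exact pow_le_pow_of_le_one hη.1.le hη.2 (by omega)
          _ = _ := by rw [pow_one]
      have e2 : |(∑ n ∈ Finset.range N, (b (n + 1) t + g (n + 1) (t / η)) * η ^ n) * η| ≤ B * η := by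
        rw [abs_mul, abs_of_pos hη.1]
        exact mul_le_mul_of_nonneg_right h2 hη.1.le
      rw [abs_le] at *
      constructor <;> linarith [h1.1, h1.2, e2.1, e2.2]
    have hid : Tendsto (fun η : ℝ => η) (𝓝[>] 0) (𝓝 0) := tendsto_nhdsWithin_of_tendsto_nhds tendsto_id
    have b0 : ∀ t ∈ Ioo (-t₀) 0 ∪ Ioo 0 t₀, b 0 t = 0 := by
      intro t ht
      have ht0 : t ≠ 0 := by rcases ht with h | h; exacts [h.2.ne, h.1.ne']
      have htt : |t| < t₀ := by
        rw [abs_lt]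
        rcases ht with h | h
        exacts [⟨h.1, h.2.trans ht₀⟩, ⟨by linarith [h.1], h.2⟩]
      obtain ⟨C, hC⟩ := lead |t| ⟨abs_pos.2 ht0, htt⟩
      have l1 : Tendsto (fun η => b 0 t + g 0 (t / η)) (𝓝[>] 0) (𝓝 0) := by
        refine squeeze_zero_norm' (hC.mono fun η hη => hη t ⟨neg_abs_le t, le_abs_self t⟩) ?_
        simpa using hid.const_mul C
      have l2 := (tendsto_div_nhdsGT (hg 0) ht0).const_add (b 0 t)
      simpa using tendsto_nhds_unique l2 l1
    have b0' : EqOn (b 0) (fun _ => 0) (Icc (-t₀) t₀) := by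
      refine EqOn.of_subset_closure (s := Ioo (-t₀) 0 ∪ Ioo 0 t₀) b0 (hb 0) continuousOn_const ?_ ?_
      · rintro x (hx | hx)
        exacts [⟨hx.1.le, hx.2.le.trans ht₀.le⟩, ⟨by linarith [hx.1], hx.2.le⟩]
      · rw [closure_union, closure_Ioo (by linarith), closure_Ioo ht₀.ne]
        exact Icc_subset_Icc_union_Icc
    have g0 : ∀ T, g 0 T = 0 := by
      intro T
      obtain ⟨C, hC⟩ := lead (t₀ / 2) ⟨by linarith, by linarith⟩
      have l1 : Tendsto (fun _ : ℝ => g 0 T) (𝓝[>] 0) (𝓝 0) := by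
        refine squeeze_zero_norm' (a := fun η => C * η) ?_ (by simpa using hid.const_mul C)
        have hT : Tendsto (fun η : ℝ => η * T) (𝓝[>] 0) (𝓝 0) := by simpa using hid.mul_const T
        filter_upwards [hC, CanardData.eventually_pos_le one_pos,
          hT.eventually (Icc_mem_nhds (show -(t₀ / 2) < 0 by linarith)
            (show 0 < t₀ / 2 by linarith))] with η h1 hη h2
        have := h1 (η * T) ⟨h2.1, h2.2⟩
        rw [b0' (Icc_subset_Icc (by linarith) (by linarith) h2), zero_add,
          mul_div_cancel_left₀ T hη.1.ne'] at this
        exact this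
      exact tendsto_nhds_unique tendsto_const_nhds l1
    have rest := ih (b := fun n => b (n + 1)) (g := fun n => g (n + 1)) (fun n => hb _)
      (fun n => hgb _) (fun n => hg _) (by
        intro r hr
        obtain ⟨C, hC⟩ := h r hr
        refine ⟨C, ?_⟩
        filter_upwards [hC, CanardData.eventually_pos_le one_pos] with η h1 hη t ht
        have := h1 t ht
        rw [split, b0' (Icc_subset_Icc (by linarith [hr.2]) hr.2.le ht), g0, add_zero, add_zero,
          abs_mul, abs_of_pos hη.1, pow_succ, ← mul_assoc] at this
        exact le_of_mul_le_mul_right this hη.1)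
    rintro (_ | n) hn
    · exact ⟨b0', g0⟩
    · exact rest n (by omega)

namespace CanardData

variable {D : CanardData}

/-! ### Comparison of approximate solutions -/

theorem DiffBigO.trans {r : ℝ} {N : ℕ} {x y z : CoupleFamily} (h : DiffBigO r N x y)
    (h' : DiffBigO r N y z) : DiffBigO r N x z := by
  obtain ⟨C, hC⟩ := h
  obtain ⟨C', hC'⟩ := h'
  refine ⟨C + C', ?_⟩
  filter_upwards [hC, hC'] with η h h'
  rw [add_mul]
  exact ⟨(abs_sub_le _ _ _).trans (add_le_add h.1 h'.1),
    fun t ht => (abs_sub_le _ _ _).trans (add_le_add (h.2 t ht) (h'.2 t ht))⟩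

theorem DiffBigO.symm {r : ℝ} {N : ℕ} {x y : CoupleFamily} (h : DiffBigO r N x y) :
    DiffBigO r N y x := by
  obtain ⟨C, hC⟩ := h
  refine ⟨C, hC.mono fun η h => ?_⟩
  exact ⟨by rw [abs_sub_comm]; exact h.1, fun t ht => by rw [abs_sub_comm]; exact h.2 t ht⟩

theorem ApproxSol.mono {r r' : ℝ} {N : ℕ} {y : CoupleFamily} {f : ℝ → ℝ → ℝ}
    (h : D.ApproxSol r N y f) (hr : r' ≤ r) : D.ApproxSol r' N y f := by
  obtain ⟨C, hC⟩ := h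
  have hs : Icc (-r') r' ⊆ Icc (-r) r := Icc_subset_Icc (by linarith) hr
  refine ⟨C, hC.mono fun η h t ht => ?_⟩
  obtain ⟨u', hu, hb⟩ := h t (hs ht)
  exact ⟨u', hu.mono hs, hb⟩

theorem ApproxSol.of_succ {r : ℝ} {N : ℕ} {y : CoupleFamily} {f : ℝ → ℝ → ℝ}
    (h : D.ApproxSol r (N + 1) y f) : D.ApproxSol r N y f := by
  obtain ⟨C, hC⟩ := h
  refine ⟨|C|, ?_⟩
  filter_upwards [hC, eventually_pos_le one_pos] with η h hη t ht
  obtain ⟨u', hu, hb⟩ := h t ht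
  refine ⟨u', hu, hb.trans ?_⟩
  have h0 := hη.1.le
  gcongr ?_ * ?_ * _
  · exact le_abs_self C
  · exact pow_le_pow_of_le_one hη.1.le hη.2 (by omega)

theorem ApproxSol.congr_left {r : ℝ} {N : ℕ} {y y' : CoupleFamily} {f : ℝ → ℝ → ℝ}
    (h : D.ApproxSol r N y f) (hy : ∀ᶠ η in 𝓝[>] (0 : ℝ), y'.1 η = y.1 η ∧
      ∀ t ∈ Icc (-r) r, y'.2 η t = y.2 η t) : D.ApproxSol r N y' f := by
  obtain ⟨C, hC⟩ := h
  refine ⟨C, ?_⟩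
  filter_upwards [hC, hy] with η h hy t ht
  obtain ⟨u', hu, hb⟩ := h t ht
  refine ⟨u', hu.congr hy.2 (hy.2 t ht), ?_⟩
  rwa [hy.1, hy.2 t ht]

theorem IsBoundedFamily.sub {y y' : CoupleFamily} (h : D.IsBoundedFamily y)
    (h' : D.IsBoundedFamily y') : D.IsBoundedFamily (y - y') := by
  obtain ⟨M, hM⟩ := h
  obtain ⟨M', hM'⟩ := h'
  refine ⟨M + M', ?_⟩
  filter_upwards [hM, hM'] with η h h'
  exact ⟨(abs_sub _ _).trans (add_le_add h.1 h'.1),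
    fun t ht => (abs_sub _ _).trans (add_le_add (h.2 t ht) (h'.2 t ht))⟩

theorem Admissible.isBoundedFamily_partialSum (hD : D.Admissible) (c : D.FormalSeries) (N : ℕ) :
    D.IsBoundedFamily (D.partialSum c N) := by
  obtain ⟨C, -, hC⟩ := hD.partialSum_bounded c N
  exact ⟨C, (eventually_pos_le one_pos).mono fun η hη => hC η hη⟩

/-- Formal solutions do not satisfy `u(±t₀) = 0`, so only boundedness at `±r` is available. For `|t|
≤ r₁ < r` the a priori estimate damps the boundary values by `exp(-(r^(p+1) - r₁^(p+1))/η^(p+1))`,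
which is smaller than any power of `η`. -/
theorem Admissible.diffBigO_of_homogeneous (hD : D.Admissible) {r r₁ : ℝ} (hr₁ : 0 < r₁) (hr : r₁ < r)
    (hrt : r ≤ D.t₀) {N : ℕ} {y : CoupleFamily} (h : D.ApproxSol r N y (fun _ _ => 0))
    (hb : D.IsBoundedFamily y) : DiffBigO r₁ N y 0 := by
  obtain ⟨K, hK1, hK⟩ := apriori_estimate_scaled hD.odd_p hD.even_L hD.L_lt_p.le
  obtain ⟨C, hC⟩ := h
  obtain ⟨B, hB⟩ := hb
  have hev := hD.odd_p.add_one
  have hcpos : 0 < r ^ (D.p + 1) - r₁ ^ (D.p + 1) :=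
    sub_pos.2 (pow_lt_pow_left₀ hr hr₁.le (by omega))
  obtain ⟨E, hE0, hE⟩ := exp_neg_div_pow_le hcpos (show 1 ≤ D.p + 1 by omega) N
  refine ⟨K * (|C| + |B| * E), ?_⟩
  filter_upwards [hC, hB, eventually_pos_le one_pos, eventually_pos_le (hr₁.trans hr)] with
    η hC hB hη hηr
  obtain ⟨h0, h1⟩ := hη
  choose! u' hu hd using hC
  have hrmem : ∀ t ∈ Icc (-r) r, t ∈ Icc (-D.t₀) D.t₀ := fun t ht =>
    Icc_subset_Icc (by linarith) hrt ht
  have hr0 : 0 < r := hr₁.trans hr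
  obtain ⟨k1, k2⟩ := hK η r (y.1 η) (|C| * η ^ N) |B| (y.2 η) u' h0 hηr.2 (by positivity) hu
    (by
      intro t ht
      have := hd t ht
      rw [add_zero] at this
      refine this.trans ?_
      gcongr
      exact le_abs_self C)
    ((hB.2 _ (hrmem r ⟨by linarith, le_rfl⟩)).trans (le_abs_self B))
    ((hB.2 _ (hrmem (-r) ⟨le_rfl, by linarith⟩)).trans (le_abs_self B))
  have hexp : ∀ t, |t| ≤ r₁ → Real.exp ((t / η) ^ (D.p + 1) - (r / η) ^ (D.p + 1)) ≤ E * η ^ N := by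
    intro t ht
    refine le_trans (Real.exp_le_exp.2 ?_) (hE η ⟨h0, h1⟩)
    rw [div_pow, div_pow, ← sub_div, ← neg_div]
    have : t ^ (D.p + 1) ≤ r₁ ^ (D.p + 1) := by
      rw [← hev.pow_abs]; gcongr
    gcongr
    linarith
  have fin : ∀ z, z ≤ E * η ^ N → K * (|C| * η ^ N + |B| * z) ≤ K * (|C| + |B| * E) * η ^ N := by
    intro z hz
    calc K * (|C| * η ^ N + |B| * z) ≤ K * (|C| * η ^ N + |B| * (E * η ^ N)) := by gcongr
      _ = _ := by ring
  refine ⟨?_, fun t ht => ?_⟩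
  · have h2 := hexp 0 (by simpa using hr₁.le)
    simp only [zero_div, ne_eq, Nat.succ_ne_zero, not_false_eq_true, zero_pow, zero_sub] at h2
    simpa using k1.trans (fin _ h2)
  · simpa using (k2 t (Icc_subset_Icc (by linarith) hr.le ht)).trans (fin _ (hexp t (abs_le.2 ht)))

/-- Two bounded approximate solutions of the same equation differ by `O(η^N)`. -/
theorem Admissible.stability (hD : D.Admissible) {r r₁ : ℝ} (hr₁ : 0 < r₁) (hr : r₁ < r)
    (hrt : r ≤ D.t₀) {N : ℕ} {y y' : CoupleFamily} {f : ℝ → ℝ → ℝ} (h : D.ApproxSol r N y f)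
    (h' : D.ApproxSol r N y' f) (hb : D.IsBoundedFamily y) (hb' : D.IsBoundedFamily y') :
    DiffBigO r₁ N y y' := by
  have h1 : D.ApproxSol r N (y - y') (fun _ _ => 0) := by
    have := h.add (h'.smul (-1))
    rw [neg_one_smul, ← sub_eq_add_neg] at this
    simpa using this
  simpa [DiffBigO] using hD.diffBigO_of_homogeneous hr₁ hr hrt h1 (hb.sub hb')

/-- The gain of one order, `N` to `N + 1`, is the factor `η` in the Lipschitz constant of `rhs`. -/
theorem Admissible.rhs_diff_negligible (hD : D.Admissible) {r : ℝ} (hr : r ≤ D.t₀) {N : ℕ}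
    {x x' y y' : CoupleFamily} (hx : D.IsBoundedFamily x) (hx' : D.IsBoundedFamily x')
    (hy : D.IsBoundedFamily y) (hy' : D.IsBoundedFamily y') (hxx : DiffBigO r N x x')
    (hyy : DiffBigO r N y y') :
    D.Negligible r (N + 1) (fun η t => D.rhs η (y.1 η) (x.1 η) (x.2 η t) t
      - D.rhs η (y'.1 η) (x'.1 η) (x'.2 η t) t) := by
  obtain ⟨M₁, h1⟩ := hx
  obtain ⟨M₂, h2⟩ := hx'
  obtain ⟨M₃, h3⟩ := hy
  obtain ⟨M₄, h4⟩ := hy'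
  obtain ⟨C₁, h5⟩ := hxx
  obtain ⟨C₂, h6⟩ := hyy
  set M := |M₁| + |M₂| + |M₃| + |M₄| with hM
  have a1 := abs_nonneg M₁
  have a2 := abs_nonneg M₂
  have a3 := abs_nonneg M₃
  have a4 := abs_nonneg M₄
  obtain ⟨C, hC0, hC⟩ := hD.rhs_lipschitz (M := M) (by positivity)
  refine ⟨C * (C₂ + C₁ + C₁), ?_⟩
  filter_upwards [h1, h2, h3, h4, h5, h6, hC, eventually_pos_le one_pos] with η h1 h2 h3 h4 h5 h6 hC hη t ht
  have ht' : t ∈ Icc (-D.t₀) D.t₀ := Icc_subset_Icc (by linarith) hr ht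
  have b1 := le_abs_self M₁
  have b2 := le_abs_self M₂
  have b3 := le_abs_self M₃
  have b4 := le_abs_self M₄
  have := hC t ht' (y.1 η) (y'.1 η) (x.1 η) (x'.1 η) (x.2 η t) (x'.2 η t)
    (by linarith [h3.1]) (by linarith [h4.1]) (by linarith [h1.1]) (by linarith [h2.1])
    (by linarith [h1.2 t ht']) (by linarith [h2.2 t ht'])
  refine this.trans ?_
  have h0 := hη.1.le
  calc _ ≤ C * η * (C₂ * η ^ N + C₁ * η ^ N + C₁ * η ^ N) * (1 + |t / η| ^ D.p) := by
        gcongr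
        exacts [h6.1, h5.1, h5.2 t ht]
    _ = _ := by ring

theorem Admissible.diffBigO_partialSum_succ (hD : D.Admissible) {r : ℝ} (hr : r ≤ D.t₀)
    (c : D.FormalSeries) (N : ℕ) : DiffBigO r N (D.partialSum c (N + 1)) (D.partialSum c N) := by
  obtain ⟨C, hC0, hC⟩ := hD.termEval_bounded (c N)
  refine ⟨|(c N).1| + C, ?_⟩
  filter_upwards [eventually_pos_le one_pos] with η hη
  have hp : 0 < η ^ N := pow_pos hη.1 N
  simp only [partialSum, Finset.sum_range_succ, add_sub_cancel_left]
  refine ⟨?_, fun t ht => ?_⟩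
  · rw [abs_mul, abs_of_pos hp]; gcongr; linarith
  · rw [abs_mul, abs_of_pos hp]
    gcongr
    have := hC η t (Icc_subset_Icc (by linarith) hr ht)
    linarith [abs_nonneg (c N).1]

theorem Admissible.diffBigO_partialSum (hD : D.Admissible) {r : ℝ} (hr : r ≤ D.t₀)
    (c : D.FormalSeries) {N M : ℕ} (hNM : N ≤ M) :
    DiffBigO r N (D.partialSum c M) (D.partialSum c N) := by
  induction M, hNM using Nat.le_induction with
  | base => exact ⟨0, Eventually.of_forall fun η => by simp⟩
  | succ M hM ih =>
    refine DiffBigO.trans ?_ ih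
    obtain ⟨C, hC⟩ := hD.diffBigO_partialSum_succ hr c M
    refine ⟨|C|, ?_⟩
    filter_upwards [hC, eventually_pos_le one_pos] with η h hη
    have h0 := hη.1.le
    have e : C * η ^ M ≤ |C| * η ^ N := by
      gcongr ?_ * ?_
      · exact le_abs_self C
      · exact pow_le_pow_of_le_one h0 hη.2 hM
    exact ⟨h.1.trans e, fun t ht => (h.2 t ht).trans e⟩

/-- A formal series that vanishes to order `N` vanishes identically up to order `N`. -/
theorem Admissible.partialSum_eq_of_diffBigO (hD : D.Admissible) {c d : D.FormalSeries} {N : ℕ}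
    (h : ∀ r ∈ Ioo 0 D.t₀, DiffBigO r N (D.partialSum c N) (D.partialSum d N)) :
    ∀ η, (D.partialSum c N).1 η = (D.partialSum d N).1 η ∧
      ∀ t ∈ Icc (-D.t₀) D.t₀, (D.partialSum c N).2 η t = (D.partialSum d N).2 η t := by
  have h1 := eq_zero_of_expansion hD.t₀_pos N (b := fun n _ => (c n).1 - (d n).1) (g := fun _ _ => 0)
    (fun _ => continuousOn_const) (fun _ => ⟨0, by simp⟩) (fun _ => tendsto_const_nhds) (by
      intro r hr
      obtain ⟨C, hC⟩ := h r hr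
      refine ⟨C, hC.mono fun η hη t _ => ?_⟩
      have := hη.1
      simp only [partialSum, ← Finset.sum_sub_distrib, ← sub_mul] at this
      simpa using this)
  have h2 := eq_zero_of_expansion hD.t₀_pos N
    (b := fun n t => smoothEval ((c n).2.1) t - smoothEval ((d n).2.1) t)
    (g := fun n T => ∑ i : Fin (n + 1), ∑ k : {k : Fin D.p // (k : ℕ) ≠ D.L},
      ((c n).2.2 i k - (d n).2.2 i k) * psiBar D.p D.L i k.1 T)
    (fun n => (contDiffOn_smoothEval _).continuousOn.sub (contDiffOn_smoothEval _).continuousOn)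
    (by
      intro n
      choose B hB using fun (i : ℕ) (k : {k : Fin D.p // (k : ℕ) ≠ D.L}) =>
        exists_bound_psiBar hD.odd_p hD.even_L hD.L_lt_p k.1.2 i
      refine ⟨∑ i : Fin (n + 1), ∑ k, |(c n).2.2 i k - (d n).2.2 i k| * B i k, fun T => ?_⟩
      refine (Finset.abs_sum_le_sum_abs _ _).trans (Finset.sum_le_sum fun i _ => ?_)
      refine (Finset.abs_sum_le_sum_abs _ _).trans (Finset.sum_le_sum fun k _ => ?_)
      rw [abs_mul]
      gcongr
      exact hB i k T)
    (by
      intro n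
      have : Tendsto (fun T => ∑ i : Fin (n + 1), ∑ k : {k : Fin D.p // (k : ℕ) ≠ D.L},
          ((c n).2.2 i k - (d n).2.2 i k) * psiBar D.p D.L i k.1 T) (atBot ⊔ atTop)
          (𝓝 (∑ i : Fin (n + 1), ∑ k : {k : Fin D.p // (k : ℕ) ≠ D.L},
            ((c n).2.2 i k - (d n).2.2 i k) * 0)) :=
        tendsto_finsetSum _ fun i _ => tendsto_finsetSum _ fun k _ =>
          (tendsto_psiBar hD.odd_p hD.even_L hD.L_lt_p k.1.2 i).const_mul _
      simpa using this)
    (by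
      intro r hr
      obtain ⟨C, hC⟩ := h r hr
      refine ⟨C, hC.mono fun η hη t ht => ?_⟩
      have := hη.2 t ht
      simp only [partialSum, ← Finset.sum_sub_distrib, ← sub_mul, termEval] at this
      refine le_trans (le_of_eq ?_) this
      congr 1
      refine Finset.sum_congr rfl fun n _ => ?_
      simp only [sub_mul, Finset.sum_sub_distrib]
      ring)
  intro η
  refine ⟨?_, fun t ht => ?_⟩
  · change ∑ n ∈ Finset.range N, (c n).1 * η ^ n = ∑ n ∈ Finset.range N, (d n).1 * η ^ n
    refine Finset.sum_congr rfl fun n hn => ?_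
    have := (h1 n (Finset.mem_range.1 hn)).1 0 ⟨by linarith [hD.t₀_pos], hD.t₀_pos.le⟩
    rw [sub_eq_zero.1 this]
  · change ∑ n ∈ Finset.range N, D.termEval (c n) η t * η ^ n
      = ∑ n ∈ Finset.range N, D.termEval (d n) η t * η ^ n
    refine Finset.sum_congr rfl fun n hn => ?_
    have e1 := (h2 n (Finset.mem_range.1 hn)).1 t ht
    have e2 := (h2 n (Finset.mem_range.1 hn)).2 (t / η)
    simp only [sub_mul, Finset.sum_sub_distrib] at e2
    simp only [termEval]
    rw [sub_eq_zero.1 e1, sub_eq_zero.1 e2]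

end CanardData

namespace CanardData

variable {D : CanardData}

/-! ### The formal operator -/

/-- `d` solves the equation with input `c` up to `O(η^N)`. -/
def Consistent (D : CanardData) (N : ℕ) (c d : D.FormalSeries) : Prop :=
  D.ApproxSol D.t₀ N (D.partialSum d N) (fun η t =>
    D.rhs η ((D.partialSum d N).1 η) ((D.partialSum c N).1 η) ((D.partialSum c N).2 η t) t)

theorem Consistent.congr {N : ℕ} {c c' d d' : D.FormalSeries} (h : D.Consistent N c d)
    (hc : ∀ n < N, c' n = c n) (hd : ∀ n < N, d' n = d n) : D.Consistent N c' d' := by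
  rw [Consistent, partialSum_congr hc, partialSum_congr hd]
  exact h

theorem Admissible.consistent_zero (hD : D.Admissible) (c d : D.FormalSeries) :
    D.Consistent 0 c d := by
  obtain ⟨C, hC0, hC⟩ := hD.rhs_bound le_rfl
  refine ⟨C, ?_⟩
  filter_upwards [hC] with η h t ht
  refine ⟨0, ?_, ?_⟩
  · have : (D.partialSum d 0).2 η = fun _ => 0 := by funext t; simp [partialSum]
    rw [this]
    exact hasDerivWithinAt_const _ _ _
  · have h1 := h t ht 0 0 (by simp) (by simp)
    have hT : (0 : ℝ) ≤ |t / η| ^ D.p := by positivity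
    simp only [partialSum, Finset.range_zero, Finset.sum_empty, mul_zero, zero_mul, zero_add,
      zero_sub, abs_neg, pow_zero, mul_one]
    exact h1.trans (le_mul_of_one_le_right hC0 (by linarith))

/-- The coefficients below `N` fix `rhs` up to `O(η^(N+1))`. A formal solution `x` of the resulting
equation agrees with `d` below order `N`, by stability, so its coefficient of order `N` continues
`d`. Quantifying over all `c'` records that the order `N` of the input is irrelevant. -/
theorem Admissible.exists_next (hD : D.Admissible) (hlin : D.IsLinear) {N : ℕ} {c d : D.FormalSeries}
    (h : D.Consistent N c d) : ∃ e : D.FormalTerm N, ∀ c' : D.FormalSeries, (∀ n < N, c' n = c n) →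
      D.Consistent (N + 1) c' (Function.update d N e) := by
  obtain ⟨x, hx⟩ := hD.solvable_rhs hlin d c N (N + 1)
  have hbd := fun (c : D.FormalSeries) (N : ℕ) => hD.isBoundedFamily_partialSum c N
  have hdiff : ∀ r ∈ Ioo 0 D.t₀, DiffBigO r N (D.partialSum x N) (D.partialSum d N) := fun r hr =>
    (hD.diffBigO_partialSum_succ hr.2.le x N).symm.trans
      (hD.stability hr.1 hr.2 le_rfl hx.of_succ h (hbd _ _) (hbd _ _))
  -- Only the values of the partial sums are identified, not the coefficients of the symbols. This
  -- suffices: `d'` keeps the coefficients of `d` and takes from `x` that of order `N` alone.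
  have heq := hD.partialSum_eq_of_diffBigO hdiff
  refine ⟨x N, fun c' hc' => ?_⟩
  set d' := Function.update d N (x N) with hd'
  have hd'n : ∀ n < N, d' n = d n := fun n hn => Function.update_of_ne hn.ne _ _
  have hd'N : d' N = x N := Function.update_self _ _ _
  have h1 : D.ApproxSol D.t₀ (N + 1) (D.partialSum d' (N + 1)) (fun η t =>
      D.rhs η ((D.partialSum d N).1 η) ((D.partialSum c N).1 η) ((D.partialSum c N).2 η t) t) := by
    refine hx.congr_left (Eventually.of_forall fun η => ?_)
    have hl := partialSum_congr hd'n
    have e1 : (D.partialSum d' (N + 1)).1 η = (D.partialSum d' N).1 η + (d' N).1 * η ^ N :=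
      Finset.sum_range_succ _ _
    have e2 : (D.partialSum x (N + 1)).1 η = (D.partialSum x N).1 η + (x N).1 * η ^ N :=
      Finset.sum_range_succ _ _
    refine ⟨by rw [e1, e2, hl, hd'N, (heq η).1], fun t ht => ?_⟩
    have e3 : (D.partialSum d' (N + 1)).2 η t = (D.partialSum d' N).2 η t
        + D.termEval (d' N) η t * η ^ N := Finset.sum_range_succ _ _
    have e4 : (D.partialSum x (N + 1)).2 η t = (D.partialSum x N).2 η t
        + D.termEval (x N) η t * η ^ N := Finset.sum_range_succ _ _
    rw [e3, e4, hl, hd'N, (heq η).2 t ht]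
  refine h1.of_negligible (hD.rhs_diff_negligible le_rfl (hbd c' (N + 1)) (hbd c N)
    (hbd d' (N + 1)) (hbd d N) ?_ ?_)
  · rw [← partialSum_congr hc']; exact hD.diffBigO_partialSum_succ le_rfl c' N
  · rw [← partialSum_congr hd'n]; exact hD.diffBigO_partialSum_succ le_rfl d' N

/-- The next coefficient of the image of `c`, given the previous coefficients `d`. -/
noncomputable def next (D : CanardData) (N : ℕ) (c d : D.FormalSeries) : D.FormalTerm N :=
  Classical.epsilon fun e => ∀ c' : D.FormalSeries, (∀ n < N, c' n = c n) →
    D.Consistent (N + 1) c' (Function.update d N e)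

theorem Admissible.next_spec (hD : D.Admissible) (hlin : D.IsLinear) {N : ℕ} {c d : D.FormalSeries}
    (h : D.Consistent N c d) : D.Consistent (N + 1) c (Function.update d N (D.next N c d)) :=
  Classical.epsilon_spec (hD.exists_next hlin h) c fun _ _ => rfl

/-- The property behind the choice involves `c` only through its coefficients below `N`, so the
choice itself does. Compatibility and the formal fixed point rest on this. -/
theorem next_congr {N : ℕ} {c c' : D.FormalSeries} (h : ∀ n < N, c n = c' n) (d : D.FormalSeries) :
    D.next N c d = D.next N c' d := by
  unfold next
  congr 1
  funext e
  refine propext (forall_congr' fun x => imp_congr_left ?_)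
  exact forall₂_congr fun n hn => by rw [h n hn]

/-- The first `N` coefficients of the image of `c` under the formal operator. -/
noncomputable def xiApprox (D : CanardData) (c : D.FormalSeries) : ℕ → D.FormalSeries
  | 0 => 0
  | N + 1 => Function.update (xiApprox D c N) N (D.next N c (xiApprox D c N))

/-- The image of `c` under the formal operator. -/
noncomputable def xiSeries (D : CanardData) (c : D.FormalSeries) : D.FormalSeries :=
  fun n => D.xiApprox c (n + 1) n

/-- The first `N` coefficients of the fixed point of the formal operator. -/
noncomputable def fixedApprox (D : CanardData) : ℕ → D.FormalSeries
  | 0 => 0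
  | N + 1 => Function.update (fixedApprox D N) N (D.next N (fixedApprox D N) (fixedApprox D N))

/-- The fixed point of the formal operator. -/
noncomputable def fixedSeries (D : CanardData) : D.FormalSeries :=
  fun n => D.fixedApprox (n + 1) n

theorem eq_diagonal_of_update {x : ℕ → D.FormalSeries} {e : (N : ℕ) → D.FormalTerm N}
    (hx : ∀ N, x (N + 1) = Function.update (x N) N (e N)) :
    ∀ N, ∀ n < N, x N n = x (n + 1) n := by
  intro N
  induction N with
  | zero => intro n hn; omega
  | succ N ih =>
    intro n hn
    rcases (Nat.lt_succ_iff.1 hn).eq_or_lt with rfl | h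
    · rfl
    · rw [hx N, Function.update_of_ne h.ne, ih n h]

theorem xiApprox_eq (c : D.FormalSeries) {N n : ℕ} (hn : n < N) :
    D.xiApprox c N n = D.xiSeries c n :=
  eq_diagonal_of_update (x := D.xiApprox c) (fun _ => rfl) N n hn

theorem fixedApprox_eq {N n : ℕ} (hn : n < N) : D.fixedApprox N n = D.fixedSeries n :=
  eq_diagonal_of_update (x := D.fixedApprox) (fun _ => rfl) N n hn

theorem xiApprox_congr {N : ℕ} {c c' : D.FormalSeries} (h : ∀ n < N, c n = c' n) :
    D.xiApprox c N = D.xiApprox c' N := by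
  induction N with
  | zero => rfl
  | succ N ih =>
    rw [xiApprox, xiApprox, ih fun n hn => h n (by omega), next_congr fun n hn => h n (by omega)]

theorem xiSeries_congr {N : ℕ} {c c' : D.FormalSeries} (h : ∀ n ≤ N, c n = c' n) :
    D.xiSeries c N = D.xiSeries c' N := by
  rw [xiSeries, xiSeries, xiApprox_congr fun n hn => h n (by omega)]

/-- At each stage both recursions feed `next` with inputs that agree below the current order. -/
theorem xiApprox_fixedSeries (N : ℕ) : D.xiApprox D.fixedSeries N = D.fixedApprox N := by
  induction N with
  | zero => rfl
  | succ N ih =>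
    rw [xiApprox, fixedApprox, ih, next_congr fun n hn => (fixedApprox_eq hn).symm]

theorem xiSeries_fixedSeries : D.xiSeries D.fixedSeries = D.fixedSeries := by
  funext n
  rw [xiSeries, xiApprox_fixedSeries, fixedSeries]

theorem Admissible.consistent_xiSeries (hD : D.Admissible) (hlin : D.IsLinear) (c : D.FormalSeries)
    (N : ℕ) : D.Consistent N c (D.xiSeries c) := by
  have h : D.Consistent N c (D.xiApprox c N) := by
    induction N with
    | zero => exact hD.consistent_zero _ _
    | succ N ih => exact hD.next_spec hlin ih
  exact h.congr (fun _ _ => rfl) (fun n hn => (xiApprox_eq c hn).symm)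

/-- A truncated series completed by zeros. -/
def extendZero (D : CanardData) {K : ℕ} (c : D.FormalSpace K) : D.FormalSeries :=
  fun n => if h : n < K + 1 then c ⟨n, h⟩ else 0

theorem extendZero_apply {K : ℕ} (c : D.FormalSpace K) {n : ℕ} (h : n < K + 1) :
    D.extendZero c n = c ⟨n, h⟩ := dif_pos h

theorem realize_eq_partialSum {K : ℕ} (c : D.FormalSpace K) (d : D.FormalSeries)
    (h : ∀ n : Fin (K + 1), c n = d n) : D.realize c = D.partialSum d (K + 1) := by
  refine Prod.ext (funext fun η => ?_) (funext fun η => funext fun t => ?_)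
  · simp only [realize, partialSum]
    rw [← Fin.sum_univ_eq_sum_range (fun n => (d n).1 * η ^ n)]
    exact Finset.sum_congr rfl fun n _ => by rw [h n]
  · simp only [realize, partialSum]
    rw [← Fin.sum_univ_eq_sum_range (fun n => D.termEval (d n) η t * η ^ n)]
    exact Finset.sum_congr rfl fun n _ => by rw [h n]; rfl

/-! ### Exact solutions -/

theorem Admissible.solvesSystem_iff (hD : D.Admissible) {η : ℝ} (hη : 0 < η) (β α : ℝ)
    (v u : ℝ → ℝ) : D.SolvesSystem η β v α u ↔ u (-D.t₀) = 0 ∧ u D.t₀ = 0 ∧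
      ∀ t ∈ Icc (-D.t₀) D.t₀, ∃ u' : ℝ, HasDerivWithinAt u u' (Icc (-D.t₀) D.t₀) t ∧
        η * u' = ((D.p : ℝ) + 1) * (t / η) ^ D.p * u t + α * (t / η) ^ D.L + D.rhs η α β (v t) t := by
  refine and_congr_right fun _ => and_congr_right fun _ => forall₂_congr fun t _ =>
    exists_congr fun u' => and_congr_right fun _ => ?_
  have hpow : η ^ (D.p + 1) ≠ 0 := by positivity
  have e1 : η ^ (D.p + 1) * (t / η) ^ D.p = η * t ^ D.p := by
    rw [pow_succ, div_pow]; field_simp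
  have e2 : η ^ (D.p + 1) * (t / η) ^ D.L = η ^ (D.p - D.L + 1) * t ^ D.L := by
    have : D.p + 1 = (D.p - D.L + 1) + D.L := by have := hD.L_lt_p; omega
    rw [this, pow_add, div_pow]; field_simp
  have e3 : η ^ (D.p + 1) * (D.S t (η ^ (D.p - D.L + 1) * α) / η ^ (D.p + 1))
      = D.S t (η ^ (D.p - D.L + 1) * α) := by field_simp
  rw [← mul_right_inj' hpow (b := η * u'), rhs]
  have e4 : η ^ (D.p + 1) * (((D.p : ℝ) + 1) * (t / η) ^ D.p * u t + α * (t / η) ^ D.L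
      + (D.S t (η ^ (D.p - D.L + 1) * α) / η ^ (D.p + 1)
        + D.P t (η * v t) (η ^ (D.p - D.L + 1) * β) η))
      = ((D.p : ℝ) + 1) * (η ^ (D.p + 1) * (t / η) ^ D.p) * u t
        + α * (η ^ (D.p + 1) * (t / η) ^ D.L)
        + η ^ (D.p + 1) * (D.S t (η ^ (D.p - D.L + 1) * α) / η ^ (D.p + 1))
        + η ^ (D.p + 1) * D.P t (η * v t) (η ^ (D.p - D.L + 1) * β) η := by ring
  rw [e4, e1, e2, e3]
  constructor <;> intro h <;> linear_combination h

theorem Admissible.approxSol_of_isXiImage (hD : D.Admissible) {x y : CoupleFamily}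
    (h : D.IsXiImage x y) (N : ℕ) :
    D.ApproxSol D.t₀ N y (fun η t => D.rhs η (y.1 η) (x.1 η) (x.2 η t) t) := by
  refine ⟨0, ?_⟩
  filter_upwards [h.2, eventually_pos_le one_pos] with η hs hη t ht
  obtain ⟨u', hu, he⟩ := ((hD.solvesSystem_iff hη.1 _ _ _ _).1 hs).2.2 t ht
  exact ⟨u', hu, by rw [he]; simp⟩

/-- An exact solution is approximated by the formal one. -/
theorem Admissible.expansion_of_isXiImage (hD : D.Admissible) {x y : CoupleFamily}
    (h : D.IsXiImage x y) (hx : D.IsBoundedFamily x) {c d : D.FormalSeries}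
    (hcd : ∀ N, D.Consistent N c d) {K : ℕ}
    (hxc : ∀ n ≤ K, (∀ r ∈ Ioo 0 D.t₀, DiffBigO r n y (D.partialSum d n)) →
      ∀ r ∈ Ioo 0 D.t₀, DiffBigO r n x (D.partialSum c (n + 1))) :
    ∀ n ≤ K + 1, ∀ r ∈ Ioo 0 D.t₀, DiffBigO r n y (D.partialSum d n) := by
  have hbd := fun (c : D.FormalSeries) (N : ℕ) => hD.isBoundedFamily_partialSum c N
  intro n
  induction n with
  | zero =>
    intro _ r hr
    obtain ⟨M, hM⟩ := h.1
    refine ⟨M, hM.mono fun η h => ⟨by simpa [partialSum] using h.1, fun t ht => ?_⟩⟩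
    simpa [partialSum] using h.2 t (Icc_subset_Icc (by linarith [hr.2]) hr.2.le ht)
  | succ n ih =>
    intro hn r hr
    have ih' := ih (by omega)
    -- Closeness to order `n` on the larger interval gives `rhs` to order `n + 1`; stability then
    -- gives `y` to order `n + 1` on the smaller one.
    obtain ⟨r', hr1, hr2⟩ := exists_between hr.2
    have hr' : r' ∈ Ioo 0 D.t₀ := ⟨hr.1.trans hr1, hr2⟩
    have h1 := (ih' r' hr').trans (hD.diffBigO_partialSum_succ hr2.le d n).symm
    have h2 := hxc n (by omega) ih' r' hr'
    have h3 := hD.rhs_diff_negligible hr2.le hx (hbd c (n + 1)) h.1 (hbd d (n + 1)) h2 h1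
    have h4 := ((hcd (n + 1)).mono hr2.le).of_negligible h3
    exact hD.stability hr.1 hr1 hr2.le ((hD.approxSol_of_isXiImage h (n + 1)).mono hr2.le) h4 h.1
      (hbd _ _)

end CanardData

namespace CanardData

/-! ### Existence and uniqueness of bounded solutions -/

/-- The boundary value problem `η u' = (p + 1) (t/η)^p u + α (t/η)^L + f(t)`, `u(±r) = 0`. -/
def SolvesLinear (p L : ℕ) (η r α : ℝ) (u f : ℝ → ℝ) : Prop :=
  u (-r) = 0 ∧ u r = 0 ∧ ∀ t ∈ Icc (-r) r, ∃ u' : ℝ, HasDerivWithinAt u u' (Icc (-r) r) t ∧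
    η * u' = ((p : ℝ) + 1) * (t / η) ^ p * u t + α * (t / η) ^ L + f t

theorem SolvesLinear.continuousOn {p L : ℕ} {η r α : ℝ} {u f : ℝ → ℝ}
    (h : SolvesLinear p L η r α u f) : ContinuousOn u (Icc (-r) r) := fun t ht => by
  obtain ⟨u', hu, -⟩ := h.2.2 t ht
  exact hu.continuousWithinAt

/-- The difference of two solutions vanishes at both ends, so the a priori estimate applies with
boundary bound `0` and holds up to the ends. -/
theorem exists_solvesLinear_estimate {p L : ℕ} (hp : Odd p) (hL : Even L) (hLp : L ≤ p) :
    ∃ K : ℝ, 1 ≤ K ∧ ∀ (η r α α' ε : ℝ) (u u' f f' : ℝ → ℝ), 0 < η → η ≤ r → 0 ≤ ε →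
      SolvesLinear p L η r α u f → SolvesLinear p L η r α' u' f' →
      (∀ t ∈ Icc (-r) r, |f t - f' t| ≤ ε * (1 + |t / η| ^ p)) →
      |α - α'| ≤ K * ε ∧ ∀ t ∈ Icc (-r) r, |u t - u' t| ≤ K * ε := by
  obtain ⟨K, hK1, hK⟩ := apriori_estimate_scaled hp hL hLp
  refine ⟨K, hK1, fun η r α α' ε u u' f f' hη hr hε h h' hf => ?_⟩
  choose! v hv hv2 using h.2.2
  choose! v' hv' hv2' using h'.2.2
  have := hK η r (α - α') ε 0 (fun t => u t - u' t) (fun t => v t - v' t) hη hr hε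
    (fun t ht => (hv t ht).sub (hv' t ht)) (fun t ht => by
      have e : η * (v t - v' t) - (((p : ℝ) + 1) * (t / η) ^ p * (u t - u' t)
          + (α - α') * (t / η) ^ L) = f t - f' t := by
        rw [mul_sub, hv2 t ht, hv2' t ht]; ring
      rw [e]; exact hf t ht)
    (by simp [h.2.1, h'.2.1]) (by simp [h.1, h'.1])
  simpa using this

/-- Existence and uniqueness for a weakly nonlinear boundary value problem. -/
theorem exists_unique_solvesLinear {p L : ℕ} (hp : Odd p) (hL : Even L) (hLp : L ≤ p) :
    ∃ K : ℝ, 1 ≤ K ∧ ∀ (η r M : ℝ) (F : ℝ → ℝ → ℝ → ℝ), 0 < η → η ≤ r → 0 ≤ M →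
      (∀ (a : ℝ) (u : ℝ → ℝ), ContinuousOn u (Icc (-r) r) →
        ContinuousOn (fun t => F t a (u t)) (Icc (-r) r)) →
      (∀ t ∈ Icc (-r) r, ∀ a u, |a| ≤ M → |u| ≤ M → K * |F t a u| ≤ M * (1 + |t / η| ^ p)) →
      (∀ t ∈ Icc (-r) r, ∀ a a' u u', |a| ≤ M → |a'| ≤ M → |u| ≤ M → |u'| ≤ M →
        4 * K * |F t a u - F t a' u'| ≤ (|a - a'| + |u - u'|) * (1 + |t / η| ^ p)) →
      ∃ (α : ℝ) (u : ℝ → ℝ), |α| ≤ M ∧ (∀ t ∈ Icc (-r) r, |u t| ≤ M) ∧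
        SolvesLinear p L η r α u (fun t => F t α (u t)) ∧
        ∀ (α' : ℝ) (u' : ℝ → ℝ), |α'| ≤ M → (∀ t ∈ Icc (-r) r, |u' t| ≤ M) →
          SolvesLinear p L η r α' u' (fun t => F t α' (u' t)) →
          α' = α ∧ ∀ t ∈ Icc (-r) r, u' t = u t := by
  obtain ⟨K, hK1, hK⟩ := exists_solvesLinear_estimate hp hL hLp
  refine ⟨K, hK1, fun η r M F hη hηr hM hcont hbd hlip => ?_⟩
  have hK0 : 0 < K := by linarith
  have hr : 0 < r := hη.trans_le hηr
  have hrr : -r ≤ r := by linarith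
  have hw : ∀ t, 0 ≤ 1 + |t / η| ^ p := fun t => by positivity
  let X := ℝ × C(Icc (-r) r, ℝ)
  have hXu : ∀ (x : X) (t : Icc (-r) r), |x.2 t| ≤ ‖x‖ := fun x t =>
    (x.2.norm_coe_le_norm t).trans (norm_snd_le x)
  have hXa : ∀ x : X, |x.1| ≤ ‖x‖ := fun x => norm_fst_le x
  have hXle : ∀ (x : X) (B : ℝ), 0 ≤ B → |x.1| ≤ B → (∀ t, |x.2 t| ≤ B) → ‖x‖ ≤ B :=
    fun x B hB h1 h2 => max_le h1 ((ContinuousMap.norm_le _ hB).2 h2)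
  -- contraction property in terms of the norm
  have hlipX : ∀ (x x' : X), ‖x‖ ≤ M → ‖x'‖ ≤ M → ∀ t : Icc (-r) r,
      |F t x.1 (x.2 t) - F t x'.1 (x'.2 t)| ≤ ‖x - x'‖ / (2 * K) * (1 + |t / η| ^ p) := by
    intro x x' hx hx' t
    have h1 := hlip t t.2 x.1 x'.1 (x.2 t) (x'.2 t) ((hXa x).trans hx) ((hXa x').trans hx')
      ((hXu x t).trans hx) ((hXu x' t).trans hx')
    have h2 : |x.1 - x'.1| + |x.2 t - x'.2 t| ≤ 2 * ‖x - x'‖ := by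
      have e1 : |x.1 - x'.1| ≤ ‖x - x'‖ := hXa (x - x')
      have e2 : |x.2 t - x'.2 t| ≤ ‖x - x'‖ := hXu (x - x') t
      linarith
    rw [div_mul_eq_mul_div, le_div_iff₀ (by positivity)]
    nlinarith [mul_le_mul_of_nonneg_right h2 (hw t)]
  -- The linear problem is solved with a forcing continuous on the whole line, hence the extension
  -- by constants outside `[-r, r]`.
  have hsol : ∀ x : X, ∃ (α : ℝ) (u : ℝ → ℝ), Continuous u ∧
      SolvesLinear p L η r α u (IccExtend hrr fun t : Icc (-r) r => F t x.1 (x.2 t)) := by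
    intro x
    have hc : Continuous (fun t : Icc (-r) r => F t x.1 (x.2 t)) := by
      have := (hcont x.1 (IccExtend hrr x.2) (x.2.continuous.Icc_extend').continuousOn).domRestrict
      refine this.congr fun t => ?_
      simp [IccExtend_of_mem hrr x.2 t.2]
    obtain ⟨α, u, u', h1, h2, h3⟩ := exists_linear_solution p hL hη hr hc.Icc_extend'
    exact ⟨α, u, continuous_iff_continuousAt.2 fun t => (h3 t).1.continuousAt, h1, h2,
      fun t _ => ⟨u' t, (h3 t).1.hasDerivWithinAt, (h3 t).2⟩⟩
  choose A U hUc hU using hsol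
  let Φ : X → X := fun x => (A x, ⟨fun t => U x t, (hUc x).comp continuous_subtype_val⟩)
  have hzero : SolvesLinear p L η r 0 0 0 := ⟨rfl, rfl, fun t _ =>
    ⟨0, hasDerivWithinAt_const t _ (0 : ℝ), by simp⟩⟩
  have hΦball : MapsTo Φ (Metric.closedBall 0 M) (Metric.closedBall 0 M) := by
    intro x hx
    rw [mem_closedBall_zero_iff] at hx ⊢
    have := hK η r (A x) 0 (M / K) (U x) 0 _ 0 hη hηr (by positivity) (hU x) hzero (by
      intro t ht
      rw [IccExtend_of_mem hrr _ ht]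
      have := hbd t ht x.1 (x.2 ⟨t, ht⟩) ((hXa x).trans hx) ((hXu x _).trans hx)
      simp only [Pi.zero_apply, sub_zero]
      rw [div_mul_eq_mul_div, le_div_iff₀ hK0]
      linarith)
    rw [mul_div_cancel₀ _ hK0.ne'] at this
    simp only [Pi.zero_apply, sub_zero] at this
    exact hXle _ _ hM this.1 fun t => this.2 t t.2
  have hΦlip : ∀ x x' : X, ‖x‖ ≤ M → ‖x'‖ ≤ M → ‖Φ x - Φ x'‖ ≤ 1 / 2 * ‖x - x'‖ := by
    intro x x' hx hx'
    have := hK η r (A x) (A x') (‖x - x'‖ / (2 * K)) (U x) (U x') _ _ hη hηr (by positivity)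
      (hU x) (hU x') (by
        intro t ht
        rw [IccExtend_of_mem hrr _ ht, IccExtend_of_mem hrr _ ht]
        exact hlipX x x' hx hx' ⟨t, ht⟩)
    have e : K * (‖x - x'‖ / (2 * K)) = 1 / 2 * ‖x - x'‖ := by field_simp
    rw [e] at this
    exact hXle _ _ (by positivity) this.1 fun t => this.2 t t.2
  obtain ⟨x, hxM, hxΦ, -⟩ := ContractingWith.exists_fixedPoint' (K := 1 / 2) (f := Φ)
    (s := Metric.closedBall 0 M) Metric.isClosed_closedBall.isComplete hΦball
    ⟨by norm_num, LipschitzWith.of_dist_le_mul fun x x' => by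
      have := hΦlip x x' (mem_closedBall_zero_iff.1 x.2) (mem_closedBall_zero_iff.1 x'.2)
      rw [Subtype.dist_eq, Subtype.dist_eq, dist_eq_norm, dist_eq_norm]
      simpa using this⟩ (x := 0) (by simpa using hM) (edist_ne_top _ _)
  rw [mem_closedBall_zero_iff] at hxM
  have hx1 : A x = x.1 := congrArg Prod.fst hxΦ
  have hx2 : ∀ t : Icc (-r) r, U x t = x.2 t := fun t =>
    congrArg (fun z : X => z.2 t) hxΦ
  have hUsol : SolvesLinear p L η r x.1 (U x) (fun t => F t x.1 (U x t)) := by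
    have := hU x
    refine ⟨this.1, this.2.1, fun t ht => ?_⟩
    obtain ⟨u', h1, h2⟩ := this.2.2 t ht
    refine ⟨u', h1, ?_⟩
    rw [h2, IccExtend_of_mem hrr _ ht, hx1, ← hx2 ⟨t, ht⟩]
  have hUM : ∀ t ∈ Icc (-r) r, |U x t| ≤ M := fun t ht => by
    rw [hx2 ⟨t, ht⟩]; exact (hXu x _).trans hxM
  refine ⟨x.1, U x, (hXa x).trans hxM, hUM, hUsol, ?_⟩
  intro α' u' hα' hu' hs
  let x' : X := (α', ⟨(Icc (-r) r).domRestrict u', hs.continuousOn.domRestrict⟩)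
  have hx' : ‖x'‖ ≤ M := hXle _ _ hM hα' fun t => hu' t t.2
  have := hK η r α' x.1 (‖x' - x‖ / (2 * K)) u' (U x) _ _ hη hηr (by positivity) hs hUsol (by
    intro t ht
    have := hlipX x' x hx' hxM ⟨t, ht⟩
    rw [← hx2] at this
    exact this)
  have e : K * (‖x' - x‖ / (2 * K)) = 1 / 2 * ‖x' - x‖ := by field_simp
  rw [e] at this
  have hle : ‖x' - x‖ ≤ 1 / 2 * ‖x' - x‖ := hXle _ _ (by positivity) this.1 fun t => by
    have := this.2 t t.2
    rw [hx2] at this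
    exact this
  have h0 : 1 / 2 * ‖x' - x‖ = 0 := by linarith [norm_nonneg (x' - x)]
  rw [h0] at this
  exact ⟨sub_eq_zero.1 (abs_nonpos_iff.1 this.1),
    fun t ht => sub_eq_zero.1 (abs_nonpos_iff.1 (this.2 t ht))⟩

/-- Families of weakly nonlinear boundary value problems have exactly one bounded solution. -/
theorem exists_bounded_solvesLinear {p L : ℕ} (hp : Odd p) (hL : Even L) (hLp : L ≤ p) {r : ℝ}
    (hr : 0 < r) {F : ℝ → ℝ → ℝ → ℝ → ℝ}
    (hcont : ∀ᶠ η in 𝓝[>] (0 : ℝ), ∀ (a : ℝ) (u : ℝ → ℝ), ContinuousOn u (Icc (-r) r) →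
      ContinuousOn (fun t => F η t a (u t)) (Icc (-r) r))
    (hbd : ∃ B, ∀ᶠ η in 𝓝[>] (0 : ℝ), ∀ t ∈ Icc (-r) r, |F η t 0 0| ≤ B)
    (hlip : ∀ M, 0 ≤ M → ∃ C, 0 ≤ C ∧ ∀ᶠ η in 𝓝[>] (0 : ℝ), ∀ t ∈ Icc (-r) r, ∀ a a' u u' : ℝ,
      |a| ≤ M → |a'| ≤ M → |u| ≤ M → |u'| ≤ M →
      |F η t a u - F η t a' u'| ≤ C * η * (|a - a'| + |u - u'|) * (1 + |t / η| ^ p)) :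
    ∃ (y : CoupleFamily) (M : ℝ),
      (∀ᶠ η in 𝓝[>] (0 : ℝ), |y.1 η| ≤ M ∧ (∀ t ∈ Icc (-r) r, |y.2 η t| ≤ M) ∧
        SolvesLinear p L η r (y.1 η) (y.2 η) (fun t => F η t (y.1 η) (y.2 η t))) ∧
      ∀ (y' : CoupleFamily) (M' : ℝ),
        (∀ᶠ η in 𝓝[>] (0 : ℝ), |y'.1 η| ≤ M' ∧ (∀ t ∈ Icc (-r) r, |y'.2 η t| ≤ M') ∧
          SolvesLinear p L η r (y'.1 η) (y'.2 η) (fun t => F η t (y'.1 η) (y'.2 η t))) →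
        ∀ᶠ η in 𝓝[>] (0 : ℝ), y'.1 η = y.1 η ∧ ∀ t ∈ Icc (-r) r, y'.2 η t = y.2 η t := by
  obtain ⟨K, hK1, hK⟩ := exists_unique_solvesLinear hp hL hLp
  have hK0 : 0 < K := by linarith
  obtain ⟨B, hB⟩ := hbd
  -- every large enough ball contains exactly one solution, for small `η`
  have key : ∀ M, 2 * K * |B| ≤ M → ∀ᶠ η in 𝓝[>] (0 : ℝ),
      ∃ (α : ℝ) (u : ℝ → ℝ), |α| ≤ M ∧ (∀ t ∈ Icc (-r) r, |u t| ≤ M) ∧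
        SolvesLinear p L η r α u (fun t => F η t α (u t)) ∧
        ∀ (α' : ℝ) (u' : ℝ → ℝ), |α'| ≤ M → (∀ t ∈ Icc (-r) r, |u' t| ≤ M) →
          SolvesLinear p L η r α' u' (fun t => F η t α' (u' t)) →
          α' = α ∧ ∀ t ∈ Icc (-r) r, u' t = u t := by
    intro M hM
    have hM0 : 0 ≤ M := le_trans (by positivity) hM
    obtain ⟨C, hC0, hC⟩ := hlip M hM0
    filter_upwards [hcont, hB, hC, eventually_pos_le hr,
      eventually_pos_le (c := 1 / (4 * K * (C + 1))) (by positivity)] with η hcη hBη hCη hη hη'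
    have hsmall : 4 * K * (C * η) ≤ 1 := by
      have := hη'.2
      rw [le_div_iff₀ (by positivity)] at this
      nlinarith [mul_pos hK0 hη.1]
    have hL' : ∀ t ∈ Icc (-r) r, ∀ a a' u u' : ℝ, |a| ≤ M → |a'| ≤ M → |u| ≤ M → |u'| ≤ M →
        4 * K * |F η t a u - F η t a' u'| ≤ (|a - a'| + |u - u'|) * (1 + |t / η| ^ p) := by
      intro t ht a a' u u' ha ha' hu hu'
      calc _ ≤ 4 * K * (C * η * (|a - a'| + |u - u'|) * (1 + |t / η| ^ p)) := by
            gcongr; exact hCη t ht a a' u u' ha ha' hu hu'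
        _ = 4 * K * (C * η) * ((|a - a'| + |u - u'|) * (1 + |t / η| ^ p)) := by ring
        _ ≤ _ := mul_le_of_le_one_left (by positivity) hsmall
    -- Half of `M` bounds `K |F η t 0 0|`, as `2K|B| ≤ M`; the other half bounds the variation of
    -- `F`, by the Lipschitz bound with `4K`.
    refine hK η r M (F η) hη.1 hη.2 hM0 hcη (fun t ht a u ha hu => ?_) hL'
    have h1 := hL' t ht a 0 u 0 ha (by simpa) hu (by simpa)
    have h2 := (hBη t ht).trans (le_abs_self B)
    have h3 : |F η t a u| ≤ |F η t a u - F η t 0 0| + |F η t 0 0| := by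
      simpa using abs_add_le (F η t a u - F η t 0 0) (F η t 0 0)
    have hw : 1 ≤ 1 + |t / η| ^ p := by simp
    simp only [sub_zero] at h1
    have h4 : K * |B| * 1 ≤ M / 2 * (1 + |t / η| ^ p) := by
      gcongr
      linarith
    have h5 : (|a| + |u|) * (1 + |t / η| ^ p) ≤ (M + M) * (1 + |t / η| ^ p) := by gcongr
    nlinarith [mul_le_mul_of_nonneg_left h3 hK0.le, mul_le_mul_of_nonneg_left h2 hK0.le]
  -- A solution is selected separately for each `η`; the default value is used only where none
  -- exists, which does not happen for small `η`.
  let G : ℝ → ℝ → (ℝ → ℝ) → Prop := fun η α u => |α| ≤ 2 * K * |B| ∧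
    (∀ t ∈ Icc (-r) r, |u t| ≤ 2 * K * |B|) ∧
    SolvesLinear p L η r α u (fun t => F η t α (u t))
  have hG : ∀ η, ∃ (α : ℝ) (u : ℝ → ℝ), (∃ (α' : ℝ) (u' : ℝ → ℝ), G η α' u') → G η α u := by
    intro η
    by_cases h : ∃ (α' : ℝ) (u' : ℝ → ℝ), G η α' u'
    · obtain ⟨α', u', h⟩ := h
      exact ⟨α', u', fun _ => h⟩
    · exact ⟨0, 0, fun h' => absurd h' h⟩
  choose α u hαu using hG
  have hsol : ∀ᶠ η in 𝓝[>] (0 : ℝ), G η (α η) (u η) := (key _ le_rfl).mono fun η h => by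
    obtain ⟨a, v, ha, hv, hs, -⟩ := h
    exact hαu η ⟨a, v, ha, hv, hs⟩
  refine ⟨(α, u), 2 * K * |B|, hsol, fun y' M' hy' => ?_⟩
  -- Both families lie in the larger of the two balls, which contains a single solution for small
  -- `η`.
  filter_upwards [hsol, key (max (2 * K * |B|) M') (le_max_left _ _), hy'] with η h h' hη
  obtain ⟨a, v, -, -, -, huniq⟩ := h'
  have e1 := huniq _ _ (hη.1.trans (le_max_right _ _))
    (fun t ht => (hη.2.1 t ht).trans (le_max_right _ _)) hη.2.2
  have e2 := huniq _ _ (h.1.trans (le_max_left _ _))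
    (fun t ht => (h.2.1 t ht).trans (le_max_left _ _)) h.2.2
  exact ⟨e1.1.trans e2.1.symm, fun t ht => (e1.2 t ht).trans (e2.2 t ht).symm⟩

end CanardData

namespace CanardData

variable {D : CanardData}

/-! ### Well-posedness of `Ξ_η`, the canard solution and the conclusion -/

theorem Admissible.continuousOn_rhs (hD : D.Admissible) {η : ℝ} (hη : η ∈ Ico 0 D.η₀) (a b : ℝ)
    {v : ℝ → ℝ} (hv : ContinuousOn v (Icc (-D.t₀) D.t₀)) :
    ContinuousOn (fun t => D.rhs η a b (v t) t) (Icc (-D.t₀) D.t₀) := by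
  refine ContinuousOn.add (ContinuousOn.div_const ?_ _) ?_
  · exact hD.smooth_S.continuousOn.comp
      (f := fun t => (t, η ^ (D.p - D.L + 1) * a)) (by fun_prop) fun t ht => ⟨ht, mem_univ _⟩
  · exact hD.smooth_P.continuousOn.comp
      (f := fun t => (t, η * v t, η ^ (D.p - D.L + 1) * b, η)) (by fun_prop)
      fun t ht => ⟨ht, mem_univ _, mem_univ _, hη⟩

theorem Admissible.continuousOn_partialSum (hD : D.Admissible) (c : D.FormalSeries) (N : ℕ) (η : ℝ) :
    ContinuousOn ((D.partialSum c N).2 η) (Icc (-D.t₀) D.t₀) := by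
  refine continuousOn_finsetSum (Finset.range N)
    (f := fun n t => D.termEval (c n) η t * η ^ n) fun n _ => ContinuousOn.mul ?_ continuousOn_const
  refine (contDiffOn_smoothEval _).continuousOn.add (Continuous.continuousOn ?_)
  refine continuous_finsetSum _ fun i _ => continuous_finsetSum _ fun k _ => ?_
  exact continuous_const.mul ((differentiable_psiBar hD.odd_p hD.even_L hD.L_lt_p k.1.2 i).continuous.comp
    (continuous_id.div_const η))

theorem Admissible.eventually_mem_Ico (hD : D.Admissible) :
    ∀ᶠ η in 𝓝[>] (0 : ℝ), η ∈ Ico 0 D.η₀ :=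
  (eventually_pos_le (half_pos hD.η₀_pos)).mono fun _ h =>
    ⟨h.1.le, h.2.trans_lt (half_lt_self hD.η₀_pos)⟩

theorem Admissible.mem_xiDomain (hD : D.Admissible) {x : CoupleFamily} (hx : D.IsBoundedFamily x)
    (hxc : ∀ η, ContinuousOn (x.2 η) (Icc (-D.t₀) D.t₀)) : x ∈ D.xiDomain := by
  obtain ⟨B, hB⟩ := hx
  obtain ⟨y, M, hy, huniq⟩ := exists_bounded_solvesLinear (r := D.t₀) hD.odd_p hD.even_L hD.L_lt_p.le
    hD.t₀_pos (F := fun η t a _ => D.rhs η a (x.1 η) (x.2 η t) t)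
    (hD.eventually_mem_Ico.mono fun η hη a u _ => hD.continuousOn_rhs hη a _ (hxc η))
    (by
      obtain ⟨C, -, hC⟩ := hD.rhs_bound (abs_nonneg B)
      refine ⟨C, ?_⟩
      filter_upwards [hB, hC] with η h hC t ht
      exact hC t ht _ _ (h.1.trans (le_abs_self B)) ((h.2 t ht).trans (le_abs_self B)))
    (by
      intro M hM
      obtain ⟨C, hC0, hC⟩ := hD.rhs_lipschitz (hM.trans (le_max_left M B))
      refine ⟨C, hC0, ?_⟩
      filter_upwards [hB, hC, eventually_pos_le one_pos] with η h hC hη t ht a a' u u' ha ha' _ _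
      have h1 := h.1.trans (le_max_right M B)
      have h2 := (h.2 t ht).trans (le_max_right M B)
      refine (hC t ht a a' _ _ _ _ (ha.trans (le_max_left _ _)) (ha'.trans (le_max_left _ _))
        h1 h1 h2 h2).trans ?_
      have := hη.1.le
      simp only [sub_self, abs_zero, add_zero]
      gcongr
      exact le_add_of_nonneg_right (abs_nonneg _))
  refine ⟨y, ⟨⟨M, hy.mono fun η h => ⟨h.1, h.2.1⟩⟩, ?_⟩, ?_⟩
  · filter_upwards [hy, eventually_pos_le one_pos] with η h hη
    exact (hD.solvesSystem_iff hη.1 _ _ _ _).2 h.2.2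
  · rintro y' ⟨⟨M', hM'⟩, hs⟩
    refine huniq y' M' ?_
    filter_upwards [hM', hs, eventually_pos_le one_pos] with η h h' hη
    exact ⟨h.1, h.2, (hD.solvesSystem_iff hη.1 _ _ _ _).1 h'⟩

theorem Admissible.exists_canardSolution (hD : D.Admissible) : ∃ y : CoupleFamily,
    D.IsCanardSolution y ∧ ∀ y' : CoupleFamily, D.IsCanardSolution y' → D.Agree y' y := by
  obtain ⟨y, M, hy, huniq⟩ := exists_bounded_solvesLinear (r := D.t₀) hD.odd_p hD.even_L hD.L_lt_p.le
    hD.t₀_pos (F := fun η t a u => D.rhs η a a u t)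
    (hD.eventually_mem_Ico.mono fun η hη a u hu => hD.continuousOn_rhs hη a a hu)
    (by
      obtain ⟨C, -, hC⟩ := hD.rhs_bound le_rfl
      exact ⟨C, hC.mono fun η hC t ht => hC t ht 0 0 (by simp) (by simp)⟩)
    (by
      intro M hM
      obtain ⟨C, hC0, hC⟩ := hD.rhs_lipschitz hM
      refine ⟨2 * C, by positivity, ?_⟩
      filter_upwards [hC, eventually_pos_le one_pos] with η hC hη t ht a a' u u' ha ha' hu hu'
      refine (hC t ht a a' a a' u u' ha ha' ha ha' hu hu').trans ?_
      have := hη.1.le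
      calc _ ≤ C * η * (2 * (|a - a'| + |u - u'|)) * (1 + |t / η| ^ D.p) := by
            gcongr
            linarith [abs_nonneg (u - u')]
        _ = _ := by ring)
  refine ⟨y, ⟨⟨M, hy.mono fun η h => ⟨h.1, h.2.1⟩⟩, ?_⟩, ?_⟩
  · filter_upwards [hy, eventually_pos_le one_pos] with η h hη
    exact (hD.solvesSystem_iff hη.1 _ _ _ _).2 h.2.2
  · rintro y' ⟨⟨M', hM'⟩, hs⟩
    refine huniq y' M' ?_
    filter_upwards [hM', hs, eventually_pos_le one_pos] with η h h' hη
    exact ⟨h.1, h.2, (hD.solvesSystem_iff hη.1 _ _ _ _).1 h'⟩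

theorem isXiImage_xi {x : CoupleFamily} (hx : x ∈ D.xiDomain) : D.IsXiImage x (D.xi x) := by
  rw [xi, dif_pos hx]
  exact (Exists.choose_spec hx).1

theorem DiffBigO.diffLittleO {r : ℝ} {K : ℕ} {x y : CoupleFamily} (h : DiffBigO r (K + 1) x y) :
    DiffLittleO r K x y := by
  obtain ⟨C, hC⟩ := h
  intro ε hε
  filter_upwards [hC, eventually_pos_le (c := ε / (|C| + 1)) (by positivity)] with η h hη
  have h0 := hη.1.le
  have h1 := hη.2
  rw [le_div_iff₀ (by positivity)] at h1
  have e : C * η ^ (K + 1) ≤ ε * η ^ K := by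
    rw [pow_succ, mul_comm (η ^ K), ← mul_assoc]
    gcongr
    nlinarith [le_abs_self C]
  exact ⟨h.1.trans e, fun t ht => (h.2 t ht).trans e⟩

/-- The formal operator on truncated series. -/
noncomputable def formalXi (D : CanardData) (K : ℕ) (c : D.FormalSpace K) : D.FormalSpace K :=
  fun n => D.xiSeries (D.extendZero c) n

/-- Coefficients of the image up to order `K` depend only on those of the input up to order `K`, so
padding with zeros or truncating does not matter. -/
theorem compatible_formalXi : D.Compatible D.formalXi := by
  intro K
  funext c n
  refine xiSeries_congr fun m hm => ?_
  have hn := n.2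
  have hn' : (n.castSucc : ℕ) = n := rfl
  rw [extendZero_apply c (by omega), extendZero_apply (D.proj K c) (by omega)]
  rfl

/-- The input is itself a partial sum, so its expansion is known in advance at every order needed.
The error obtained is `O(η^(K+1))`, stronger than `o(η^K)`. -/
theorem Admissible.formallyEquivalent_formalXi (hD : D.Admissible) (hlin : D.IsLinear) :
    D.FormallyEquivalent D.formalXi := by
  intro c _ K
  have e : D.realize (c K) = D.partialSum (D.extendZero (c K)) (K + 1) :=
    realize_eq_partialSum _ _ fun n => (extendZero_apply (c K) n.2).symm
  have hbd := hD.isBoundedFamily_partialSum (D.extendZero (c K)) (K + 1)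
  have hdom : D.realize (c K) ∈ D.xiDomain := by
    rw [e]
    exact hD.mem_xiDomain hbd (hD.continuousOn_partialSum _ _)
  refine ⟨hdom, fun r hr => DiffBigO.diffLittleO ?_⟩
  rw [realize_eq_partialSum (D.formalXi K (c K)) (D.xiSeries (D.extendZero (c K))) fun _ => rfl]
  have hxi := isXiImage_xi hdom
  rw [e] at hxi ⊢
  refine hD.expansion_of_isXiImage hxi hbd (hD.consistent_xiSeries hlin _) (K := K) ?_ _ le_rfl r hr
  intro n hn _ r hr
  exact (hD.diffBigO_partialSum hr.2.le _ (hn.trans K.le_succ)).trans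
    (hD.diffBigO_partialSum_succ hr.2.le _ n).symm

theorem formalXi_fixedSeries (K : ℕ) :
    D.formalXi K (fun n : Fin (K + 1) => D.fixedSeries n) = fun n : Fin (K + 1) => D.fixedSeries n := by
  funext n
  have : D.xiSeries (D.extendZero (K := K) fun n : Fin (K + 1) => D.fixedSeries n) n = D.xiSeries D.fixedSeries n :=
    xiSeries_congr fun m hm => extendZero_apply (K := K) (fun n : Fin (K + 1) => D.fixedSeries n) (by omega)
  rw [formalXi, this, xiSeries_fixedSeries]

/-- Input and output coincide, and so do their formal series: the expansion of the input needed at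
each order is the one just established for the output. -/
theorem Admissible.isSemiAsymptoticExpansion_fixedSeries (hD : D.Admissible) (hlin : D.IsLinear)
    {y : CoupleFamily} (hy : D.IsCanardSolution y) :
    D.IsSemiAsymptoticExpansion y fun K (n : Fin (K + 1)) => D.fixedSeries n := by
  refine ⟨fun _ => rfl, fun r hr K => ?_⟩
  rw [realize_eq_partialSum _ D.fixedSeries fun _ => rfl]
  refine hD.expansion_of_isXiImage hy hy.1 (c := D.fixedSeries) (K := K) (fun N => ?_)
    (fun n _ h r hr => (h r hr).trans (hD.diffBigO_partialSum_succ hr.2.le _ n).symm) _ le_rfl r hr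
  have := hD.consistent_xiSeries hlin D.fixedSeries N
  rwa [xiSeries_fixedSeries] at this

end CanardData

theorem theorem1 (D : CanardData) (hD : D.Admissible) (hlin : D.IsLinear) :
    ∃ Xi : (K : ℕ) → D.FormalSpace K → D.FormalSpace K,
      D.Compatible Xi ∧ D.FormallyEquivalent Xi ∧
      ∃ y : CoupleFamily, D.IsCanardSolution y ∧
        (∀ y' : CoupleFamily, D.IsCanardSolution y' → D.Agree y' y) ∧
        ∃ c : (K : ℕ) → D.FormalSpace K,
          (∀ K, Xi K (c K) = c K) ∧ D.IsSemiAsymptoticExpansion y c := by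
  obtain ⟨y, hy, huniq⟩ := hD.exists_canardSolution
  exact ⟨D.formalXi, D.compatible_formalXi, hD.formallyEquivalent_formalXi hlin, y, hy, huniq,
    fun _ n => D.fixedSeries n, CanardData.formalXi_fixedSeries,
    hD.isSemiAsymptoticExpansion_fixedSeries hlin hy⟩
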